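/- Let $d\ge 2$ and let $\omega\in\mathbb R^d$ be non-resonant, i.e. $\omega_1,\dots,\omega_d$ are linearly independent over $\mathbb Q$. On $\mathbb R^{2d}$ with coordinates $(x,y)$ put $I_j=\frac12(x_j^2+y_j^2)$, $\xi_j=\frac1{\sqrt2}(x_j+iy_j)$, $\eta_j=\frac1{\sqrt2}(x_j-iy_j)$. A function $H$ has an elliptic equilibrium of frequency $\omega$ at the origin if $H=\sum_j\omega_jI_j+O(|(x,y)|^3)$. In that case its Birkhoff normal form at the origin is the (unique) formal power series $B(I_1,\dots,I_d)$ such that $H\circ\Phi=B(I)$, as formal power series, for some formal exact symplectic transformation $\Phi=\mathrm{Id}+O^2(x,y)$; it is called divergent if its radius of convergence is $0$. (1) There exists a real entire Hamiltonian $H:\mathbb R^{2d}\to\mathbb R$ with an elliptic equilibrium of frequency $\omega$ at the origin whose Birkhoff normal form exists and is divergent. (2) Explicitly: let $p,q$ be indices with $|\omega_p|<|\omega_q|$, and let $C>0$. (a) If $\omega_p\omega_q<0$, let $(k_n,l_n)_{n\ge 0}$ be any sequence in $\mathbb N^2$ with $|k_n\omega_p+l_n\omega_q|<C/k_n$ and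 $k_n\ge 10e^{e^n}$ for all $n$, and put $F_n=a_n(\xi_p^{k_n}\xi_q^{l_n}+\eta_p^{k_n}\eta_q^{l_n})$ with $a_n=e^{-n(k_n+l_n)}$. (b) If $\omega_p\omega_q>0$, let $(k_n,l_n)_{n\ge 0}$ be any sequence in $\mathbb N^2$ with $|k_n\omega_p-l_n\omega_q|<C/k_n$ and $k_n\ge 10e^{e^n}$ for all $n$, and put $F_n=a_n(\xi_p^{k_n}\eta_q^{l_n}+\eta_p^{k_n}\xi_q^{l_n})$ with $a_n=e^{-n(k_n+l_n)}$. In both cases such sequences exist when $C=|\omega_q|$. For every $\zeta\in[0,1]^{\mathbb N}$ the series in $$H=(\omega_p+I_q)I_p+\omega_qI_q+\sum_{j\ne p,q}\omega_jI_j+\sum_{n\ge 0}\zeta_nF_n$$ converges everywhere and $H$ is a real entire Hamiltonian with an elliptic equilibrium of frequency $\omega$ at the origin; and there is a $\zeta\in[0,1]^{\mathbb N}$ for which the Birkhoff normal form of $H$ at the origin exists and is divergent. -/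

import Mathlib

open Topology

noncomputable section

namespace Birkhoff

/-- The phase space `ℝ^{2d}`. The coordinate `Sum.inl j` is `x_j`, the coordinate `Sum.inr j` is
`y_j`. -/
abbrev Phase (d : ℕ) : Type := Fin d ⊕ Fin d → ℝ

/-- Formal power series with real coefficients in the variables `(x, y)`. -/
abbrev PhaseSeries (d : ℕ) : Type := MvPowerSeries (Fin d ⊕ Fin d) ℝ

/-! ### Real entire functions, Taylor series, elliptic equilibria -/

/-- `h` converges at `z`, with sum `s` (for a numerical series indexed by multi-indices,
unconditional convergence is absolute convergence). -/
def ConvergesAtTo {d : ℕ} (h : PhaseSeries d) (z : Phase d) (s : ℝ) : Prop :=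
  HasSum (fun m : Fin d ⊕ Fin d →₀ ℕ => MvPowerSeries.coeff m h * m.prod fun v e => z v ^ e) s

/-- `H` is real entire: it is the sum of a power series that converges (absolutely) at every point
of `ℝ^{2d}`, equivalently, it extends to a holomorphic function on `ℂ^{2d}`. -/
def IsRealEntire {d : ℕ} (H : Phase d → ℝ) : Prop :=
  ∃ h : PhaseSeries d, ∀ z : Phase d, ConvergesAtTo h z (H z)

/-- `h` is the Taylor series at the origin of `H`, which is real analytic there: `h` converges
to `H` in a neighbourhood of the origin. -/
def HasTaylorSeries {d : ℕ} (H : Phase d → ℝ) (h : PhaseSeries d) : Prop :=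
  ∀ᶠ z in 𝓝 (0 : Phase d), ConvergesAtTo h z (H z)

/-- The action variable `I_j = (x_j² + y_j²) / 2`. -/
def action {d : ℕ} (j : Fin d) (z : Phase d) : ℝ :=
  (z (Sum.inl j) ^ 2 + z (Sum.inr j) ^ 2) / 2

/-- The origin is an elliptic equilibrium with frequency `ω` of the Hamiltonian flow of `H`:
`H = ∑ ω_j I_j + O³(x, y)`. -/
def IsEllipticEquilibrium {d : ℕ} (ω : Fin d → ℝ) (H : Phase d → ℝ) : Prop :=
  (fun z : Phase d => H z - ∑ j, ω j * action j z) =O[𝓝 0] fun z => ‖z‖ ^ 3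

/-! ### Formal Birkhoff normal forms -/

/-- The Jacobian matrix of a formal map. -/
def formalJacobian {d : ℕ} (Φ : Fin d ⊕ Fin d → PhaseSeries d) :
    Matrix (Fin d ⊕ Fin d) (Fin d ⊕ Fin d) (PhaseSeries d) :=
  Matrix.of fun v w => MvPowerSeries.pderiv ℝ w (Φ v)

/-- The coefficient along `dw` of the pull-back by `Φ` of the one-form `∑ y_j dx_j`. -/
def liouvillePullback {d : ℕ} (Φ : Fin d ⊕ Fin d → PhaseSeries d) (w : Fin d ⊕ Fin d) :
    PhaseSeries d :=
  ∑ j, Φ (Sum.inr j) * MvPowerSeries.pderiv ℝ w (Φ (Sum.inl j))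

/-- `Φ` is a formal exact symplectic transformation of the form `Id + O²(x, y)`. -/
structure IsFormalExactSymplectic {d : ℕ} (Φ : Fin d ⊕ Fin d → PhaseSeries d) : Prop where
  /-- `Φ - Id` has no affine terms -/
  tangent : ∀ v, ∀ m : Fin d ⊕ Fin d →₀ ℕ, m.degree ≤ 1 →
    MvPowerSeries.coeff m (Φ v) = MvPowerSeries.coeff m (MvPowerSeries.X v : PhaseSeries d)
  /-- the Jacobian matrix is symplectic -/
  symplectic : formalJacobian Φ ∈ Matrix.symplecticGroup (Fin d) (PhaseSeries d)
  /-- the one-form `Φ^* (y dx) - y dx` is the differential of a formal power series -/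
  exact : ∃ S : PhaseSeries d, ∀ w,
    liouvillePullback Φ w - liouvillePullback MvPowerSeries.X w = MvPowerSeries.pderiv ℝ w S

/-- The action variable `I_j` as a formal power series. -/
def actionSeries {d : ℕ} (j : Fin d) : PhaseSeries d :=
  MvPowerSeries.C (1 / 2 : ℝ) *
    (MvPowerSeries.X (Sum.inl j) ^ 2 + MvPowerSeries.X (Sum.inr j) ^ 2)

/-- `B`, a formal power series in `I_1, …, I_d`, is a Birkhoff normal form of the formal
Hamiltonian `h`: `h ∘ Φ = B(I)` for some formal exact symplectic `Φ = Id + O²`. -/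
def IsBirkhoffNormalForm {d : ℕ} (h : PhaseSeries d) (B : MvPowerSeries (Fin d) ℝ) : Prop :=
  ∃ Φ : Fin d ⊕ Fin d → PhaseSeries d, IsFormalExactSymplectic Φ ∧
    MvPowerSeries.subst Φ h = MvPowerSeries.subst actionSeries B

/-- The radius of convergence of `B` is `0`: for no `r > 0` does `B` converge absolutely on the
polydisc of radius `r`. -/
def IsDivergent {d : ℕ} (B : MvPowerSeries (Fin d) ℝ) : Prop :=
  ∀ r : ℝ, 0 < r →
    ¬ Summable fun m : Fin d →₀ ℕ => |MvPowerSeries.coeff m B| * r ^ m.degree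

/-- `H` is real analytic at the origin, it has a Birkhoff normal form there, and the Birkhoff
normal form diverges. -/
def HasDivergentBNF {d : ℕ} (H : Phase d → ℝ) : Prop :=
  ∃ h : PhaseSeries d, HasTaylorSeries H h ∧
    (∃ B, IsBirkhoffNormalForm h B) ∧ ∀ B, IsBirkhoffNormalForm h B → IsDivergent B

/-! ### The explicit Hamiltonians -/

/-- The complex coordinate `ξ_j = (x_j + i y_j) / √2`. -/
def xi {d : ℕ} (j : Fin d) (z : Phase d) : ℂ :=
  ((z (Sum.inl j) : ℂ) + Complex.I * (z (Sum.inr j) : ℂ)) / ((Real.sqrt 2 : ℝ) : ℂ)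

/-- The complex coordinate `η_j = (x_j - i y_j) / √2`. -/
def eta {d : ℕ} (j : Fin d) (z : Phase d) : ℂ :=
  ((z (Sum.inl j) : ℂ) - Complex.I * (z (Sum.inr j) : ℂ)) / ((Real.sqrt 2 : ℝ) : ℂ)

/-- `a_n = e^{-n (k_n + l_n)}`, for `k = k_n` and `l = l_n`. -/
def amplitude (n k l : ℕ) : ℝ := Real.exp (-((n : ℝ) * ((k : ℝ) + (l : ℝ))))

/-- `a_n (ξ_p^k ξ_q^l + η_p^k η_q^l)`; this complex number is real (see `modeOpp_eq`). -/
def modeOpp {d : ℕ} (p q : Fin d) (n k l : ℕ) (z : Phase d) : ℝ :=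
  ((amplitude n k l : ℂ) * (xi p z ^ k * xi q z ^ l + eta p z ^ k * eta q z ^ l)).re

/-- `a_n (ξ_p^k η_q^l + η_p^k ξ_q^l)`; this complex number is real (see `modeSame_eq`). -/
def modeSame {d : ℕ} (p q : Fin d) (n k l : ℕ) (z : Phase d) : ℝ :=
  ((amplitude n k l : ℂ) * (xi p z ^ k * eta q z ^ l + eta p z ^ k * xi q z ^ l)).re

lemma conj_xi {d : ℕ} (j : Fin d) (z : Phase d) : (starRingEnd ℂ) (xi j z) = eta j z := by
  simp [xi, eta, sub_eq_add_neg]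

lemma conj_eta {d : ℕ} (j : Fin d) (z : Phase d) : (starRingEnd ℂ) (eta j z) = xi j z := by
  simp [xi, eta]

lemma modeOpp_eq {d : ℕ} (p q : Fin d) (n k l : ℕ) (z : Phase d) :
    (modeOpp p q n k l z : ℂ) =
      (amplitude n k l : ℂ) * (xi p z ^ k * xi q z ^ l + eta p z ^ k * eta q z ^ l) := by
  refine Complex.conj_eq_iff_re.mp ?_
  simp [conj_xi, conj_eta, add_comm]

lemma modeSame_eq {d : ℕ} (p q : Fin d) (n k l : ℕ) (z : Phase d) :
    (modeSame p q n k l z : ℂ) =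
      (amplitude n k l : ℂ) * (xi p z ^ k * eta q z ^ l + eta p z ^ k * xi q z ^ l) := by
  refine Complex.conj_eq_iff_re.mp ?_
  simp [conj_xi, conj_eta, add_comm]

/-- The Hamiltonian `(ω_p + I_q) I_p + ω_q I_q + ∑_{j ≠ p, q} ω_j I_j + ∑_n ζ_n F_n`. -/
def perturbed {d : ℕ} (ω : Fin d → ℝ) (p q : Fin d) (F : ℕ → Phase d → ℝ) (ζ : ℕ → ℝ)
    (z : Phase d) : ℝ :=
  (∑ j, ω j * action j z) + action q z * action p z + ∑' n, ζ n * F n z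

/-- `|k_n α + l_n β| < C / k_n` and `k_n ≥ 10 e^{e^n}` for all `n`. -/
def IsApproximating (C α β : ℝ) (k l : ℕ → ℕ) : Prop :=
  ∀ n, |(k n : ℝ) * α + (l n : ℝ) * β| < C / (k n : ℝ) ∧
    10 * Real.exp (Real.exp (n : ℝ)) ≤ (k n : ℝ)

/-- For all `ζ ∈ [0,1]^ℕ` the series `∑ ζ_n F_n` converges everywhere, and the Hamiltonian it
defines is real entire with an elliptic equilibrium of frequency `ω` at the origin; for some
`ζ ∈ [0,1]^ℕ` its Birkhoff normal form diverges. -/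
def YieldsDivergentBNF {d : ℕ} (ω : Fin d → ℝ) (p q : Fin d) (F : ℕ → Phase d → ℝ) : Prop :=
  (∀ ζ : ℕ → ℝ, (∀ n, ζ n ∈ Set.Icc (0 : ℝ) 1) →
    (∀ z, Summable fun n => ζ n * F n z) ∧
      IsRealEntire (perturbed ω p q F ζ) ∧ IsEllipticEquilibrium ω (perturbed ω p q F ζ)) ∧
  ∃ ζ : ℕ → ℝ, (∀ n, ζ n ∈ Set.Icc (0 : ℝ) 1) ∧ HasDivergentBNF (perturbed ω p q F ζ)

end Birkhoff

end

/-! The proof is by contradiction, combining Baire's theorem with one explicit second-order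
computation. Write N = ∑ ω_j I_j + I_p I_q and H_ζ = N + ∑ ζ_n F_n. Non-resonance makes the
homological equation for ∑ ω_j I_j solvable modulo functions of the actions, so H_ζ is brought to a
normal form B_ζ by the Lie series of a generator built degree by degree (`expHam_generator`). The
normal form is unique (`IsBirkhoffNormalForm.eq_normalForm`), so it suffices that this particular
one diverges for some ζ.

Counting degrees, the coefficient of I^c in B_ζ is a polynomial in ζ of degree at most 2|c|
(`coeff_normalForm_mem_polyFun`). If B_ζ converged for every ζ in the cube, the closed sets on which
all coefficients are bounded by (A+1)^(|c|+1) would cover the cube, so one of them would contain a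
box constraining only a finite set I of coordinates (`exists_box_of_not_isDivergent`). Chebyshev's
extremal inequality extrapolates a polynomial of degree 2|c| at the price of a factor K^(2|c|), so
the coordinates in I can be moved to 0. For n outside I there remains the one-parameter family N + τ
F_n, and the τ²-coefficient of its normal form is bounded geometrically in |c|, with a ratio
independent of n.

That τ²-coefficient is computable: it is half the action part of {χ, F_n}, where {N, χ} = F_n
(`normalForm_expand`). On the mode ξ_p^k ξ_q^l η_q^m the operator {N, ·} is, up to a unit,
multiplication by δ + k I_q + (l - m) I_p with δ = k ω_p + (l - m) ω_q. Thus the twist I_p I_q turns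
the small divisor into the geometric series of 1/(δ + k I_q), and I_p^(k-1) I_q^(l+m+j) gets the
coefficient -(c² k²/δ)(-k/δ)^j (`coeff_actionPart_ham_modeSeries`). Letting j tend to infinity with
n fixed removes every prefactor, the amplitude included, and yields k_n/|δ_n| ≤ L for all n outside
I. But |δ_n| < C/k_n forces k_n/|δ_n| > k_n²/C, which is unbounded. -/

open Topology

noncomputable section

namespace Birkhoff

open MvPowerSeries

/-! ### The filtration by order -/

section Filtration

variable {σ τ R S : Type*} [CommRing R] [CommRing S]

/-- The power series all of whose terms have degree at least `m`. -/
def ordGE (σ R : Type*) [CommRing R] (m : ℕ) : Submodule R (MvPowerSeries σ R) where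
  carrier := {f | ∀ a : σ →₀ ℕ, a.degree < m → coeff a f = 0}
  add_mem' hf hg a ha := by simp [hf a ha, hg a ha]
  zero_mem' a _ := by simp
  smul_mem' c f hf a ha := by simp [hf a ha]

lemma ordGE_anti {m n : ℕ} (h : m ≤ n) {f : MvPowerSeries σ R} (hf : f ∈ ordGE σ R n) :
    f ∈ ordGE σ R m := fun a ha => hf a (ha.trans_le h)

lemma mem_ordGE_zero (f : MvPowerSeries σ R) : f ∈ ordGE σ R 0 := fun _ h => absurd h (by simp)

lemma mem_ordGE_iff_order {m : ℕ} {f : MvPowerSeries σ R} :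
    f ∈ ordGE σ R m ↔ (m : ℕ∞) ≤ f.order :=
  ⟨fun h => le_order fun a ha => h a (by exact_mod_cast ha),
    fun h a ha => coeff_of_lt_order (lt_of_lt_of_le (by exact_mod_cast ha) h)⟩

lemma mul_mem_ordGE {m n : ℕ} {f g : MvPowerSeries σ R} (hf : f ∈ ordGE σ R m)
    (hg : g ∈ ordGE σ R n) : f * g ∈ ordGE σ R (m + n) := by
  rw [mem_ordGE_iff_order] at *
  push_cast
  exact (add_le_add hf hg).trans le_order_mul

lemma pow_mem_ordGE {f : MvPowerSeries σ R} (hf : f ∈ ordGE σ R 1) (n : ℕ) :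
    f ^ n ∈ ordGE σ R n := by
  induction n with
  | zero => exact mem_ordGE_zero _
  | succ n ih => rw [pow_succ]; exact mul_mem_ordGE ih hf

lemma eq_zero_of_forall_mem_ordGE {f : MvPowerSeries σ R} (h : ∀ m, f ∈ ordGE σ R m) : f = 0 := by
  ext a
  simpa using h (a.degree + 1) a (Nat.lt_succ_self _)

lemma pderiv_mem_ordGE {m : ℕ} {f : MvPowerSeries σ R} (hf : f ∈ ordGE σ R m) (v : σ) :
    pderiv R v f ∈ ordGE σ R (m - 1) := by
  intro a ha
  rw [coeff_pderiv, hf _ (by simp [Finsupp.degree_single]; omega), zero_mul]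

lemma X_mem_ordGE (v : σ) : (X v : MvPowerSeries σ R) ∈ ordGE σ R 1 := by
  intro a ha
  have : a = 0 := (Finsupp.degree_eq_zero_iff a).1 (Nat.lt_one_iff.1 ha)
  simp [this]

lemma map_mem_ordGE (φ : R →+* S) {m : ℕ} {f : MvPowerSeries σ R} (hf : f ∈ ordGE σ R m) :
    MvPowerSeries.map φ f ∈ ordGE σ S m := fun a ha => by simp [hf a ha]

lemma constantCoeff_of_mem_ordGE {f : MvPowerSeries σ R} (hf : f ∈ ordGE σ R 1) :
    constantCoeff f = 0 := by
  simpa using hf 0 (by simp)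

lemma hasSubst_of_mem_ordGE [Finite σ] [Algebra R S] {a : σ → MvPowerSeries τ S}
    (ha : ∀ v, a v ∈ ordGE τ S 1) : HasSubst a :=
  hasSubst_of_constantCoeff_zero fun v => constantCoeff_of_mem_ordGE (ha v)

lemma subst_mem_ordGE [Finite σ] [Algebra R S] {a : σ → MvPowerSeries τ S}
    (ha : ∀ v, a v ∈ ordGE τ S 1) {m : ℕ} {f : MvPowerSeries σ R} (hf : f ∈ ordGE σ R m) :
    subst a f ∈ ordGE τ S m := by
  rw [mem_ordGE_iff_order] at *
  refine le_trans ?_ (le_order_subst (hasSubst_of_mem_ordGE (R := R) ha) f)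
  calc (m : ℕ∞) = 1 * m := (one_mul _).symm
    _ ≤ _ := by
      gcongr
      exact le_iInf fun v => by exact_mod_cast mem_ordGE_iff_order.1 (ha v)

lemma exists_sub_coe_mem_ordGE [Finite σ] (f : MvPowerSeries σ R) (m : ℕ) :
    ∃ p : MvPolynomial σ R, f - p ∈ ordGE σ R m := by
  refine ⟨truncTotal m f, fun a ha => ?_⟩
  simp [MvPolynomial.coeff_coe, coeff_truncTotal _ ha]

/-- An additive map that lowers the order by a bounded amount and vanishes on polynomials
is zero. -/
lemma eq_zero_of_coe_eq_zero [Finite σ] (c : ℕ) (E : MvPowerSeries σ R →+ MvPowerSeries τ S)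
    (hE : ∀ m f, f ∈ ordGE σ R m → E f ∈ ordGE τ S (m - c))
    (hp : ∀ p : MvPolynomial σ R, E p = 0) (f : MvPowerSeries σ R) : E f = 0 := by
  refine eq_zero_of_forall_mem_ordGE fun m => ?_
  -- The loss of c orders is compensated by approximating f to order m + c.
  obtain ⟨p, h⟩ := exists_sub_coe_mem_ordGE f (m + c)
  have := hE _ _ h
  rwa [map_sub, hp, sub_zero, Nat.add_sub_cancel] at this

/-- Two algebra homomorphisms that preserve the filtration agree if they agree on variables. -/
lemma algHom_eq_of_X [Finite σ] [Algebra R S] (U W : MvPowerSeries σ R →ₐ[R] MvPowerSeries τ S)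
    (hU : ∀ m f, f ∈ ordGE σ R m → U f ∈ ordGE τ S m)
    (hW : ∀ m f, f ∈ ordGE σ R m → W f ∈ ordGE τ S m)
    (hX : ∀ v, U (X v) = W (X v)) (f : MvPowerSeries σ R) : U f = W f := by
  refine sub_eq_zero.1 (eq_zero_of_coe_eq_zero 0
    (U.toLinearMap.toAddMonoidHom - W.toLinearMap.toAddMonoidHom)
    (fun m f hf => Submodule.sub_mem _ (hU m f hf) (hW m f hf)) (fun p => ?_) f)
  have : U.comp (MvPolynomial.coeToMvPowerSeries.algHom R) =
      W.comp (MvPolynomial.coeToMvPowerSeries.algHom R) :=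
    MvPolynomial.algHom_ext fun v => by simpa using hX v
  have := DFunLike.congr_fun this p
  simpa [sub_eq_zero] using this

/-- By Leibniz such a derivation kills polynomials, and these are dense for the order filtration; c
bounds the loss of order. -/
lemma derivation_eq_zero_of_X [Finite σ] (c : ℕ)
    (D : Derivation R (MvPowerSeries σ R) (MvPowerSeries σ R))
    (hD : ∀ m f, f ∈ ordGE σ R m → D f ∈ ordGE σ R (m - c))
    (hX : ∀ v, D (X v) = 0) (f : MvPowerSeries σ R) : D f = 0 := by
  refine eq_zero_of_coe_eq_zero c (D : MvPowerSeries σ R →ₗ[R] MvPowerSeries σ R).toAddMonoidHom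
    hD (fun p => ?_) f
  change D (p : MvPowerSeries σ R) = 0
  induction p using MvPolynomial.induction_on with
  | C a => rw [MvPolynomial.coe_C, c_eq_algebraMap, D.map_algebraMap]
  | add p q hp hq => rw [MvPolynomial.coe_add, map_add, hp, hq, add_zero]
  | mul_X p v hp => rw [MvPolynomial.coe_mul, D.leibniz, hp, MvPolynomial.coe_X, hX]; simp

end Filtration

/-! ### The Poisson bracket of formal power series -/

section Poisson

variable {d : ℕ} {R : Type*} [CommRing R]

/-- The algebra of formal power series on phase space, with coefficients in `R`. -/
abbrev PS (d : ℕ) (R : Type*) : Type _ := MvPowerSeries (Fin d ⊕ Fin d) R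

/-- The Hamiltonian derivation `g ↦ {f, g}`, linear in `f`. -/
def ham : PS d R →ₗ[R] Derivation R (PS d R) (PS d R) where
  toFun f := ∑ j, (pderiv R (Sum.inl j) f • pderiv R (Sum.inr j) -
    pderiv R (Sum.inr j) f • pderiv R (Sum.inl j))
  map_add' f g := by
    simp only [map_add, add_smul, ← Finset.sum_add_distrib]
    exact Finset.sum_congr rfl fun j _ => by abel
  map_smul' c f := by
    simp only [Derivation.map_smul, smul_assoc, Finset.smul_sum, smul_sub, RingHom.id_apply]

lemma ham_apply (f g : PS d R) :
    ham f g = ∑ j, (pderiv R (Sum.inl j) f * pderiv R (Sum.inr j) g -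
      pderiv R (Sum.inr j) f * pderiv R (Sum.inl j) g) := by
  change (∑ j, (pderiv R (Sum.inl j) f • pderiv R (Sum.inr j) -
    pderiv R (Sum.inr j) f • pderiv R (Sum.inl j)) :
      Derivation R (PS d R) (PS d R)) g = _
  rw [← Derivation.coeFnAddMonoidHom_apply, map_sum, Finset.sum_apply]
  rfl

lemma ham_antisymm (f g : PS d R) : ham f g = -ham g f := by
  simp only [ham_apply, ← Finset.sum_neg_distrib]
  exact Finset.sum_congr rfl fun j _ => by ring

lemma ham_mul_right (f g h : PS d R) : ham f (g * h) = g * ham f h + h * ham f g := by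
  simp [Derivation.leibniz]

lemma ham_mul_left (f g h : PS d R) : ham (f * g) h = f * ham g h + g * ham f h := by
  rw [ham_antisymm, ham_mul_right, ham_antisymm h g, ham_antisymm h f]; ring

lemma ham_C_left (c : R) (g : PS d R) : ham (C c) g = 0 := by
  simp [ham_apply]

lemma ham_C_right (c : R) (g : PS d R) : ham g (C c) = 0 := by
  simp [ham_apply]

lemma ham_X_inl (f : PS d R) (j : Fin d) : ham f (X (Sum.inl j)) = -pderiv R (Sum.inr j) f := by
  rw [ham_apply, Finset.sum_eq_single j]
  · simp [pderiv_X_of_ne]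
  · intro i _ hi
    simp [pderiv_X_of_ne, Ne.symm hi]
  · simp

lemma ham_X_inr (f : PS d R) (j : Fin d) : ham f (X (Sum.inr j)) = pderiv R (Sum.inl j) f := by
  rw [ham_apply, Finset.sum_eq_single j]
  · simp [pderiv_X_of_ne]
  · intro i _ hi
    simp [pderiv_X_of_ne, Ne.symm hi]
  · simp

lemma ham_mem_ordGE {m n k : ℕ} {f g : PS d R} (hf : f ∈ ordGE _ R m) (hg : g ∈ ordGE _ R n)
    (hk : k ≤ m - 1 + (n - 1)) : ham f g ∈ ordGE _ R k := by
  rw [ham_apply]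
  refine Submodule.sum_mem _ fun j _ => Submodule.sub_mem _ ?_ ?_ <;>
  exact ordGE_anti hk (mul_mem_ordGE (pderiv_mem_ordGE hf _) (pderiv_mem_ordGE hg _))

lemma pderiv_comm (v w : Fin d ⊕ Fin d) (f : PS d R) :
    pderiv R v (pderiv R w f) = pderiv R w (pderiv R v f) := by
  classical
  ext a
  simp only [coeff_pderiv, Finsupp.add_apply]
  by_cases h : v = w
  · subst h; ring
  · rw [Finsupp.single_apply, Finsupp.single_apply, if_neg h, if_neg (Ne.symm h),
      add_right_comm a]
    push_cast
    ring

lemma pderiv_ham (v : Fin d ⊕ Fin d) (f g : PS d R) :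
    pderiv R v (ham f g) = ham (pderiv R v f) g + ham f (pderiv R v g) := by
  simp only [ham_apply, map_sum, map_sub, Derivation.leibniz, smul_eq_mul,
    ← Finset.sum_add_distrib]
  refine Finset.sum_congr rfl fun j _ => ?_
  rw [pderiv_comm v (Sum.inl j) f, pderiv_comm v (Sum.inr j) f, pderiv_comm v (Sum.inl j) g,
    pderiv_comm v (Sum.inr j) g]
  ring

/-- The Jacobi identity. -/
lemma ham_ham (f g h : PS d R) : ham f (ham g h) = ham (ham f g) h + ham g (ham f h) := by
  -- Both sides are derivations in h, so only the variables need checking; there the identity is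
  -- `pderiv_ham`. A double bracket loses at most two orders.
  have key := derivation_eq_zero_of_X 2 (⁅ham f, ham g⁆ - ham (ham f g) : Derivation R _ _)
    (fun m u hu => ?_) (fun v => ?_) h
  · rw [Derivation.sub_apply, Derivation.commutator_apply, sub_eq_zero] at key
    rw [← key]; ring
  · rw [Derivation.sub_apply, Derivation.commutator_apply]
    have h1 : ∀ f : PS d R, ∀ k u, u ∈ ordGE _ R k → ham f u ∈ ordGE _ R (k - 1) :=
      fun f k u hu => ham_mem_ordGE (mem_ordGE_zero f) hu (by omega)
    refine Submodule.sub_mem _ (Submodule.sub_mem _ ?_ ?_) ?_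
    · exact ordGE_anti (by omega) (h1 _ _ _ (h1 _ _ _ hu))
    · exact ordGE_anti (by omega) (h1 _ _ _ (h1 _ _ _ hu))
    · exact ordGE_anti (by omega) (h1 _ _ _ hu)
  · rw [Derivation.sub_apply, Derivation.commutator_apply]
    rcases v with j | j
    · rw [ham_X_inl, ham_X_inl, ham_X_inl, pderiv_ham, map_neg, map_neg,
        ham_antisymm g (pderiv R _ f)]
      ring
    · rw [ham_X_inr, ham_X_inr, ham_X_inr, pderiv_ham, ham_antisymm g (pderiv R _ f)]
      ring

/-- A filtered algebra homomorphism that multiplies the brackets of the variables by `c`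
multiplies all brackets by `c`. -/
lemma ham_algHom_of_X (U : PS d R →ₐ[R] PS d R) (c : R)
    (hU : ∀ m f, f ∈ ordGE _ R m → U f ∈ ordGE _ R m)
    (hX : ∀ v w, ham (U (X v)) (U (X w)) = c • U (ham (X v) (X w))) (f g : PS d R) :
    ham (U f) (U g) = c • U (ham f g) := by
  -- One argument is treated at a time: `step` passes from variables to all series on the left, and
  -- antisymmetry then lets it be used for the right argument as well.
  have step : ∀ g : PS d R, (∀ v, ham (U (X v)) (U g) = c • U (ham (X v) g)) →
      ∀ f, ham (U f) (U g) = c • U (ham f g) := by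
    intro g hg f
    refine sub_eq_zero.1 (eq_zero_of_coe_eq_zero 1
      (AddMonoidHom.mk' (fun f => ham (U f) (U g) - c • U (ham f g)) fun a b => ?_)
      (fun m f hf => ?_) (fun p => ?_) f)
    · simp only [map_add, Derivation.add_apply, smul_add]; ring
    · refine Submodule.sub_mem _ (ham_mem_ordGE (hU _ _ hf) (mem_ordGE_zero _) (by omega))
        (Submodule.smul_mem _ _ (hU _ _ (ham_mem_ordGE hf (mem_ordGE_zero _) (by omega))))
    · change ham (U p) (U g) - c • U (ham (p : PS d R) g) = 0
      rw [sub_eq_zero]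
      induction p using MvPolynomial.induction_on with
      | C a =>
        rw [MvPolynomial.coe_C, ham_C_left, c_eq_algebraMap, U.commutes, ← c_eq_algebraMap,
          ham_C_left]
        simp
      | add p q hp hq =>
        simp only [MvPolynomial.coe_add, map_add, Derivation.add_apply, hp, hq, smul_add]
      | mul_X p v hp =>
        rw [MvPolynomial.coe_mul, MvPolynomial.coe_X, map_mul, ham_mul_left, ham_mul_left, hp, hg,
          map_add, map_mul, map_mul, smul_add, mul_smul_comm, mul_smul_comm]
  refine step g (fun v => ?_) f
  rw [ham_antisymm, step (X v) (fun w => hX w v) g, ham_antisymm (X v) g, map_neg, smul_neg]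

end Poisson

end Birkhoff

namespace Birkhoff

open MvPowerSeries

/-! ### The time-one map of a formal Hamiltonian flow -/

section Exponential

variable {d : ℕ}

/-- The Hamiltonian derivation as an endomorphism. -/
def adHam (χ : PS d ℝ) : Module.End ℝ (PS d ℝ) := (ham χ : PS d ℝ →ₗ[ℝ] PS d ℝ)

@[simp] lemma adHam_apply (χ f : PS d ℝ) : adHam χ f = ham χ f := rfl

/-- A partial sum of the Lie series `∑ (ad χ)^k / k!`. -/
def expPartial (χ : PS d ℝ) (N : ℕ) : Module.End ℝ (PS d ℝ) :=
  ∑ k ∈ Finset.range N, ((k.factorial : ℝ)⁻¹) • adHam χ ^ k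

/-- The Lie series `∑ (ad χ)^k / k!`. -/
def expHam (χ : PS d ℝ) : PS d ℝ →ₗ[ℝ] PS d ℝ where
  -- For χ of order at least 3, `ad χ` raises the order by one, so the terms with k > |a| have no
  -- coefficient at a and the truncation is exact.
  toFun f := fun a => coeff a (expPartial χ (a.degree + 1) f)
  map_add' f g := by
    ext a
    change coeff a (expPartial χ (a.degree + 1) (f + g)) = coeff a _ + coeff a _
    rw [map_add, map_add]
  map_smul' c f := by
    ext a
    change coeff a (expPartial χ (a.degree + 1) (c • f)) = c * coeff a _
    rw [map_smul, coeff_smul]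

lemma coeff_expHam (χ f : PS d ℝ) (a : Fin d ⊕ Fin d →₀ ℕ) :
    coeff a (expHam χ f) = coeff a (expPartial χ (a.degree + 1) f) := rfl

lemma expPartial_apply (χ f : PS d ℝ) (N : ℕ) :
    expPartial χ N f = ∑ k ∈ Finset.range N, ((k.factorial : ℝ)⁻¹) • (adHam χ ^ k) f := by
  simp [expPartial]

lemma adHam_pow_mem {χ : PS d ℝ} (hχ : χ ∈ ordGE _ ℝ 3) {m : ℕ} {f : PS d ℝ}
    (hf : f ∈ ordGE _ ℝ m) (k : ℕ) : (adHam χ ^ k) f ∈ ordGE _ ℝ (m + k) := by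
  induction k with
  | zero => simpa using hf
  | succ k ih =>
    rw [pow_succ', Module.End.mul_apply]
    exact ham_mem_ordGE hχ ih (by omega)

lemma expPartial_mem {χ : PS d ℝ} (hχ : χ ∈ ordGE _ ℝ 3) {m : ℕ} {f : PS d ℝ}
    (hf : f ∈ ordGE _ ℝ m) (N : ℕ) : expPartial χ N f ∈ ordGE _ ℝ m := by
  rw [expPartial_apply]
  exact Submodule.sum_mem _ fun k _ => Submodule.smul_mem _ _
    (ordGE_anti (by omega) (adHam_pow_mem hχ hf k))

lemma expHam_sub_expPartial_mem {χ : PS d ℝ} (hχ : χ ∈ ordGE _ ℝ 3) (f : PS d ℝ) (N : ℕ) :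
    expHam χ f - expPartial χ N f ∈ ordGE _ ℝ N := by
  intro a ha
  rw [map_sub, coeff_expHam, sub_eq_zero, expPartial_apply, expPartial_apply, map_sum, map_sum]
  refine Finset.sum_subset (fun k hk => ?_) fun k _ hk => ?_
  · simp only [Finset.mem_range] at *; omega
  · simp only [Finset.mem_range, not_lt] at hk
    rw [coeff_smul, adHam_pow_mem hχ (mem_ordGE_zero f) k a (by omega), mul_zero]

lemma expHam_mem {χ : PS d ℝ} (hχ : χ ∈ ordGE _ ℝ 3) {m : ℕ} {f : PS d ℝ}
    (hf : f ∈ ordGE _ ℝ m) : expHam χ f ∈ ordGE _ ℝ m := by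
  rw [← sub_add_cancel (expHam χ f) (expPartial χ m f)]
  exact Submodule.add_mem _ (expHam_sub_expPartial_mem hχ f m) (expPartial_mem hχ hf m)

lemma expHam_sub_self_mem {χ : PS d ℝ} (hχ : χ ∈ ordGE _ ℝ 3) {m : ℕ} {f : PS d ℝ}
    (hf : f ∈ ordGE _ ℝ m) : expHam χ f - f ∈ ordGE _ ℝ (m + 1) := by
  rw [← sub_add_sub_cancel (expHam χ f) (expPartial χ (m + 1) f)]
  refine Submodule.add_mem _ (expHam_sub_expPartial_mem hχ f _) ?_
  rw [expPartial_apply, Finset.sum_range_succ']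
  simp only [Nat.factorial_zero, Nat.cast_one, inv_one, pow_zero, Module.End.one_apply, one_smul,
    add_sub_cancel_right]
  exact Submodule.sum_mem _ fun k _ => Submodule.smul_mem _ _
    (ordGE_anti (by omega) (adHam_pow_mem hχ hf (k + 1)))

/-- Rearrangement behind a Cauchy product: the square and the triangle i + j < N differ only by
terms with i + j ≥ N, which are negligible modulo W. -/
lemma sum_square_sub_sum_antidiagonal_mem {M : Type*} [AddCommGroup M] [Module ℝ M]
    (W : Submodule ℝ M) (F : ℕ → ℕ → M) (N : ℕ) (hF : ∀ i j, N ≤ i + j → F i j ∈ W) :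
    ∑ i ∈ Finset.range N, ∑ j ∈ Finset.range N, F i j -
      ∑ k ∈ Finset.range N, ∑ p ∈ Finset.HasAntidiagonal.antidiagonal k, F p.1 p.2 ∈ W := by
  have h1 : ∑ k ∈ Finset.range N, ∑ p ∈ Finset.HasAntidiagonal.antidiagonal k, F p.1 p.2 =
      ∑ p ∈ (Finset.range N ×ˢ Finset.range N) with p.1 + p.2 < N, F p.1 p.2 := by
    rw [← Finset.sum_fiberwise_of_maps_to (t := Finset.range N) (g := fun p : ℕ × ℕ => p.1 + p.2)]
    · refine Finset.sum_congr rfl fun k hk => Finset.sum_congr ?_ fun _ _ => rfl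
      ext p
      simp only [Finset.mem_range, Finset.HasAntidiagonal.mem_antidiagonal, Finset.mem_filter,
        Finset.mem_product] at *
      omega
    · intro p hp
      simpa using (Finset.mem_filter.1 hp).2
  rw [h1, ← Finset.sum_product', ← Finset.sum_filter_add_sum_filter_not _
    (fun p : ℕ × ℕ => p.1 + p.2 < N), add_sub_cancel_left]
  refine Submodule.sum_mem _ fun p hp => hF _ _ ?_
  simpa using (Finset.mem_filter.1 hp).2

/-- Leibniz' formula for the powers of a derivation; Pascal's rule gives the induction step. -/
lemma adHam_pow_bilin (χ : PS d ℝ) (β : PS d ℝ →ₗ[ℝ] PS d ℝ →ₗ[ℝ] PS d ℝ)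
    (hβ : ∀ f g, ham χ (β f g) = β (ham χ f) g + β f (ham χ g)) (f g : PS d ℝ) (k : ℕ) :
    (adHam χ ^ k) (β f g) = ∑ p ∈ Finset.HasAntidiagonal.antidiagonal k,
      k.choose p.1 • β ((adHam χ ^ p.1) f) ((adHam χ ^ p.2) g) := by
  induction k with
  | zero => simp
  | succ k ih =>
    rw [pow_succ', Module.End.mul_apply, ih, map_sum, Finset.sum_antidiagonal_choose_succ_nsmul
      (fun i j => β ((adHam χ ^ i) f) ((adHam χ ^ j) g)), ← Finset.sum_add_distrib]
    refine Finset.sum_congr rfl fun p hp => ?_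
    rw [map_nsmul, adHam_apply, hβ, ← Nat.choose_symm_of_eq_add
      (Finset.HasAntidiagonal.mem_antidiagonal.1 hp).symm, nsmul_add, pow_succ', pow_succ', add_comm]
    rfl

/-- The Lie series respects every bilinear operation for which `ad χ` is a derivation. -/
lemma expHam_bilin {χ : PS d ℝ} (hχ : χ ∈ ordGE _ ℝ 3)
    (β : PS d ℝ →ₗ[ℝ] PS d ℝ →ₗ[ℝ] PS d ℝ)
    (hβ : ∀ f g, ham χ (β f g) = β (ham χ f) g + β f (ham χ g))
    (hord : ∀ i j f g, f ∈ ordGE _ ℝ i → g ∈ ordGE _ ℝ j → β f g ∈ ordGE _ ℝ (i + j - 2))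
    (f g : PS d ℝ) : expHam χ (β f g) = β (expHam χ f) (expHam χ g) := by
  refine sub_eq_zero.1 (eq_zero_of_forall_mem_ordGE fun N => ?_)
  -- The truncation is at N + 2 because β may lose two orders, as the Poisson bracket does.
  have h1 := ordGE_anti (Nat.le_add_right N 2) (expHam_sub_expPartial_mem hχ (β f g) (N + 2))
  have h2 : β (expHam χ f - expPartial χ (N + 2) f) (expHam χ g) ∈ ordGE _ ℝ N :=
    ordGE_anti (by omega) (hord _ _ _ _ (expHam_sub_expPartial_mem hχ f (N + 2))
      (mem_ordGE_zero _))
  have h3 : β (expPartial χ (N + 2) f) (expHam χ g - expPartial χ (N + 2) g) ∈ ordGE _ ℝ N :=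
    ordGE_anti (by omega) (hord _ _ _ _ (mem_ordGE_zero _)
      (expHam_sub_expPartial_mem hχ g (N + 2)))
  have h4 := sum_square_sub_sum_antidiagonal_mem (ordGE (Fin d ⊕ Fin d) ℝ N)
    (fun i j => (((i.factorial : ℝ)⁻¹) * ((j.factorial : ℝ)⁻¹)) •
      β ((adHam χ ^ i) f) ((adHam χ ^ j) g)) (N + 2) fun i j hij =>
      Submodule.smul_mem _ _ (ordGE_anti (by omega) (hord _ _ _ _
        (adHam_pow_mem hχ (mem_ordGE_zero f) i) (adHam_pow_mem hχ (mem_ordGE_zero g) j)))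
  have h5 : expPartial χ (N + 2) (β f g) = ∑ k ∈ Finset.range (N + 2),
      ∑ p ∈ Finset.HasAntidiagonal.antidiagonal k, (((p.1.factorial : ℝ)⁻¹) * ((p.2.factorial : ℝ)⁻¹)) •
        β ((adHam χ ^ p.1) f) ((adHam χ ^ p.2) g) := by
    rw [expPartial_apply]
    refine Finset.sum_congr rfl fun k _ => ?_
    rw [adHam_pow_bilin χ β hβ, Finset.smul_sum]
    refine Finset.sum_congr rfl fun p hp => ?_
    rw [← Nat.cast_smul_eq_nsmul ℝ, smul_smul]
    congr 1
    have hp' := Finset.HasAntidiagonal.mem_antidiagonal.1 hp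
    subst hp'
    rw [Nat.choose_symm_add, ← Nat.add_choose_mul_factorial_mul_factorial p.1 p.2]
    have := (p.1 + p.2).choose_pos (Nat.le_add_left p.2 p.1)
    push_cast
    field_simp
  have h6 : β (expPartial χ (N + 2) f) (expPartial χ (N + 2) g) = ∑ i ∈ Finset.range (N + 2),
      ∑ j ∈ Finset.range (N + 2), (((i.factorial : ℝ)⁻¹) * ((j.factorial : ℝ)⁻¹)) •
        β ((adHam χ ^ i) f) ((adHam χ ^ j) g) := by
    rw [expPartial_apply χ f, expPartial_apply χ g, map_sum β, LinearMap.sum_apply]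
    refine Finset.sum_congr rfl fun i _ => ?_
    rw [map_sum]
    refine Finset.sum_congr rfl fun j _ => ?_
    rw [map_smul, map_smul, LinearMap.smul_apply, smul_smul, mul_comm]
  rw [← h5, ← h6] at h4
  have key : expHam χ (β f g) - β (expHam χ f) (expHam χ g) =
      (expHam χ (β f g) - expPartial χ (N + 2) (β f g)) -
      β (expHam χ f - expPartial χ (N + 2) f) (expHam χ g) -
      β (expPartial χ (N + 2) f) (expHam χ g - expPartial χ (N + 2) g) -
      (β (expPartial χ (N + 2) f) (expPartial χ (N + 2) g) - expPartial χ (N + 2) (β f g)) := by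
    simp only [map_sub, LinearMap.sub_apply]
    abel
  rw [key]
  exact Submodule.sub_mem _ (Submodule.sub_mem _ (Submodule.sub_mem _ h1 h2) h3) h4

lemma expHam_mul {χ : PS d ℝ} (hχ : χ ∈ ordGE _ ℝ 3) (f g : PS d ℝ) :
    expHam χ (f * g) = expHam χ f * expHam χ g := by
  refine expHam_bilin hχ (LinearMap.mul ℝ (PS d ℝ)) (fun f g => ?_)
    (fun i j f g hf hg => ordGE_anti (by omega) (mul_mem_ordGE hf hg)) f g
  simp only [LinearMap.mul_apply']
  rw [ham_mul_right]
  ring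

/-- The bracket as a bilinear map. -/
def hamBilin (d : ℕ) : PS d ℝ →ₗ[ℝ] PS d ℝ →ₗ[ℝ] PS d ℝ :=
  LinearMap.mk₂ ℝ (fun f g => ham f g) (by simp) (by simp) (by simp) (by simp)

lemma expHam_ham {χ : PS d ℝ} (hχ : χ ∈ ordGE _ ℝ 3) (f g : PS d ℝ) :
    expHam χ (ham f g) = ham (expHam χ f) (expHam χ g) :=
  expHam_bilin hχ (hamBilin d) (fun f g => ham_ham χ f g)
    (fun i j f g hf hg => ham_mem_ordGE hf hg (by omega)) f g

lemma expHam_one (χ : PS d ℝ) : expHam χ 1 = 1 := by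
  ext a
  rw [coeff_expHam, expPartial_apply, Finset.sum_range_succ']
  have : ∀ k, (adHam χ ^ (k + 1)) (1 : PS d ℝ) = 0 := fun k => by
    rw [pow_succ, Module.End.mul_apply, adHam_apply, Derivation.map_one_eq_zero, map_zero]
  simp [this]

/-- The Lie series as an algebra homomorphism. -/
def expAlgHom {χ : PS d ℝ} (hχ : χ ∈ ordGE _ ℝ 3) : PS d ℝ →ₐ[ℝ] PS d ℝ :=
  AlgHom.ofLinearMap (expHam χ) (expHam_one χ) (expHam_mul hχ)

@[simp] lemma expAlgHom_apply {χ : PS d ℝ} (hχ : χ ∈ ordGE _ ℝ 3) (f : PS d ℝ) :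
    expAlgHom hχ f = expHam χ f := rfl

/-- This is (1 - 1)^k / k!, expanded by the binomial theorem. -/
lemma sum_antidiagonal_neg_one_pow_inv_factorial (k : ℕ) (hk : k ≠ 0) :
    ∑ p ∈ Finset.HasAntidiagonal.antidiagonal k,
      ((p.1.factorial : ℝ)⁻¹ * (-1) ^ p.1) * (p.2.factorial : ℝ)⁻¹ = 0 := by
  have h := (Commute.all (-1 : ℝ) 1).add_pow' k
  rw [neg_add_cancel, zero_pow hk] at h
  have h2 : (k.factorial : ℝ) * ∑ p ∈ Finset.HasAntidiagonal.antidiagonal k,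
      ((p.1.factorial : ℝ)⁻¹ * (-1) ^ p.1) * (p.2.factorial : ℝ)⁻¹ = 0 := by
    rw [h, Finset.mul_sum]
    refine Finset.sum_congr rfl fun p hp => ?_
    have hp' := Finset.HasAntidiagonal.mem_antidiagonal.1 hp
    subst hp'
    rw [Nat.choose_symm_add, ← Nat.add_choose_mul_factorial_mul_factorial p.1 p.2]
    push_cast
    rw [nsmul_eq_mul, one_pow]
    field_simp
  exact (mul_eq_zero.1 h2).resolve_left (by positivity)

lemma adHam_neg_pow (χ f : PS d ℝ) (k : ℕ) :
    (adHam (-χ) ^ k) f = (-1 : ℝ) ^ k • (adHam χ ^ k) f := by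
  have : adHam (-χ) = (-1 : ℝ) • adHam χ := by
    ext1 g; simp
  rw [this, smul_pow]; rfl

/-- The product of the two truncated series is a sum over i + j = k of (-1)^i/(i! j!) (ad χ)^k; only
k = 0 survives, up to terms of high order. -/
lemma expHam_neg_expHam {χ : PS d ℝ} (hχ : χ ∈ ordGE _ ℝ 3) (f : PS d ℝ) :
    expHam (-χ) (expHam χ f) = f := by
  refine sub_eq_zero.1 (eq_zero_of_forall_mem_ordGE fun N => ?_)
  have hχ' : -χ ∈ ordGE _ ℝ 3 := Submodule.neg_mem _ hχ
  refine ordGE_anti (Nat.le_succ N) ?_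
  have h1 := expHam_mem hχ' (expHam_sub_expPartial_mem hχ f (N + 1))
  have h2 := expHam_sub_expPartial_mem hχ' (expPartial χ (N + 1) f) (N + 1)
  have h4 := sum_square_sub_sum_antidiagonal_mem (ordGE (Fin d ⊕ Fin d) ℝ (N + 1))
    (fun i j => (((i.factorial : ℝ)⁻¹ * (-1) ^ i) * ((j.factorial : ℝ)⁻¹)) •
      (adHam χ ^ (i + j)) f) (N + 1) fun i j hij =>
      Submodule.smul_mem _ _ (ordGE_anti (by omega) (adHam_pow_mem hχ (mem_ordGE_zero f) _))
  have h5 : ∑ k ∈ Finset.range (N + 1), ∑ p ∈ Finset.HasAntidiagonal.antidiagonal k,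
      (((p.1.factorial : ℝ)⁻¹ * (-1) ^ p.1) * ((p.2.factorial : ℝ)⁻¹)) •
      (adHam χ ^ (p.1 + p.2)) f = f := by
    rw [Finset.sum_eq_single 0]
    · simp
    · intro k _ hk
      have : ∀ p ∈ Finset.HasAntidiagonal.antidiagonal k,
          (((p.1.factorial : ℝ)⁻¹ * (-1) ^ p.1) * ((p.2.factorial : ℝ)⁻¹)) •
            (adHam χ ^ (p.1 + p.2)) f =
          (((p.1.factorial : ℝ)⁻¹ * (-1) ^ p.1) * ((p.2.factorial : ℝ)⁻¹)) •
            (adHam χ ^ k) f := fun p hp => by rw [Finset.HasAntidiagonal.mem_antidiagonal.1 hp]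
      rw [Finset.sum_congr rfl this, ← Finset.sum_smul,
        sum_antidiagonal_neg_one_pow_inv_factorial k hk, zero_smul]
    · simp
  have h6 : expPartial (-χ) (N + 1) (expPartial χ (N + 1) f) = ∑ i ∈ Finset.range (N + 1),
      ∑ j ∈ Finset.range (N + 1), (((i.factorial : ℝ)⁻¹ * (-1) ^ i) * ((j.factorial : ℝ)⁻¹)) •
      (adHam χ ^ (i + j)) f := by
    rw [expPartial_apply, expPartial_apply]
    refine Finset.sum_congr rfl fun i _ => ?_
    rw [map_sum, Finset.smul_sum]
    refine Finset.sum_congr rfl fun j _ => ?_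
    rw [map_smul, adHam_neg_pow, pow_add, Module.End.mul_apply, smul_smul, smul_smul]
    congr 1
    ring
  rw [h5, ← h6] at h4
  have key : expHam (-χ) (expHam χ f) - f =
      expHam (-χ) (expHam χ f - expPartial χ (N + 1) f) +
      (expHam (-χ) (expPartial χ (N + 1) f) -
        expPartial (-χ) (N + 1) (expPartial χ (N + 1) f)) +
      (expPartial (-χ) (N + 1) (expPartial χ (N + 1) f) - f) := by
    rw [map_sub]; abel
  rw [key]
  exact Submodule.add_mem _ (Submodule.add_mem _ h1 h2) h4

/-- The difference telescopes: the step from k to k + 1 applies `ad (χ + κ)` to the old difference,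
which gains an order, and adds {κ, (ad χ)^k h}, of order m + (2 + k) - 2. -/
lemma adHam_add_pow_sub_mem {χ κ h : PS d ℝ} {m : ℕ} (hm : 3 ≤ m) (hχ : χ ∈ ordGE _ ℝ 3)
    (hκ : κ ∈ ordGE _ ℝ m) (hh : h ∈ ordGE _ ℝ 2) (k : ℕ) :
    (adHam (χ + κ) ^ (k + 1)) h - (adHam χ ^ (k + 1)) h ∈ ordGE _ ℝ (m + k) := by
  have h1 : ∀ k, (adHam (χ + κ) ^ (k + 1)) h - (adHam χ ^ (k + 1)) h =
      ham (χ + κ) ((adHam (χ + κ) ^ k) h - (adHam χ ^ k) h) + ham κ ((adHam χ ^ k) h) := by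
    intro k
    rw [pow_succ', pow_succ', Module.End.mul_apply, Module.End.mul_apply, adHam_apply,
      adHam_apply, map_sub]
    simp only [map_add, Derivation.add_apply]
    abel
  have h2 : ∀ k, ham κ ((adHam χ ^ k) h) ∈ ordGE _ ℝ (m + k) := fun k =>
    ham_mem_ordGE hκ (adHam_pow_mem hχ hh k) (by omega)
  induction k with
  | zero => rw [h1]; simpa using h2 0
  | succ k ih =>
    rw [h1]
    exact Submodule.add_mem _ (ham_mem_ordGE (Submodule.add_mem _ hχ (ordGE_anti hm hκ)) ih
      (by omega)) (h2 (k + 1))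

/-- First-order dependence of the Lie series on the generator. -/
lemma expHam_add_sub_mem {χ κ h h₂ : PS d ℝ} {m : ℕ} (hm : 3 ≤ m) (hχ : χ ∈ ordGE _ ℝ 3)
    (hκ : κ ∈ ordGE _ ℝ m) (hh : h ∈ ordGE _ ℝ 2) (hh₂ : h - h₂ ∈ ordGE _ ℝ 3) :
    expHam (χ + κ) h - expHam χ h - ham κ h₂ ∈ ordGE _ ℝ (m + 1) := by
  have h1 := expHam_sub_expPartial_mem (Submodule.add_mem _ hχ (ordGE_anti hm hκ)) h (m + 1)
  have h2 := expHam_sub_expPartial_mem hχ h (m + 1)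
  have h3 : expPartial (χ + κ) (m + 1) h - expPartial χ (m + 1) h - ham κ h₂ ∈
      ordGE _ ℝ (m + 1) := by
    rw [expPartial_apply, expPartial_apply, ← Finset.sum_sub_distrib, Finset.sum_range_succ']
    -- Writing m = n + 1 exposes the terms k = 0, which cancel, and k = 1, which give {κ, h};
    -- replacing h by h₂ there costs order m + 1.
    obtain ⟨n, rfl⟩ : ∃ n, m = n + 1 := ⟨m - 1, by omega⟩
    rw [Finset.sum_range_succ']
    have e : ham κ h - ham κ h₂ ∈ ordGE _ ℝ (n + 1 + 1) := by
      rw [← map_sub]; exact ham_mem_ordGE hκ hh₂ (by omega)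
    simp only [zero_add, Nat.factorial_one, Nat.cast_one, inv_one, pow_one, one_smul,
      Nat.factorial_zero, pow_zero, sub_self, add_zero, adHam_apply, map_add,
      Derivation.add_apply, add_sub_cancel_left]
    rw [add_sub_assoc]
    refine Submodule.add_mem _ (Submodule.sum_mem _ fun k _ => ?_) e
    rw [← smul_sub]
    exact Submodule.smul_mem _ _ (ordGE_anti (by omega)
      (adHam_add_pow_sub_mem hm hχ hκ hh (k + 1)))
  have key : expHam (χ + κ) h - expHam χ h - ham κ h₂ =
      (expHam (χ + κ) h - expPartial (χ + κ) (m + 1) h) - (expHam χ h - expPartial χ (m + 1) h) +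
      (expPartial (χ + κ) (m + 1) h - expPartial χ (m + 1) h - ham κ h₂) := by abel
  rw [key]
  exact Submodule.add_mem _ (Submodule.sub_mem _ h1 h2) h3

end Exponential

end Birkhoff

namespace Birkhoff

open MvPowerSeries

/-! ### Complex coordinates -/

section Diagonal

variable {d : ℕ} {R : Type*} [CommRing R]

/-- The exponent of the monomial `∏ (x_j y_j)^{c_j}`. -/
def dia (c : Fin d →₀ ℕ) : Fin d ⊕ Fin d →₀ ℕ := Finsupp.sumElim c c

/-- The exponents of the variables `x_j` in a monomial. -/
def leftPart (a : Fin d ⊕ Fin d →₀ ℕ) : Fin d →₀ ℕ :=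
  Finsupp.equivFunOnFinite.symm fun j => a (Sum.inl j)

@[simp] lemma dia_inl (c : Fin d →₀ ℕ) (j : Fin d) : dia c (Sum.inl j) = c j := rfl
@[simp] lemma dia_inr (c : Fin d →₀ ℕ) (j : Fin d) : dia c (Sum.inr j) = c j := rfl
@[simp] lemma leftPart_apply (a : Fin d ⊕ Fin d →₀ ℕ) (j : Fin d) :
    leftPart a j = a (Sum.inl j) := rfl

@[simp] lemma leftPart_dia (c : Fin d →₀ ℕ) : leftPart (dia c) = c := by ext j; simp

/-- The monomial is a monomial in the products `x_j y_j`. -/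
def IsDia (a : Fin d ⊕ Fin d →₀ ℕ) : Prop := ∀ j, a (Sum.inl j) = a (Sum.inr j)

lemma isDia_dia (c : Fin d →₀ ℕ) : IsDia (dia c) := fun _ => rfl

lemma IsDia.eq_dia {a : Fin d ⊕ Fin d →₀ ℕ} (h : IsDia a) : a = dia (leftPart a) := by
  ext (j | j)
  · rfl
  · exact (h j).symm

lemma dia_injective : Function.Injective (dia : (Fin d →₀ ℕ) → _) := fun a b h => by
  rw [← leftPart_dia a, h, leftPart_dia]

lemma degree_phase (a : Fin d ⊕ Fin d →₀ ℕ) :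
    a.degree = ∑ j, a (Sum.inl j) + ∑ j, a (Sum.inr j) := by
  rw [Finsupp.degree_eq_sum, Fintype.sum_sum_type]

lemma degree_dia (c : Fin d →₀ ℕ) : (dia c).degree = 2 * c.degree := by
  rw [degree_phase, Finsupp.degree_eq_sum]; simp; ring

lemma dia_add (b c : Fin d →₀ ℕ) : dia (b + c) = dia b + dia c := by
  ext (j | j) <;> simp

open Classical in
/-- The power series `B(x_1 y_1, …, x_d y_d)`. -/
def diaSeries (B : MvPowerSeries (Fin d) R) : PS d R :=
  fun a => if IsDia a then coeff (leftPart a) B else 0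

lemma coeff_diaSeries_dia (B : MvPowerSeries (Fin d) R) (c : Fin d →₀ ℕ) :
    coeff (dia c) (diaSeries B) = coeff c B := by
  rw [coeff_apply, diaSeries, if_pos (isDia_dia c), leftPart_dia]

lemma coeff_diaSeries_of_not (B : MvPowerSeries (Fin d) R) {a : Fin d ⊕ Fin d →₀ ℕ}
    (h : ¬ IsDia a) : coeff a (diaSeries B) = 0 := by
  rw [coeff_apply, diaSeries, if_neg h]

lemma diaSeries_add (B B' : MvPowerSeries (Fin d) R) :
    diaSeries (B + B') = diaSeries B + diaSeries B' := by
  ext a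
  by_cases h : IsDia a
  · rw [h.eq_dia, map_add]; simp only [coeff_diaSeries_dia, map_add]
  · rw [map_add]; simp only [coeff_diaSeries_of_not _ h, add_zero]

lemma diaSeries_monomial (c : Fin d →₀ ℕ) (r : R) :
    diaSeries (monomial c r) = monomial (dia c) r := by
  classical
  ext a
  by_cases h : IsDia a
  · rw [h.eq_dia, coeff_diaSeries_dia, coeff_monomial, coeff_monomial]
    simp only [dia_injective.eq_iff]
  · rw [coeff_diaSeries_of_not _ h, coeff_monomial, if_neg]
    rintro rfl
    exact h (isDia_dia c)

lemma diaSeries_mem_ordGE {m : ℕ} {B : MvPowerSeries (Fin d) R} (hB : B ∈ ordGE _ R m) :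
    diaSeries B ∈ ordGE _ R m := by
  intro a ha
  by_cases h : IsDia a
  · rw [h.eq_dia, coeff_diaSeries_dia]
    rw [h.eq_dia, degree_dia] at ha
    exact hB _ (by omega)
  · exact coeff_diaSeries_of_not _ h

lemma coeff_X_mul_pderiv (v : Fin d ⊕ Fin d) (f : PS d R) (a : Fin d ⊕ Fin d →₀ ℕ) :
    coeff a (X v * pderiv R v f) = a v * coeff a f := by
  classical
  rw [X_def, coeff_monomial_mul]
  split_ifs with h
  · rw [coeff_pderiv, one_mul, tsub_add_cancel_of_le h]
    have : 1 ≤ a v := by simpa using h v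
    rw [Finsupp.tsub_apply, Finsupp.single_eq_same, Nat.cast_sub this]
    push_cast
    ring
  · have : a v = 0 := by
      by_contra h0
      exact h (Finsupp.single_le_iff.2 (Nat.one_le_iff_ne_zero.2 h0))
    simp [this]

/-- `x_j y_j` acts diagonally on monomials. -/
lemma coeff_ham_X_mul_X (j : Fin d) (f : PS d R) (a : Fin d ⊕ Fin d →₀ ℕ) :
    coeff a (ham (X (Sum.inl j) * X (Sum.inr j)) f) =
      ((a (Sum.inr j) : R) - a (Sum.inl j)) * coeff a f := by
  rw [ham_mul_left, ham_antisymm _ f, ham_antisymm _ f, ham_X_inl, ham_X_inr, neg_neg, mul_neg,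
    map_add, map_neg, coeff_X_mul_pderiv, coeff_X_mul_pderiv]
  ring

end Diagonal

/-! ### The linear change to the coordinates ξ, η. -/

section Complexification

variable {d : ℕ}

/-- `1 / √2`. -/
def invSqrtTwo : ℂ := ((Real.sqrt 2 : ℝ) : ℂ)⁻¹

lemma invSqrtTwo_sq : invSqrtTwo * invSqrtTwo = 1 / 2 := by
  rw [invSqrtTwo, ← mul_inv, ← Complex.ofReal_mul, Real.mul_self_sqrt (by norm_num)]
  norm_num

/-- `x_j` and `y_j` as functions of `ξ_j` and `η_j`. -/
def realCoord : Fin d ⊕ Fin d → PS d ℂ :=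
  Sum.elim (fun j => C invSqrtTwo * (X (Sum.inl j) + X (Sum.inr j)))
    (fun j => C (-Complex.I * invSqrtTwo) * (X (Sum.inl j) - X (Sum.inr j)))

/-- `ξ_j` and `η_j` as functions of `x_j` and `y_j`. -/
def complexCoord : Fin d ⊕ Fin d → PS d ℂ :=
  Sum.elim (fun j => C invSqrtTwo * (X (Sum.inl j) + C Complex.I * X (Sum.inr j)))
    (fun j => C invSqrtTwo * (X (Sum.inl j) - C Complex.I * X (Sum.inr j)))

lemma C_mul_mem_ordGE {σ R : Type*} [CommRing R] {m : ℕ} (c : R) {f : MvPowerSeries σ R}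
    (hf : f ∈ ordGE σ R m) : C c * f ∈ ordGE σ R m := by
  rw [← smul_eq_C_mul]; exact Submodule.smul_mem _ _ hf

lemma realCoord_mem (v : Fin d ⊕ Fin d) : realCoord v ∈ ordGE _ ℂ 1 := by
  rcases v with j | j
  · exact C_mul_mem_ordGE _ (Submodule.add_mem _ (X_mem_ordGE _) (X_mem_ordGE _))
  · exact C_mul_mem_ordGE _ (Submodule.sub_mem _ (X_mem_ordGE _) (X_mem_ordGE _))

lemma complexCoord_mem (v : Fin d ⊕ Fin d) : complexCoord v ∈ ordGE _ ℂ 1 := by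
  rcases v with j | j
  · exact C_mul_mem_ordGE _ (Submodule.add_mem _ (X_mem_ordGE _)
      (C_mul_mem_ordGE _ (X_mem_ordGE _)))
  · exact C_mul_mem_ordGE _ (Submodule.sub_mem _ (X_mem_ordGE _)
      (C_mul_mem_ordGE _ (X_mem_ordGE _)))

/-- Passage from the coordinates `(x, y)` to the coordinates `(ξ, η)`. -/
def toComplexCoord (d : ℕ) : PS d ℂ →ₐ[ℂ] PS d ℂ :=
  substAlgHom (hasSubst_of_mem_ordGE (R := ℂ) realCoord_mem)

/-- Passage from the coordinates `(ξ, η)` to the coordinates `(x, y)`. -/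
def toRealCoord (d : ℕ) : PS d ℂ →ₐ[ℂ] PS d ℂ :=
  substAlgHom (hasSubst_of_mem_ordGE (R := ℂ) complexCoord_mem)

lemma toComplexCoord_X (v : Fin d ⊕ Fin d) : toComplexCoord d (X v) = realCoord v :=
  substAlgHom_X _ v

lemma toRealCoord_X (v : Fin d ⊕ Fin d) : toRealCoord d (X v) = complexCoord v :=
  substAlgHom_X _ v

lemma toComplexCoord_mem {m : ℕ} {f : PS d ℂ} (hf : f ∈ ordGE _ ℂ m) :
    toComplexCoord d f ∈ ordGE _ ℂ m := by
  rw [toComplexCoord, substAlgHom_apply]; exact subst_mem_ordGE realCoord_mem hf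

lemma toRealCoord_mem {m : ℕ} {f : PS d ℂ} (hf : f ∈ ordGE _ ℂ m) :
    toRealCoord d f ∈ ordGE _ ℂ m := by
  rw [toRealCoord, substAlgHom_apply]; exact subst_mem_ordGE complexCoord_mem hf

lemma algHom_C {σ τ R : Type*} [CommRing R] (U : MvPowerSeries σ R →ₐ[R] MvPowerSeries τ R)
    (c : R) : U (C c) = C c := by
  rw [c_eq_algebraMap, U.commutes, c_eq_algebraMap]

lemma C_invSqrtTwo_sq : (C invSqrtTwo * C invSqrtTwo * 2 : PS d ℂ) = 1 := by
  rw [show (2 : PS d ℂ) = C 2 from (map_ofNat C 2).symm, ← map_mul, ← map_mul, invSqrtTwo_sq]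
  norm_num

lemma toRealCoord_toComplexCoord (f : PS d ℂ) : toRealCoord d (toComplexCoord d f) = f := by
  refine algHom_eq_of_X ((toRealCoord d).comp (toComplexCoord d)) (AlgHom.id ℂ _)
    (fun m f hf => toRealCoord_mem (toComplexCoord_mem hf)) (fun m f hf => hf) (fun v => ?_) f
  have h2 := C_invSqrtTwo_sq (d := d)
  have h4 : (C Complex.I * C Complex.I : PS d ℂ) = -1 := by
    rw [← map_mul, Complex.I_mul_I, map_neg, map_one]
  rcases v with j | j
  · simp only [AlgHom.comp_apply, toComplexCoord_X, realCoord, Sum.elim_inl, map_mul, map_add,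
      algHom_C, toRealCoord_X, complexCoord, Sum.elim_inr, AlgHom.id_apply]
    linear_combination X (Sum.inl j) * h2
  · simp only [AlgHom.comp_apply, toComplexCoord_X, realCoord, Sum.elim_inr, map_mul, map_sub,
      algHom_C, toRealCoord_X, complexCoord, Sum.elim_inl, AlgHom.id_apply, map_neg]
    linear_combination (-C Complex.I * C Complex.I * X (Sum.inr j)) * h2 -
      X (Sum.inr j) * h4

lemma ham_X_X {R : Type*} [CommRing R] (v w : Fin d ⊕ Fin d) :
    ham (X v : PS d R) (X w) = C ((Matrix.J (Fin d) R) w v) := by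
  classical
  rcases v with i | i <;> rcases w with j | j
  · rw [ham_X_inl, pderiv_X_of_ne (by simp)]; simp [Matrix.J]
  · rw [ham_X_inr, pderiv_X]
    by_cases h : i = j <;> simp [Matrix.J, h, Ne.symm]
  · rw [ham_X_inl, pderiv_X]
    by_cases h : i = j <;> simp [Matrix.J, h, Ne.symm]
  · rw [ham_X_inr, pderiv_X_of_ne (by simp)]; simp [Matrix.J]

lemma ham_C_mul_left {R : Type*} [CommRing R] (c : R) (f g : PS d R) :
    ham (C c * f) g = C c * ham f g := by
  rw [ham_mul_left, ham_C_left, mul_zero, add_zero]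

lemma ham_C_mul_right {R : Type*} [CommRing R] (c : R) (f g : PS d R) :
    ham f (C c * g) = C c * ham f g := by
  rw [ham_mul_right, ham_C_right, mul_zero, add_zero]

/-- The substitution is conformally symplectic: x = (ξ + η)/√2 and y = -i(ξ - η)/√2 have bracket i
when ξ, η are canonical. A check on the variables suffices. -/
lemma ham_toComplexCoord (f g : PS d ℂ) :
    ham (toComplexCoord d f) (toComplexCoord d g) = Complex.I • toComplexCoord d (ham f g) := by
  refine ham_algHom_of_X _ _ (fun m f hf => toComplexCoord_mem hf) (fun v w => ?_) f g
  rw [ham_X_X, algHom_C, toComplexCoord_X, toComplexCoord_X, smul_eq_C_mul, ← map_mul]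
  rcases v with i | i <;> rcases w with j | j <;>
  simp only [realCoord, Sum.elim_inl, Sum.elim_inr, ham_C_mul_left, ham_C_mul_right, map_add,
    map_sub, Derivation.add_apply, Derivation.sub_apply, ham_X_X] <;>
  (rcases eq_or_ne i j with rfl | h
   · simp only [Matrix.J, Matrix.fromBlocks_apply₁₁, Matrix.fromBlocks_apply₁₂,
      Matrix.fromBlocks_apply₂₁, Matrix.fromBlocks_apply₂₂, Matrix.one_apply, Matrix.zero_apply,
      Matrix.neg_apply, if_true, map_neg, map_one, map_zero, map_mul]
     first
     | ring1
     | linear_combination (C Complex.I) * C_invSqrtTwo_sq (d := d)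
     | linear_combination (-C Complex.I) * C_invSqrtTwo_sq (d := d)
   · simp only [Matrix.J, Matrix.fromBlocks_apply₁₁, Matrix.fromBlocks_apply₁₂,
      Matrix.fromBlocks_apply₂₁, Matrix.fromBlocks_apply₂₂, Matrix.one_apply, Matrix.zero_apply,
      Matrix.neg_apply, if_neg h.symm, map_zero, mul_zero, neg_zero, add_zero,
      sub_zero])

lemma ham_toRealCoord (f g : PS d ℂ) :
    ham (toRealCoord d f) (toRealCoord d g) = (-Complex.I) • toRealCoord d (ham f g) := by
  refine ham_algHom_of_X _ _ (fun m f hf => toRealCoord_mem hf) (fun v w => ?_) f g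
  rw [ham_X_X, algHom_C, toRealCoord_X, toRealCoord_X, smul_eq_C_mul, ← map_mul]
  rcases v with i | i <;> rcases w with j | j <;>
  simp only [complexCoord, Sum.elim_inl, Sum.elim_inr, ham_C_mul_left, ham_C_mul_right, map_add,
    map_sub, Derivation.add_apply, Derivation.sub_apply, ham_X_X] <;>
  (rcases eq_or_ne i j with rfl | h
   · simp only [Matrix.J, Matrix.fromBlocks_apply₁₁, Matrix.fromBlocks_apply₁₂,
      Matrix.fromBlocks_apply₂₁, Matrix.fromBlocks_apply₂₂, Matrix.one_apply, Matrix.zero_apply,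
      Matrix.neg_apply, if_true, map_neg, map_one, map_zero, map_mul]
     first
     | ring1
     | linear_combination (C Complex.I) * C_invSqrtTwo_sq (d := d)
     | linear_combination (-C Complex.I) * C_invSqrtTwo_sq (d := d)
   · simp only [Matrix.J, Matrix.fromBlocks_apply₁₁, Matrix.fromBlocks_apply₁₂,
      Matrix.fromBlocks_apply₂₁, Matrix.fromBlocks_apply₂₂, Matrix.one_apply, Matrix.zero_apply,
      Matrix.neg_apply, if_neg h.symm, map_zero, mul_zero, neg_zero, add_zero,
      sub_zero])

end Complexification

end Birkhoff

namespace Birkhoff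

open MvPowerSeries

/-! ### Real series in complex coordinates -/

section RealSeries

variable {d : ℕ}

/-- A real series as a complex series. -/
def ofRealSeries (d : ℕ) : PS d ℝ →ₐ[ℝ] PS d ℂ := MvPowerSeries.mapAlgHom Complex.ofRealAm

/-- The real part of a complex series. -/
def reSeries (d : ℕ) : PS d ℂ →ₗ[ℝ] PS d ℝ where
  toFun f := fun a => (coeff a f).re
  map_add' _ _ := rfl
  map_smul' c f := by
    ext a
    change (coeff a (c • f)).re = c * (coeff a f).re
    rw [show coeff a (c • f) = c • coeff a f from rfl, Complex.smul_re, smul_eq_mul]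

@[simp] lemma coeff_ofRealSeries (f : PS d ℝ) (a : Fin d ⊕ Fin d →₀ ℕ) :
    coeff a (ofRealSeries d f) = ((coeff a f : ℝ) : ℂ) := rfl

@[simp] lemma coeff_reSeries (f : PS d ℂ) (a : Fin d ⊕ Fin d →₀ ℕ) :
    coeff a (reSeries d f) = (coeff a f).re := rfl

lemma reSeries_ofRealSeries (f : PS d ℝ) : reSeries d (ofRealSeries d f) = f := by
  ext a; simp

lemma reSeries_I_smul_ofRealSeries (f : PS d ℝ) :
    reSeries d (Complex.I • ofRealSeries d f) = 0 := by
  ext a; simp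

lemma ofRealSeries_mem {m : ℕ} {f : PS d ℝ} (hf : f ∈ ordGE _ ℝ m) :
    ofRealSeries d f ∈ ordGE _ ℂ m := fun a ha => by simp [hf a ha]

lemma reSeries_mem {m : ℕ} {f : PS d ℂ} (hf : f ∈ ordGE _ ℂ m) :
    reSeries d f ∈ ordGE _ ℝ m := fun a ha => by simp [hf a ha]

lemma pderiv_ofRealSeries (v : Fin d ⊕ Fin d) (f : PS d ℝ) :
    pderiv ℂ v (ofRealSeries d f) = ofRealSeries d (pderiv ℝ v f) := by
  ext a; simp [coeff_pderiv]

lemma ham_ofRealSeries (f g : PS d ℝ) :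
    ham (ofRealSeries d f) (ofRealSeries d g) = ofRealSeries d (ham f g) := by
  simp only [ham_apply, map_sum, map_sub, map_mul, pderiv_ofRealSeries]

lemma reSeries_mul_ofRealSeries (f : PS d ℝ) (g : PS d ℂ) :
    reSeries d (ofRealSeries d f * g) = f * reSeries d g := by
  classical
  ext a
  simp [coeff_mul]

lemma pderiv_reSeries (v : Fin d ⊕ Fin d) (f : PS d ℂ) :
    pderiv ℝ v (reSeries d f) = reSeries d (pderiv ℂ v f) := by
  ext a
  simp only [coeff_pderiv, coeff_reSeries]
  rw [show ((a v : ℂ) + 1) = ((a v + 1 : ℝ) : ℂ) by push_cast; rfl, Complex.re_mul_ofReal]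

lemma ham_reSeries (f : PS d ℝ) (g : PS d ℂ) :
    ham f (reSeries d g) = reSeries d (ham (ofRealSeries d f) g) := by
  simp only [ham_apply, map_sum, map_sub, pderiv_ofRealSeries, pderiv_reSeries,
    reSeries_mul_ofRealSeries]

/-- A real series, written in the complex coordinates `(ξ, η)`. -/
def complexify (d : ℕ) : PS d ℝ →ₐ[ℝ] PS d ℂ :=
  ((toComplexCoord d).restrictScalars ℝ).comp (ofRealSeries d)

/-- The real part of a series given in the complex coordinates `(ξ, η)`. -/
def realify (d : ℕ) : PS d ℂ →ₗ[ℝ] PS d ℝ :=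
  reSeries d ∘ₗ ((toRealCoord d).restrictScalars ℝ).toLinearMap

lemma complexify_apply (f : PS d ℝ) :
    complexify d f = toComplexCoord d (ofRealSeries d f) := rfl

lemma realify_apply (f : PS d ℂ) : realify d f = reSeries d (toRealCoord d f) := rfl

lemma complexify_mem {m : ℕ} {f : PS d ℝ} (hf : f ∈ ordGE _ ℝ m) :
    complexify d f ∈ ordGE _ ℂ m := toComplexCoord_mem (ofRealSeries_mem hf)

lemma realify_mem {m : ℕ} {f : PS d ℂ} (hf : f ∈ ordGE _ ℂ m) :
    realify d f ∈ ordGE _ ℝ m := reSeries_mem (toRealCoord_mem hf)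

lemma realify_complexify (f : PS d ℝ) : realify d (complexify d f) = f := by
  rw [realify_apply, complexify_apply, toRealCoord_toComplexCoord, reSeries_ofRealSeries]

lemma realify_I_smul_complexify (f : PS d ℝ) : realify d (Complex.I • complexify d f) = 0 := by
  rw [realify_apply, complexify_apply, map_smul, toRealCoord_toComplexCoord,
    reSeries_I_smul_ofRealSeries]

lemma complexify_injective : Function.Injective (complexify d) :=
  Function.LeftInverse.injective realify_complexify

lemma ham_complexify (f g : PS d ℝ) :
    ham (complexify d f) (complexify d g) = Complex.I • complexify d (ham f g) := by
  rw [complexify_apply, complexify_apply, ham_toComplexCoord, ham_ofRealSeries, complexify_apply]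

/-- Solving a bracket equation in the complex coordinates solves it in the real ones. -/
lemma ham_realify (f : PS d ℝ) (g : PS d ℂ) :
    ham f (realify d g) = realify d ((-Complex.I) • ham (complexify d f) g) := by
  rw [realify_apply, ham_reSeries, realify_apply, map_smul, ← ham_toRealCoord, complexify_apply,
    toRealCoord_toComplexCoord]

lemma complexify_X_inl (j : Fin d) :
    complexify d (X (Sum.inl j)) = C invSqrtTwo * (X (Sum.inl j) + X (Sum.inr j)) := by
  rw [complexify_apply, ofRealSeries, mapAlgHom_apply]
  simp only [map_X]
  exact toComplexCoord_X _

lemma complexify_X_inr (j : Fin d) : complexify d (X (Sum.inr j)) =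
    C (-Complex.I * invSqrtTwo) * (X (Sum.inl j) - X (Sum.inr j)) := by
  rw [complexify_apply, ofRealSeries, mapAlgHom_apply]
  simp only [map_X]
  exact toComplexCoord_X _

lemma complexify_C (c : ℝ) : complexify d (C c) = C (c : ℂ) := by
  rw [complexify_apply, ofRealSeries, mapAlgHom_apply, map_C]
  exact algHom_C _ _

lemma complexify_actionSeries (j : Fin d) :
    complexify d (actionSeries j) = X (Sum.inl j) * X (Sum.inr j) := by
  have h2 := C_invSqrtTwo_sq (d := d)
  have h4 : (C Complex.I * C Complex.I : PS d ℂ) = -1 := by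
    rw [← map_mul, Complex.I_mul_I, map_neg, map_one]
  have h3 : (C ((1 / 2 : ℝ) : ℂ) * 2 : PS d ℂ) = 1 := by
    rw [show (2 : PS d ℂ) = C 2 from (map_ofNat C 2).symm, ← map_mul]; norm_num
  rw [actionSeries, map_mul, map_add, map_pow, map_pow, complexify_X_inl, complexify_X_inr,
    complexify_C]
  simp only [map_mul, map_neg]
  linear_combination (C ((1 / 2 : ℝ) : ℂ) * C invSqrtTwo * C invSqrtTwo *
    (X (Sum.inl j) - X (Sum.inr j)) ^ 2) * h4 +
    (C ((1 / 2 : ℝ) : ℂ) * 2 * X (Sum.inl j) * X (Sum.inr j)) * h2 +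
    (X (Sum.inl j) * X (Sum.inr j)) * h3

/-- The substitution of the actions into a series in `d` variables. -/
def ofActions (d : ℕ) : MvPowerSeries (Fin d) ℝ →ₐ[ℝ] PS d ℝ :=
  substAlgHom (hasSubst_of_mem_ordGE (R := ℝ) (a := actionSeries) fun _ =>
    ordGE_anti one_le_two (C_mul_mem_ordGE _
      (Submodule.add_mem _ (pow_mem_ordGE (X_mem_ordGE _) 2) (pow_mem_ordGE (X_mem_ordGE _) 2))))

lemma actionSeries_mem (j : Fin d) : (actionSeries j : PS d ℝ) ∈ ordGE _ ℝ 2 :=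
  C_mul_mem_ordGE _
    (Submodule.add_mem _ (pow_mem_ordGE (X_mem_ordGE _) 2) (pow_mem_ordGE (X_mem_ordGE _) 2))

lemma ofActions_apply (B : MvPowerSeries (Fin d) ℝ) :
    ofActions d B = MvPowerSeries.subst actionSeries B := substAlgHom_apply _ _

lemma ofActions_X (j : Fin d) : ofActions d (X j) = actionSeries j := substAlgHom_X _ _

lemma ofActions_mem {m : ℕ} {B : MvPowerSeries (Fin d) ℝ} (hB : B ∈ ordGE _ ℝ m) :
    ofActions d B ∈ ordGE _ ℝ m := by
  rw [ofActions_apply]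
  exact subst_mem_ordGE (fun j => ordGE_anti one_le_two (actionSeries_mem j)) hB

lemma dia_eq_sum (c : Fin d →₀ ℕ) : dia c = ∑ j, c j • dia (Finsupp.single j 1) := by
  classical
  ext (i | i) <;> simp [Finsupp.finsetSum_apply, Finsupp.single_apply]

/-- In complex coordinates, a series in the actions is diagonal. -/
lemma complexify_ofActions (B : MvPowerSeries (Fin d) ℝ) :
    complexify d (ofActions d B) = diaSeries (MvPowerSeries.map Complex.ofRealHom B) := by
  refine sub_eq_zero.1 (eq_zero_of_coe_eq_zero 0
    (AddMonoidHom.mk' (fun B => complexify d (ofActions d B) -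
      diaSeries (MvPowerSeries.map Complex.ofRealHom B)) fun a b => ?_)
    (fun m f hf => ?_) (fun p => ?_) B)
  · simp only [map_add, diaSeries_add]; abel
  · exact Submodule.sub_mem _ (complexify_mem (ofActions_mem hf))
      (diaSeries_mem_ordGE (map_mem_ordGE _ hf))
  · change complexify d (ofActions d p) - diaSeries (MvPowerSeries.map Complex.ofRealHom p) = 0
    induction p using MvPolynomial.induction_on' with
    | monomial c r =>
      rw [MvPolynomial.coe_monomial, map_monomial, diaSeries_monomial, ofActions,
        substAlgHom_monomial, Finsupp.prod_fintype _ _ (by simp)]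
      rw [← Algebra.smul_def, map_smul, map_prod]
      simp only [map_pow, complexify_actionSeries]
      have h1 : ∀ j : Fin d, (X (Sum.inl j) * X (Sum.inr j) : PS d ℂ) =
          monomial (dia (Finsupp.single j 1)) 1 := fun j => by
        rw [X_def, X_def, monomial_mul_monomial, one_mul]
        congr 2
        classical
        ext (i | i) <;> simp [Finsupp.single_apply]
      simp only [h1, monomial_pow, one_pow]
      rw [prod_monomial, ← dia_eq_sum, Finset.prod_const_one]
      classical
      ext a
      change r • coeff a (monomial (dia c) (1 : ℂ)) - coeff a (monomial (dia c) (r : ℂ)) = 0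
      simp [coeff_monomial]
    | add p q hp hq =>
      rw [sub_eq_zero] at *
      rw [MvPolynomial.coe_add, map_add, map_add, hp, hq, map_add, diaSeries_add]

lemma coeff_dia_complexify_ofActions (B : MvPowerSeries (Fin d) ℝ) (c : Fin d →₀ ℕ) :
    coeff (dia c) (complexify d (ofActions d B)) = ((coeff c B : ℝ) : ℂ) := by
  rw [complexify_ofActions, coeff_diaSeries_dia]; simp

lemma coeff_complexify_ofActions_of_not (B : MvPowerSeries (Fin d) ℝ)
    {a : Fin d ⊕ Fin d →₀ ℕ} (h : ¬ IsDia a) :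
    coeff a (complexify d (ofActions d B)) = 0 := by
  rw [complexify_ofActions, coeff_diaSeries_of_not _ h]

/-- The part of a real series that depends on the actions only. -/
def actionPart (d : ℕ) : PS d ℝ →ₗ[ℝ] MvPowerSeries (Fin d) ℝ where
  toFun f := fun c => (coeff (dia c) (complexify d f)).re
  map_add' f g := by
    ext c
    change (coeff (dia c) (complexify d (f + g))).re = _
    rw [map_add, map_add]; rfl
  map_smul' r f := by
    ext c
    change (coeff (dia c) (complexify d (r • f))).re = r * (coeff (dia c) (complexify d f)).re
    rw [map_smul, show coeff (dia c) (r • complexify d f) = r • coeff (dia c) (complexify d f)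
      from rfl, Complex.smul_re, smul_eq_mul]

lemma coeff_actionPart (f : PS d ℝ) (c : Fin d →₀ ℕ) :
    coeff c (actionPart d f) = (coeff (dia c) (complexify d f)).re := rfl

lemma actionPart_ofActions (B : MvPowerSeries (Fin d) ℝ) : actionPart d (ofActions d B) = B := by
  ext c
  rw [coeff_actionPart, coeff_dia_complexify_ofActions, Complex.ofReal_re]

lemma ofActions_injective : Function.Injective (ofActions d) :=
  Function.LeftInverse.injective actionPart_ofActions

open Classical in
/-- The diagonal part of a complex series. -/
def diaPart (g : PS d ℂ) : PS d ℂ := fun a => if IsDia a then coeff a g else 0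

lemma coeff_diaPart_of {g : PS d ℂ} {a : Fin d ⊕ Fin d →₀ ℕ} (h : IsDia a) :
    coeff a (diaPart g) = coeff a g := by rw [coeff_apply, diaPart, if_pos h]

lemma coeff_diaPart_of_not {g : PS d ℂ} {a : Fin d ⊕ Fin d →₀ ℕ} (h : ¬ IsDia a) :
    coeff a (diaPart g) = 0 := by rw [coeff_apply, diaPart, if_neg h]

/-- The series with given coefficients. -/
def ofCoeffs {σ R : Type*} (u : (σ →₀ ℕ) → R) : MvPowerSeries σ R := u

@[simp] lemma coeff_ofCoeffs {σ R : Type*} [Semiring R] (u : (σ →₀ ℕ) → R) (a : σ →₀ ℕ) :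
    coeff a (ofCoeffs u) = u a := rfl

/-- The diagonal coefficients are split into real and imaginary parts; `realify` kills the imaginary
ones, so it need not be known that they vanish. -/
lemma realify_diaPart (f : PS d ℝ) :
    realify d (diaPart (complexify d f)) = ofActions d (actionPart d f) := by
  have h : diaPart (complexify d f) = complexify d (ofActions d (actionPart d f)) +
      Complex.I • complexify d (ofActions d
        (ofCoeffs fun c => (coeff (dia c) (complexify d f)).im)) := by
    ext a
    rw [map_add, coeff_smul]
    by_cases h : IsDia a
    · rw [coeff_diaPart_of h, h.eq_dia, coeff_dia_complexify_ofActions,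
        coeff_dia_complexify_ofActions, coeff_actionPart, mul_comm, coeff_ofCoeffs]
      exact (Complex.re_add_im _).symm
    · rw [coeff_diaPart_of_not h, coeff_complexify_ofActions_of_not _ h,
        coeff_complexify_ofActions_of_not _ h]
      simp
  rw [h, map_add, realify_I_smul_complexify, add_zero, realify_complexify]

/-- The quadratic Hamiltonian `∑ ω_j I_j`. -/
def quadratic (ω : Fin d → ℝ) : PS d ℝ := ofActions d (∑ j, ω j • X j)

lemma complexify_quadratic (ω : Fin d → ℝ) :
    complexify d (quadratic ω) = ∑ j, (ω j : ℂ) • (X (Sum.inl j) * X (Sum.inr j)) := by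
  rw [quadratic, map_sum, map_sum]
  refine Finset.sum_congr rfl fun j _ => ?_
  rw [map_smul, map_smul, ofActions_X, complexify_actionSeries]
  rfl

/-- The eigenvalues of the quadratic Hamiltonian on monomials in `ξ`, `η`. -/
def eigenvalue (ω : Fin d → ℝ) (a : Fin d ⊕ Fin d →₀ ℕ) : ℝ :=
  ∑ j, ω j * ((a (Sum.inr j) : ℝ) - a (Sum.inl j))

lemma coeff_ham_quadratic (ω : Fin d → ℝ) (g : PS d ℂ) (a : Fin d ⊕ Fin d →₀ ℕ) :
    coeff a (ham (complexify d (quadratic ω)) g) = (eigenvalue ω a : ℂ) * coeff a g := by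
  rw [complexify_quadratic, map_sum, ← Derivation.coeFnAddMonoidHom_apply, map_sum,
    Finset.sum_apply, map_sum, eigenvalue, Complex.ofReal_sum, Finset.sum_mul]
  refine Finset.sum_congr rfl fun j _ => ?_
  rw [map_smul]
  change coeff a ((ω j : ℂ) • ham _ g) = _
  rw [coeff_smul, coeff_ham_X_mul_X]
  push_cast
  ring

/-- This is where non-resonance enters: an eigenvalue is an integer combination of the frequencies,
and rational independence makes all its coefficients vanish. -/
lemma eigenvalue_eq_zero_iff {ω : Fin d → ℝ} (hω : LinearIndependent ℚ ω)
    (a : Fin d ⊕ Fin d →₀ ℕ) : eigenvalue ω a = 0 ↔ IsDia a := by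
  constructor
  · intro h j
    have := Fintype.linearIndependent_iff.1 hω
      (fun j => (a (Sum.inr j) : ℚ) - a (Sum.inl j)) (by
        rw [← h, eigenvalue]
        refine Finset.sum_congr rfl fun j _ => ?_
        rw [Rat.smul_def]
        push_cast
        ring) j
    have h2 : (a (Sum.inr j) : ℚ) = a (Sum.inl j) := sub_eq_zero.1 this
    exact_mod_cast h2.symm
  · intro h
    exact Finset.sum_eq_zero fun j _ => by rw [h j]; ring

/-- Division of the coefficients by the eigenvalues of the quadratic Hamiltonian; the diagonal
coefficients are sent to `0`. -/
def divEigenvalue (ω : Fin d → ℝ) : PS d ℂ →ₗ[ℝ] PS d ℂ where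
  -- The factor i cancels the -i produced by `ham_realify`. On diagonal exponents the divisor is 0,
  -- and division by zero gives 0.
  toFun g := ofCoeffs fun a => Complex.I * coeff a g / eigenvalue ω a
  map_add' f g := by
    ext a
    simp only [map_add, coeff_ofCoeffs]; ring
  map_smul' r f := by
    ext a
    change Complex.I * (r • coeff a f) / _ = r • (Complex.I * coeff a f / _)
    rw [Complex.real_smul, Complex.real_smul]; ring

lemma coeff_divEigenvalue (ω : Fin d → ℝ) (g : PS d ℂ) (a : Fin d ⊕ Fin d →₀ ℕ) :
    coeff a (divEigenvalue ω g) = Complex.I * coeff a g / eigenvalue ω a := rfl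

/-- The solution operator of the homological equation. -/
def homological (ω : Fin d → ℝ) : PS d ℝ →ₗ[ℝ] PS d ℝ :=
  realify d ∘ₗ divEigenvalue ω ∘ₗ (complexify d).toLinearMap

lemma homological_apply (ω : Fin d → ℝ) (f : PS d ℝ) :
    homological ω f = realify d (divEigenvalue ω (complexify d f)) := rfl

lemma homological_mem (ω : Fin d → ℝ) {m : ℕ} {f : PS d ℝ} (hf : f ∈ ordGE _ ℝ m) :
    homological ω f ∈ ordGE _ ℝ m := by
  rw [homological_apply]
  refine realify_mem fun a ha => ?_
  rw [coeff_divEigenvalue, complexify_mem hf a ha]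
  simp

lemma homological_ofActions (ω : Fin d → ℝ) (B : MvPowerSeries (Fin d) ℝ) :
    homological ω (ofActions d B) = 0 := by
  rw [homological_apply, ← map_zero (realify d)]
  congr 1
  ext a
  rw [coeff_divEigenvalue]
  by_cases h : IsDia a
  · have : eigenvalue ω a = 0 := Finset.sum_eq_zero fun j _ => by rw [h j]; ring
    rw [this]; simp
  · rw [coeff_complexify_ofActions_of_not _ h]; simp

/-- The homological equation: off the diagonal the eigenvalues are nonzero and cancel; on it both
sides vanish. -/
lemma ham_homological {ω : Fin d → ℝ} (hω : LinearIndependent ℚ ω) (f : PS d ℝ) :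
    ham (quadratic ω) (homological ω f) = f - ofActions d (actionPart d f) := by
  rw [homological_apply, ham_realify, ← realify_diaPart]
  nth_rw 2 [← realify_complexify f]
  rw [← map_sub]
  congr 1
  ext a
  rw [coeff_smul, coeff_ham_quadratic, map_sub, coeff_divEigenvalue]
  by_cases h : IsDia a
  · rw [(eigenvalue_eq_zero_iff hω a).2 h, coeff_diaPart_of h]
    simp
  · have h1 : (eigenvalue ω a : ℂ) ≠ 0 := by
      exact_mod_cast fun h0 => h ((eigenvalue_eq_zero_iff hω a).1 h0)
    rw [coeff_diaPart_of_not h, sub_zero]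
    field_simp
    linear_combination (-coeff a (complexify d f)) * Complex.I_sq

end RealSeries

end Birkhoff

namespace Birkhoff

open MvPowerSeries

/-! ### Existence of the Birkhoff normal form -/

section Existence

variable {d : ℕ}

lemma quadratic_mem (ω : Fin d → ℝ) : quadratic ω ∈ ordGE _ ℝ 2 := by
  rw [quadratic, map_sum]
  refine Submodule.sum_mem _ fun j _ => ?_
  rw [map_smul, ofActions_X]
  exact Submodule.smul_mem _ _ (actionSeries_mem j)

lemma mem_ordGE_two_of_sub_quadratic {ω : Fin d → ℝ} {h : PS d ℝ}
    (hh : h - quadratic ω ∈ ordGE _ ℝ 3) : h ∈ ordGE _ ℝ 2 := by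
  rw [← sub_add_cancel h (quadratic ω)]
  exact Submodule.add_mem _ (ordGE_anti (by norm_num) hh) (quadratic_mem ω)

/-- Approximations to the generator of the normalizing transformation. -/
def genSeq (ω : Fin d → ℝ) (h : PS d ℝ) : ℕ → PS d ℝ
  | 0 => 0
  | n + 1 => genSeq ω h n + homological ω (expHam (genSeq ω h n) h)

/-- The generator of the normalizing transformation. -/
def generator (ω : Fin d → ℝ) (h : PS d ℝ) : PS d ℝ :=
  ofCoeffs fun a => coeff a (genSeq ω h a.degree)

/-- The Birkhoff normal form. -/
def normalForm (ω : Fin d → ℝ) (h : PS d ℝ) : MvPowerSeries (Fin d) ℝ :=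
  actionPart d (expHam (generator ω h) h)

lemma homological_mem_of_sub (ω : Fin d → ℝ) {m : ℕ} {f : PS d ℝ} {b : MvPowerSeries (Fin d) ℝ}
    (hb : f - ofActions d b ∈ ordGE _ ℝ m) : homological ω f ∈ ordGE _ ℝ m := by
  have := homological_mem ω hb
  rwa [map_sub, homological_ofActions, sub_zero] at this

/-- With κ the homological solution for f = exp(ad χ) h, the first-order change {κ, ∑ ω_j I_j} = -(f
- its action part) removes the part of f outside normal form. The remaining error is one order
higher by `expHam_add_sub_mem`. Updating one exponent, instead of composing maps, makes the limit a
single Lie series. -/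
lemma genSeq_spec {ω : Fin d → ℝ} (hω : LinearIndependent ℚ ω) {h : PS d ℝ}
    (hh : h - quadratic ω ∈ ordGE _ ℝ 3) (n : ℕ) :
    genSeq ω h n ∈ ordGE _ ℝ 3 ∧
      ∃ b, expHam (genSeq ω h n) h - ofActions d b ∈ ordGE _ ℝ (n + 3) := by
  induction n with
  | zero =>
    refine ⟨Submodule.zero_mem _, ∑ j, ω j • X j, ?_⟩
    have h1 := expHam_sub_self_mem (Submodule.zero_mem _ : (0 : PS d ℝ) ∈ ordGE _ ℝ 3)
      (mem_ordGE_two_of_sub_quadratic hh)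
    have h2 := Submodule.add_mem _ h1 hh
    rwa [sub_add_sub_cancel] at h2
  | succ n ih =>
    obtain ⟨h1, b, hb⟩ := ih
    have hκ := homological_mem_of_sub ω hb
    refine ⟨Submodule.add_mem _ h1 (ordGE_anti (by omega) hκ),
      actionPart d (expHam (genSeq ω h n) h), ?_⟩
    have h2 := expHam_add_sub_mem (by omega) h1 hκ (mem_ordGE_two_of_sub_quadratic hh) hh
    rw [ham_antisymm, ham_homological hω] at h2
    convert h2 using 1
    rw [genSeq]
    abel

lemma genSeq_succ_sub_mem {ω : Fin d → ℝ} (hω : LinearIndependent ℚ ω) {h : PS d ℝ}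
    (hh : h - quadratic ω ∈ ordGE _ ℝ 3) (n : ℕ) :
    genSeq ω h (n + 1) - genSeq ω h n ∈ ordGE _ ℝ (n + 3) := by
  obtain ⟨b, hb⟩ := (genSeq_spec hω hh n).2
  rw [genSeq, add_sub_cancel_left]
  exact homological_mem_of_sub ω hb

lemma genSeq_sub_mem {ω : Fin d → ℝ} (hω : LinearIndependent ℚ ω) {h : PS d ℝ}
    (hh : h - quadratic ω ∈ ordGE _ ℝ 3) {m n : ℕ} (hmn : m ≤ n) :
    genSeq ω h n - genSeq ω h m ∈ ordGE _ ℝ (m + 3) := by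
  induction n, hmn using Nat.le_induction with
  | base => rw [sub_self]; exact Submodule.zero_mem _
  | succ n hn ih =>
    rw [← sub_add_sub_cancel _ (genSeq ω h n)]
    exact Submodule.add_mem _ (ordGE_anti (by omega) (genSeq_succ_sub_mem hω hh n)) ih

/-- The increments have order at least n + 3, so the coefficient at a is already final at stage |a|;
hence the diagonal choice in `generator`. -/
lemma generator_sub_genSeq_mem {ω : Fin d → ℝ} (hω : LinearIndependent ℚ ω) {h : PS d ℝ}
    (hh : h - quadratic ω ∈ ordGE _ ℝ 3) (n : ℕ) :
    generator ω h - genSeq ω h n ∈ ordGE _ ℝ (n + 3) := by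
  intro a ha
  rw [map_sub, generator, coeff_ofCoeffs]
  rcases le_total n a.degree with hn | hn
  · have := genSeq_sub_mem hω hh hn a ha
    rwa [map_sub] at this
  · have := genSeq_sub_mem hω hh hn a (by omega)
    rw [map_sub] at this
    linear_combination -this

lemma generator_mem {ω : Fin d → ℝ} (hω : LinearIndependent ℚ ω) {h : PS d ℝ}
    (hh : h - quadratic ω ∈ ordGE _ ℝ 3) : generator ω h ∈ ordGE _ ℝ 3 := by
  simpa [genSeq] using generator_sub_genSeq_mem hω hh 0

/-- The generator brings `h` into normal form. -/
lemma expHam_generator {ω : Fin d → ℝ} (hω : LinearIndependent ℚ ω) {h : PS d ℝ}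
    (hh : h - quadratic ω ∈ ordGE _ ℝ 3) :
    expHam (generator ω h) h = ofActions d (normalForm ω h) := by
  refine sub_eq_zero.1 (eq_zero_of_forall_mem_ordGE fun n => ordGE_anti (Nat.le_add_right n 3) ?_)
  obtain ⟨h1, b, hb⟩ := genSeq_spec hω hh n
  have h2 := generator_sub_genSeq_mem hω hh n
  have h3 := expHam_add_sub_mem (by omega) h1 h2 (mem_ordGE_two_of_sub_quadratic hh) hh
  rw [add_sub_cancel] at h3
  have h4 : ham (generator ω h - genSeq ω h n) (quadratic ω) ∈ ordGE _ ℝ (n + 3) :=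
    ham_mem_ordGE h2 (quadratic_mem ω) (by omega)
  have h5 : expHam (generator ω h) h - ofActions d b ∈ ordGE _ ℝ (n + 3) := by
    have := Submodule.add_mem _ (Submodule.add_mem _ (ordGE_anti (by omega) h3) h4) hb
    convert this using 1
    abel
  -- Solving the homological equation and then bracketing is the projection f ↦ f - action part,
  -- which preserves the order and erases the unknown b.
  have h6 := ham_mem_ordGE (quadratic_mem ω) (homological_mem ω h5) (k := n + 3) (by omega)
  rw [ham_homological hω, map_sub, map_sub, actionPart_ofActions] at h6
  convert h6 using 1
  rw [normalForm]
  abel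

end Existence

/-! ### Formal symplectic transformations -/

section Symplectic

variable {d : ℕ}

/-- A closed formal one-form is exact. -/
lemma exists_primitive {σ : Type*} [Fintype σ] (g : σ → MvPowerSeries σ ℝ)
    (hg : ∀ v w, pderiv ℝ v (g w) = pderiv ℝ w (g v)) :
    ∃ S : MvPowerSeries σ ℝ, ∀ w, pderiv ℝ w S = g w := by
  classical
  -- Radial integration, as in Poincaré's lemma: S divides each homogeneous part of ∑ x_v g_v by its
  -- degree. In degree 0 the value is 0.
  refine ⟨ofCoeffs fun a => ((a.degree : ℝ)⁻¹) *
    ∑ v, if a v = 0 then 0 else coeff (a - Finsupp.single v 1) (g v), fun w => ?_⟩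
  ext a
  rw [coeff_pderiv, coeff_ofCoeffs]
  have key : ∀ v, (if (a + Finsupp.single w 1 : σ →₀ ℕ) v = 0 then 0
      else coeff (a + Finsupp.single w 1 - Finsupp.single v 1) (g v)) * ((a w : ℝ) + 1) =
      ((a + Finsupp.single w 1 : σ →₀ ℕ) v : ℝ) * coeff a (g w) := by
    intro v
    split_ifs with h0
    · rw [h0]; simp
    rcases eq_or_ne v w with rfl | hvw
    · rw [add_tsub_cancel_right, Finsupp.add_apply, Finsupp.single_eq_same]
      push_cast; ring
    · have hv : (Finsupp.single w 1 : σ →₀ ℕ) v = 0 := Finsupp.single_eq_of_ne hvw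
      have hav : 1 ≤ a v := by
        rw [Finsupp.add_apply, hv, add_zero] at h0; omega
      have hle : Finsupp.single v 1 ≤ a := Finsupp.single_le_iff.2 hav
      have := congrArg (coeff (a - Finsupp.single v 1)) (hg w v)
      rw [coeff_pderiv, coeff_pderiv, tsub_add_cancel_of_le hle, Finsupp.tsub_apply,
        Finsupp.tsub_apply, Finsupp.single_eq_same, Finsupp.single_eq_of_ne hvw.symm,
        Nat.cast_sub hav] at this
      rw [← tsub_add_eq_add_tsub hle, Finsupp.add_apply, hv, add_zero]
      simp only [tsub_zero, Nat.cast_one, sub_add_cancel] at this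
      rw [this]; ring
  rw [mul_assoc, Finset.sum_mul, Finset.sum_congr rfl fun v _ => key v, ← Finset.sum_mul,
    ← Nat.cast_sum, ← Finsupp.degree_eq_sum, inv_mul_cancel_left₀]
  rw [map_add, Finsupp.degree_single]
  positivity

/-- The arguments of the bracket are swapped because `Matrix.J` carries -1 in its upper right block.
Symplecticity thus becomes preservation of the brackets of the coordinates. -/
lemma formalJacobian_mul_J_mul_transpose (Φ : Fin d ⊕ Fin d → PS d ℝ) (v w : Fin d ⊕ Fin d) :
    (formalJacobian Φ * Matrix.J (Fin d) (PS d ℝ) * (formalJacobian Φ).transpose) v w =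
      ham (Φ w) (Φ v) := by
  rw [ham_apply]
  simp only [Matrix.mul_apply, Fintype.sum_sum_type, Matrix.J, Matrix.fromBlocks_apply₁₁,
    Matrix.fromBlocks_apply₁₂, Matrix.fromBlocks_apply₂₁, Matrix.fromBlocks_apply₂₂,
    Matrix.zero_apply, Matrix.neg_apply, mul_zero, Finset.sum_const_zero, zero_add, add_zero,
    mul_neg, Matrix.transpose_apply, formalJacobian, Matrix.of_apply, Matrix.one_apply, mul_ite,
    mul_one, Finset.sum_neg_distrib, Finset.sum_ite_eq', Finset.mem_univ, if_true, neg_mul]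
  rw [← Finset.sum_neg_distrib, ← Finset.sum_add_distrib]
  exact Finset.sum_congr rfl fun j _ => by ring

lemma formalJacobian_mem_iff (Φ : Fin d ⊕ Fin d → PS d ℝ) :
    formalJacobian Φ ∈ Matrix.symplecticGroup (Fin d) (PS d ℝ) ↔
      ∀ v w, ham (Φ v) (Φ w) = ham (X v : PS d ℝ) (X w) := by
  rw [SymplecticGroup.mem_iff, ← Matrix.ext_iff]
  simp only [formalJacobian_mul_J_mul_transpose, ham_X_X]
  have : ∀ v w, Matrix.J (Fin d) (PS d ℝ) v w = C (Matrix.J (Fin d) ℝ v w) := fun v w => by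
    rcases v with i | i <;> rcases w with j | j <;> simp [Matrix.J, Matrix.one_apply]
  simp only [this]
  exact ⟨fun h v w => h w v, fun h v w => h w v⟩

/-- The second derivatives cancel, so the exterior derivative of Φ^*(y dx) is DΦᵀ J DΦ. It is the
same for every symplectic Φ, and comparison with the identity shows that Φ^*(y dx) - y dx is closed.
-/
lemma pderiv_liouvillePullback_sub {Φ : Fin d ⊕ Fin d → PS d ℝ}
    (hΦ : formalJacobian Φ ∈ Matrix.symplecticGroup (Fin d) (PS d ℝ)) (v w : Fin d ⊕ Fin d) :
    pderiv ℝ v (liouvillePullback Φ w) - pderiv ℝ w (liouvillePullback Φ v) =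
      Matrix.J (Fin d) (PS d ℝ) v w := by
  rw [← SymplecticGroup.mem_iff'.1 hΦ]
  simp only [Matrix.mul_apply, Fintype.sum_sum_type, Matrix.J, Matrix.fromBlocks_apply₁₁,
    Matrix.fromBlocks_apply₁₂, Matrix.fromBlocks_apply₂₁, Matrix.fromBlocks_apply₂₂,
    Matrix.zero_apply, Matrix.neg_apply, mul_zero, Finset.sum_const_zero, zero_add, add_zero,
    mul_neg, Matrix.transpose_apply, formalJacobian, Matrix.of_apply, Matrix.one_apply, mul_ite,
    mul_one, Finset.sum_neg_distrib, Finset.sum_ite_eq', Finset.mem_univ, if_true, neg_mul,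
    liouvillePullback, map_sum, Derivation.leibniz, smul_eq_mul]
  rw [← Finset.sum_sub_distrib, ← Finset.sum_neg_distrib, ← Finset.sum_add_distrib]
  refine Finset.sum_congr rfl fun j _ => ?_
  rw [pderiv_comm v w]
  ring

lemma formalJacobian_X :
    formalJacobian (X : Fin d ⊕ Fin d → PS d ℝ) ∈ Matrix.symplecticGroup (Fin d) (PS d ℝ) :=
  (formalJacobian_mem_iff _).2 fun _ _ => rfl

/-- Identifies the Lie series with the substitution that the definition of a normal form asks for: a
homomorphism compatible with the filtration is determined by the variables. -/
lemma subst_eq_of_algHom (U : PS d ℝ →ₐ[ℝ] PS d ℝ)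
    (hU : ∀ m f, f ∈ ordGE _ ℝ m → U f ∈ ordGE _ ℝ m) (f : PS d ℝ) :
    MvPowerSeries.subst (fun v => U (X v)) f = U f := by
  have hX : ∀ v, U (X v) ∈ ordGE _ ℝ 1 := fun v => hU _ _ (X_mem_ordGE v)
  rw [← substAlgHom_apply (hasSubst_of_mem_ordGE (R := ℝ) hX)]
  refine algHom_eq_of_X _ _ (fun m f hf => ?_) hU (fun v => substAlgHom_X _ v) f
  rw [substAlgHom_apply]; exact subst_mem_ordGE hX hf

lemma isFormalExactSymplectic_expHam {χ : PS d ℝ} (hχ : χ ∈ ordGE _ ℝ 3) :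
    IsFormalExactSymplectic fun v => expHam χ (X v) where
  tangent v m hm := by
    have := expHam_sub_self_mem hχ (X_mem_ordGE v) m (by omega)
    rwa [map_sub, sub_eq_zero] at this
  symplectic := (formalJacobian_mem_iff _).2 fun v w => by
    rw [← expHam_ham hχ, ham_X_X, ← expAlgHom_apply hχ, algHom_C]
  exact := by
    have hs : formalJacobian (fun v => expHam χ (X v)) ∈
        Matrix.symplecticGroup (Fin d) (PS d ℝ) := (formalJacobian_mem_iff _).2 fun v w => by
      rw [← expHam_ham hχ, ham_X_X, ← expAlgHom_apply hχ, algHom_C]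
    obtain ⟨S, hS⟩ := exists_primitive (fun w => liouvillePullback (fun v => expHam χ (X v)) w -
      liouvillePullback MvPowerSeries.X w) fun v w => by
        have h1 := pderiv_liouvillePullback_sub hs v w
        have h2 := pderiv_liouvillePullback_sub (formalJacobian_X (d := d)) v w
        rw [map_sub, map_sub]
        linear_combination h1 - h2
    exact ⟨S, fun w => (hS w).symm⟩

lemma isBirkhoffNormalForm_of_expHam {χ h : PS d ℝ} (hχ : χ ∈ ordGE _ ℝ 3)
    {B : MvPowerSeries (Fin d) ℝ} (hB : expHam χ h = ofActions d B) :
    IsBirkhoffNormalForm h B := by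
  refine ⟨_, isFormalExactSymplectic_expHam hχ, ?_⟩
  rw [← ofActions_apply, ← hB]
  exact subst_eq_of_algHom (expAlgHom hχ) (fun m f hf => expHam_mem hχ hf) h

lemma isBirkhoffNormalForm_normalForm {ω : Fin d → ℝ} (hω : LinearIndependent ℚ ω) {h : PS d ℝ}
    (hh : h - quadratic ω ∈ ordGE _ ℝ 3) : IsBirkhoffNormalForm h (normalForm ω h) :=
  isBirkhoffNormalForm_of_expHam (generator_mem hω hh) (expHam_generator hω hh)

end Symplectic

end Birkhoff

namespace Birkhoff

open MvPowerSeries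

/-! ### Uniqueness of the Birkhoff normal form -/

section Uniqueness

variable {d : ℕ}

lemma ham_actionSeries_ofActions (j : Fin d) (B : MvPowerSeries (Fin d) ℝ) :
    ham (actionSeries j) (ofActions d B) = 0 := by
  have h1 : ham (complexify d (actionSeries j)) (complexify d (ofActions d B)) = 0 := by
    ext a
    rw [complexify_actionSeries, coeff_ham_X_mul_X, coeff_zero]
    by_cases h : IsDia a
    · rw [h j]; ring
    · rw [coeff_complexify_ofActions_of_not _ h, mul_zero]
  rw [ham_complexify] at h1
  have h2 := (smul_eq_zero.1 h1).resolve_left Complex.I_ne_zero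
  exact complexify_injective (by rw [h2, map_zero])

lemma ham_ofActions (B B' : MvPowerSeries (Fin d) ℝ) :
    ham (ofActions d B) (ofActions d B') = 0 := by
  refine eq_zero_of_coe_eq_zero 1
    (AddMonoidHom.mk' (fun B => ham (ofActions d B) (ofActions d B')) fun a b => by simp)
    (fun m f hf => ham_mem_ordGE (ofActions_mem hf) (mem_ordGE_zero _) (by omega)) (fun p => ?_) B
  change ham (ofActions d p) (ofActions d B') = 0
  induction p using MvPolynomial.induction_on with
  | C a =>
    rw [MvPolynomial.coe_C, c_eq_algebraMap, AlgHom.commutes, ← c_eq_algebraMap, ham_C_left]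
  | add p q hp hq => simp [hp, hq]
  | mul_X p v hp =>
    rw [MvPolynomial.coe_mul, MvPolynomial.coe_X, map_mul, ham_mul_left, hp, ofActions_X,
      ham_actionSeries_ofActions, mul_zero, mul_zero, add_zero]

lemma homological_ham {ω : Fin d → ℝ} (hω : LinearIndependent ℚ ω) (f : PS d ℝ) :
    homological ω (ham (quadratic ω) f) = f - ofActions d (actionPart d f) := by
  rw [homological_apply, ← realify_diaPart]
  nth_rw 2 [← realify_complexify f]
  rw [← map_sub]
  congr 1
  have h0 : complexify d (ham (quadratic ω) f) =
      (-Complex.I) • ham (complexify d (quadratic ω)) (complexify d f) := by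
    rw [ham_complexify, smul_smul, neg_mul, Complex.I_mul_I, neg_neg, one_smul]
  ext a
  rw [coeff_divEigenvalue, map_sub, h0, coeff_smul, coeff_ham_quadratic]
  by_cases h : IsDia a
  · rw [(eigenvalue_eq_zero_iff hω a).2 h, coeff_diaPart_of h]
    simp
  · have h1 : (eigenvalue ω a : ℂ) ≠ 0 := by
      exact_mod_cast fun h0 => h ((eigenvalue_eq_zero_iff hω a).1 h0)
    rw [coeff_diaPart_of_not h, sub_zero]
    field_simp
    linear_combination (-coeff a (complexify d f)) * Complex.I_sq

/-- The commutant of a non-resonant normal form consists of series in the actions. -/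
lemma eq_ofActions_of_ham_eq_zero {ω : Fin d → ℝ} (hω : LinearIndependent ℚ ω)
    {B : MvPowerSeries (Fin d) ℝ} (hB : ofActions d B - quadratic ω ∈ ordGE _ ℝ 3)
    {g : PS d ℝ} (hg : ham (ofActions d B) g = 0) : g = ofActions d (actionPart d g) := by
  set r := g - ofActions d (actionPart d g) with hr
  have h1 : ham (ofActions d B) r = 0 := by rw [hr, map_sub, hg, ham_ofActions, sub_zero]
  have h2 : actionPart d r = 0 := by rw [hr, map_sub, actionPart_ofActions, sub_self]
  have h3 : homological ω (ham (quadratic ω) r) = r := by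
    rw [homological_ham hω, h2, map_zero, sub_zero]
  refine sub_eq_zero.1 (eq_zero_of_forall_mem_ordGE fun m => ?_)
  rw [← hr]
  induction m with
  | zero => exact mem_ordGE_zero _
  | succ m ih =>
    rw [← h3]
    refine homological_mem ω ?_
    -- Since {B, r} = 0, the bracket with the quadratic part is minus that with B - ∑ ω_j I_j, which
    -- has order 3 and so gains one order; `homological` carries the gain back to r.
    have h4 : ham (quadratic ω) r = -ham (ofActions d B - quadratic ω) r := by
      rw [LinearMap.map_sub, Derivation.sub_apply, h1, zero_sub, neg_neg]
    rw [h4]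
    exact Submodule.neg_mem _ (ham_mem_ordGE hB ih (by omega))

/-! ### Symplectic automorphisms and the action variables. -/

section Automorphism

variable {V : PS d ℝ →ₐ[ℝ] PS d ℝ}

lemma map_actionSeries_sub_mem (hX : ∀ v, V (X v) - X v ∈ ordGE _ ℝ 2) (j : Fin d) :
    V (actionSeries j) - actionSeries j ∈ ordGE _ ℝ 3 := by
  have h1 : ∀ v, V (X v) ^ 2 - X v ^ 2 ∈ ordGE (Fin d ⊕ Fin d) ℝ 3 := fun v => by
    rw [sq_sub_sq, mul_comm]
    refine mul_mem_ordGE (hX v) (Submodule.add_mem _ ?_ (X_mem_ordGE v))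
    rw [← sub_add_cancel (V (X v)) (X v)]
    exact Submodule.add_mem _ (ordGE_anti one_le_two (hX v)) (X_mem_ordGE v)
  have h2 : V (actionSeries j) - actionSeries j = C (1 / 2 : ℝ) *
      ((V (X (Sum.inl j)) ^ 2 - X (Sum.inl j) ^ 2) +
        (V (X (Sum.inr j)) ^ 2 - X (Sum.inr j) ^ 2)) := by
    rw [actionSeries, map_mul, algHom_C, map_add, map_pow, map_pow]; ring
  rw [h2]
  exact C_mul_mem_ordGE _ (Submodule.add_mem _ (h1 _) (h1 _))

lemma ham_actionSeries_X_inl (i j : Fin d) : ham (actionSeries j : PS d ℝ) (X (Sum.inl i)) =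
    -(if i = j then X (Sum.inr i) else 0) := by
  rw [ham_X_inl, actionSeries, ← smul_eq_C_mul, Derivation.map_smul, map_add, pderiv_pow,
    pderiv_pow]
  split_ifs with h
  · subst h
    rw [pderiv_X_of_ne (by simp), pderiv_X_self, mul_zero, zero_add, mul_one, smul_eq_C_mul,
      Nat.cast_ofNat, ← mul_assoc, show (2 : PS d ℝ) = C 2 from (map_ofNat C 2).symm, ← map_mul]
    norm_num
  · rw [pderiv_X_of_ne (by simp), pderiv_X_of_ne (by simpa using fun e => h e.symm)]
    simp

lemma ham_actionSeries_X_inr (i j : Fin d) : ham (actionSeries j : PS d ℝ) (X (Sum.inr i)) =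
    if i = j then X (Sum.inl i) else 0 := by
  rw [ham_X_inr, actionSeries, ← smul_eq_C_mul, Derivation.map_smul, map_add, pderiv_pow,
    pderiv_pow]
  split_ifs with h
  · subst h
    rw [pderiv_X_self, pderiv_X_of_ne (by simp), mul_zero, add_zero, mul_one, smul_eq_C_mul,
      Nat.cast_ofNat, ← mul_assoc, show (2 : PS d ℝ) = C 2 from (map_ofNat C 2).symm, ← map_mul]
    norm_num
  · rw [pderiv_X_of_ne (by simpa using fun e => h e.symm), pderiv_X_of_ne (by simp)]
    simp

/-- The image of `√2 ξ_i` under `V`, in complex coordinates. -/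
def xiImage (V : PS d ℝ →ₐ[ℝ] PS d ℝ) (i : Fin d) : PS d ℂ :=
  complexify d (V (X (Sum.inl i))) + C Complex.I * complexify d (V (X (Sum.inr i)))

/-- ξ_i is an eigenvector of every {I_j, ·}, and V preserves brackets, so V ξ_i is an eigenvector of
{V I_j, ·} with the same eigenvalue. -/
lemma ham_xiImage (hV : ∀ f g, ham (V f) (V g) = V (ham f g)) (i j : Fin d) :
    ham (complexify d (V (actionSeries j))) (xiImage V i) =
      -(if i = j then xiImage V i else 0) := by
  rw [xiImage, map_add, ham_C_mul_right, ham_complexify, ham_complexify, hV, hV,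
    ham_actionSeries_X_inl, ham_actionSeries_X_inr, smul_eq_C_mul, smul_eq_C_mul]
  have h4 : (C Complex.I * C Complex.I : PS d ℂ) = -1 := by
    rw [← map_mul, Complex.I_mul_I, map_neg, map_one]
  split_ifs with h
  · rw [map_neg, map_neg]
    linear_combination (complexify d (V (X (Sum.inl i)))) * h4
  · simp

lemma xiImage_sub_mem (hX : ∀ v, V (X v) - X v ∈ ordGE _ ℝ 2) (i : Fin d) :
    xiImage V i - C (2 * invSqrtTwo) * X (Sum.inl i) ∈ ordGE _ ℂ 2 := by
  have h4 : (C Complex.I * C Complex.I : PS d ℂ) = -1 := by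
    rw [← map_mul, Complex.I_mul_I, map_neg, map_one]
  have h : xiImage V i - C (2 * invSqrtTwo) * X (Sum.inl i) =
      complexify d (V (X (Sum.inl i)) - X (Sum.inl i)) +
        C Complex.I * complexify d (V (X (Sum.inr i)) - X (Sum.inr i)) := by
    rw [map_sub, map_sub, complexify_X_inl, complexify_X_inr, xiImage, map_mul, map_mul,
      map_ofNat, map_neg]
    linear_combination (C invSqrtTwo * (X (Sum.inr i) - X (Sum.inl i))) * h4
  rw [h]
  exact Submodule.add_mem _ (complexify_mem (hX _)) (C_mul_mem_ordGE _ (complexify_mem (hX _)))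

lemma invSqrtTwo_ne_zero : invSqrtTwo ≠ 0 := fun h => by
  have := invSqrtTwo_sq
  rw [h] at this
  norm_num at this

/-- A symplectic automorphism tangent to the identity that maps the action `I_j` to a series in
the actions fixes `I_j`. -/
lemma map_actionSeries_eq (hX : ∀ v, V (X v) - X v ∈ ordGE _ ℝ 2)
    (hV : ∀ f g, ham (V f) (V g) = V (ham f g)) (j : Fin d) {g : MvPowerSeries (Fin d) ℝ}
    (hg : V (actionSeries j) = ofActions d g) : V (actionSeries j) = actionSeries j := by
  classical
  set e := g - X j with he
  have hE : V (actionSeries j) - actionSeries j = ofActions d e := by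
    rw [he, map_sub, ofActions_X, hg]
  refine sub_eq_zero.1 (eq_zero_of_forall_mem_ordGE fun m => ordGE_anti (Nat.le_add_right m 3) ?_)
  induction m with
  | zero => exact map_actionSeries_sub_mem hX j
  | succ m ih =>
    rw [← realify_complexify (V (actionSeries j) - actionSeries j)]
    refine realify_mem fun a ha => ?_
    rcases Nat.lt_or_ge a.degree (m + 3) with hlt | hge
    · exact complexify_mem ih a hlt
    rw [hE]
    by_cases hd : IsDia a
    swap
    · exact coeff_complexify_ofActions_of_not _ hd
    have hdeg : a.degree = m + 3 := by omega
    -- Let E = V I_j - I_j have a coefficient at the diagonal exponent a of lowest degree, and let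
    -- η_i divide that monomial. The equation for {V I_j, V ξ_i} is read at b, which is a with one
    -- η_i removed.
    obtain ⟨i, hi⟩ : ∃ i, a (Sum.inr i) ≠ 0 := by
      by_contra! hne
      have : a = 0 := by
        ext (i | i)
        · rw [hd i]; exact hne i
        · exact hne i
      rw [this] at hdeg
      simp at hdeg
    have hle : Finsupp.single (Sum.inr i) 1 ≤ a :=
      Finsupp.single_le_iff.2 (Nat.one_le_iff_ne_zero.2 hi)
    obtain ⟨b, rfl⟩ : ∃ b, a = b + Finsupp.single (Sum.inr i) 1 :=
      ⟨a - Finsupp.single (Sum.inr i) 1, (tsub_add_cancel_of_le hle).symm⟩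
    have hbdeg : b.degree = m + 2 := by
      rw [map_add, Finsupp.degree_single] at hdeg; omega
    set f := xiImage V i with hf
    set E := complexify d (ofActions d e) with hE'
    have hEm : E ∈ ordGE _ ℂ (m + 3) := by rw [hE', ← hE]; exact complexify_mem ih
    have h1 : ham E f + ham (X (Sum.inl j) * X (Sum.inr j)) f = -(if i = j then f else 0) := by
      rw [← ham_xiImage hV i j, ← Derivation.add_apply, ← map_add, hE', ← complexify_actionSeries,
        ← map_add, ← hE, sub_add_cancel]
    -- At the degree of b only the linear part √2 ξ_i of V ξ_i matters in {E, V ξ_i}, so the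
    -- coefficient there is a nonzero multiple of that of E at a.
    have h2 := ham_mem_ordGE hEm (xiImage_sub_mem hX i) (k := m + 3) (by omega) b (by omega)
    rw [map_sub, ham_C_mul_right, ham_X_inl, map_sub, coeff_C_mul, map_neg, coeff_pderiv] at h2
    have h3 := congrArg (coeff b) h1
    rw [map_add, coeff_ham_X_mul_X] at h3
    -- As a is diagonal, b differs from a diagonal exponent only at η_i, so {I_j, ·} at b already
    -- has the required eigenvalue. Hence {E, V ξ_i} vanishes at b.
    have h4 : ((b (Sum.inr j) : ℂ) - b (Sum.inl j)) * coeff b f =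
        coeff b (-(if i = j then f else 0)) := by
      have := hd j
      rw [Finsupp.add_apply, Finsupp.add_apply, Finsupp.single_apply, Finsupp.single_apply,
        if_neg (by simp), add_zero] at this
      rw [this]
      by_cases hij : i = j
      · subst hij; simp
      · simp [hij]
    rw [h4, add_eq_right] at h3
    rw [← hf, h3, zero_sub, mul_neg, neg_neg] at h2
    have h5 : (b (Sum.inr i) : ℂ) + 1 ≠ 0 := by exact_mod_cast Nat.succ_ne_zero (b (Sum.inr i))
    exact (mul_eq_zero.1 ((mul_eq_zero.1 h2).resolve_left
      (mul_ne_zero two_ne_zero invSqrtTwo_ne_zero))).resolve_right h5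

end Automorphism

/-- A symplectic automorphism tangent to the identity that maps a normal form to a normal form
fixes it. -/
lemma normalForm_unique {ω : Fin d → ℝ} (hω : LinearIndependent ℚ ω) {V : PS d ℝ →ₐ[ℝ] PS d ℝ}
    (hord : ∀ m f, f ∈ ordGE _ ℝ m → V f ∈ ordGE _ ℝ m)
    (hX : ∀ v, V (X v) - X v ∈ ordGE _ ℝ 2) (hV : ∀ f g, ham (V f) (V g) = V (ham f g))
    {B B' : MvPowerSeries (Fin d) ℝ} (hB : ofActions d B - quadratic ω ∈ ordGE _ ℝ 3)
    (h : V (ofActions d B) = ofActions d B') : B' = B := by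
  have hq : V (quadratic ω) - quadratic ω ∈ ordGE _ ℝ 3 := by
    rw [quadratic, map_sum, map_sum, ← Finset.sum_sub_distrib]
    refine Submodule.sum_mem _ fun j _ => ?_
    rw [map_smul, map_smul, ← smul_sub, ofActions_X]
    exact Submodule.smul_mem _ _ (map_actionSeries_sub_mem hX j)
  have hB' : ofActions d B' - quadratic ω ∈ ordGE _ ℝ 3 := by
    have := Submodule.add_mem _ (hord _ _ hB) hq
    rwa [map_sub, h, sub_add_sub_cancel] at this
  -- V I_j commutes with V B = B', hence is a function of the actions by non-resonance, hence equals
  -- I_j.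
  have hI : ∀ j, V (actionSeries j) = actionSeries j := fun j => by
    refine map_actionSeries_eq hX hV j (g := actionPart d (V (actionSeries j))) ?_
    refine eq_ofActions_of_ham_eq_zero hω hB' ?_
    rw [← h, hV, ham_antisymm, ham_actionSeries_ofActions, neg_zero, map_zero]
  have hJ : V (ofActions d B) = ofActions d B :=
    algHom_eq_of_X (V.comp (ofActions d)) (ofActions d)
      (fun m f hf => hord _ _ (ofActions_mem hf)) (fun m f hf => ofActions_mem hf)
      (fun j => by rw [AlgHom.comp_apply, ofActions_X, hI]) B
  exact ofActions_injective (h.symm.trans hJ)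

/-- The Birkhoff normal form is unique. -/
lemma IsBirkhoffNormalForm.eq_normalForm {ω : Fin d → ℝ} (hω : LinearIndependent ℚ ω)
    {h : PS d ℝ} (hh : h - quadratic ω ∈ ordGE _ ℝ 3) {B : MvPowerSeries (Fin d) ℝ}
    (hB : IsBirkhoffNormalForm h B) : B = normalForm ω h := by
  obtain ⟨Φ, hΦ, hB⟩ := hB
  have hχ := generator_mem hω hh
  have hχ' : -generator ω h ∈ ordGE _ ℝ 3 := Submodule.neg_mem _ hχ
  have hΦX : ∀ v, Φ v - X v ∈ ordGE _ ℝ 2 := fun v a ha => by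
    rw [map_sub, hΦ.tangent v a (by omega), sub_self]
  have hΦ1 : ∀ v, Φ v ∈ ordGE _ ℝ 1 := fun v => by
    rw [← sub_add_cancel (Φ v) (X v)]
    exact Submodule.add_mem _ (ordGE_anti one_le_two (hΦX v)) (X_mem_ordGE v)
  set U : PS d ℝ →ₐ[ℝ] PS d ℝ := substAlgHom (hasSubst_of_mem_ordGE (R := ℝ) hΦ1) with hU
  have hUord : ∀ m f, f ∈ ordGE _ ℝ m → U f ∈ ordGE _ ℝ m := fun m f hf => by
    rw [hU, substAlgHom_apply]; exact subst_mem_ordGE hΦ1 hf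
  have hUX : ∀ v, U (X v) = Φ v := fun v => substAlgHom_X _ v
  have hUham : ∀ f g, ham (U f) (U g) = U (ham f g) := fun f g => by
    rw [ham_algHom_of_X U 1 hUord (fun v w => ?_) f g, one_smul]
    rw [hUX, hUX, (formalJacobian_mem_iff Φ).1 hΦ.symplectic, one_smul, ham_X_X, algHom_C]
  -- Undoing the canonical normalization and then applying Φ carries the canonical normal form to B.
  refine normalForm_unique hω (V := U.comp (expAlgHom hχ'))
    (fun m f hf => hUord _ _ (expHam_mem hχ' hf)) (fun v => ?_) (fun f g => ?_)
    (B := normalForm ω h) ?_ ?_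
  · have h1 := hUord _ _ (expHam_sub_self_mem hχ' (X_mem_ordGE v))
    have h2 := Submodule.add_mem _ h1 (hΦX v)
    rwa [map_sub, hUX, sub_add_sub_cancel] at h2
  · simp only [AlgHom.comp_apply, expAlgHom_apply]
    rw [hUham, expHam_ham hχ']
  · rw [← expHam_generator hω hh]
    have := Submodule.add_mem _ (expHam_sub_self_mem hχ (mem_ordGE_two_of_sub_quadratic hh)) hh
    rwa [sub_add_sub_cancel] at this
  · rw [← expHam_generator hω hh, AlgHom.comp_apply, expAlgHom_apply, expHam_neg_expHam hχ, hU,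
      substAlgHom_apply, hB, ofActions_apply]

end Uniqueness

end Birkhoff

namespace Birkhoff

open MvPowerSeries

/-! ### Polynomial dependence of the normal form on parameters -/

section Families

variable {d : ℕ}

/-- Polynomial functions of the parameters of degree at most `n - 2`; only `0` for `n < 2`. -/
def polyFun (n : ℕ) : Submodule ℝ ((ℕ → ℝ) → ℝ) where
  carrier := {u | ∃ P : MvPolynomial ℕ ℝ, (n < 2 → P = 0) ∧ P.totalDegree ≤ n - 2 ∧
    ∀ ζ, u ζ = MvPolynomial.eval ζ P}
  add_mem' := by
    rintro u v ⟨P, h1, h2, h3⟩ ⟨Q, h4, h5, h6⟩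
    exact ⟨P + Q, fun h => by rw [h1 h, h4 h, add_zero],
      (MvPolynomial.totalDegree_add P Q).trans (max_le h2 h5), fun ζ => by simp [h3, h6]⟩
  zero_mem' := ⟨0, fun _ => rfl, by simp, by simp⟩
  smul_mem' := by
    rintro c u ⟨P, h1, h2, h3⟩
    exact ⟨c • P, fun h => by rw [h1 h, smul_zero],
      (MvPolynomial.totalDegree_smul_le c P).trans h2, fun ζ => by simp [h3]⟩

lemma polyFun_mono {m n : ℕ} (h : m ≤ n) {u : (ℕ → ℝ) → ℝ} (hu : u ∈ polyFun m) :
    u ∈ polyFun n := by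
  obtain ⟨P, h1, h2, h3⟩ := hu
  exact ⟨P, fun h => h1 (by omega), by omega, h3⟩

/-- The weight n - 2 is chosen for this: the bracket of parts of degrees m and n has degree m + n -
2, and (m - 2) + (n - 2) is the weight of that degree. -/
lemma polyFun_mul {m n k : ℕ} {u v : (ℕ → ℝ) → ℝ} (hu : u ∈ polyFun m) (hv : v ∈ polyFun n)
    (hk : m + n ≤ k + 2) : (fun ζ => u ζ * v ζ) ∈ polyFun k := by
  obtain ⟨P, h1, h2, h3⟩ := hu
  obtain ⟨Q, h4, h5, h6⟩ := hv
  by_cases hm : m < 2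
  · have : (fun ζ => u ζ * v ζ) = 0 := by ext ζ; simp [h3, h1 hm]
    rw [this]; exact Submodule.zero_mem _
  by_cases hn : n < 2
  · have : (fun ζ => u ζ * v ζ) = 0 := by ext ζ; simp [h6, h4 hn]
    rw [this]; exact Submodule.zero_mem _
  refine ⟨P * Q, fun h => by omega, ?_, fun ζ => by simp [h3, h6]⟩
  exact (MvPolynomial.totalDegree_mul P Q).trans (by omega)

lemma const_mem_polyFun {n : ℕ} (hn : 2 ≤ n) (c : ℝ) : (fun _ => c) ∈ polyFun n :=
  ⟨MvPolynomial.C c, fun h => by omega, by simp, by simp⟩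

lemma coord_mem_polyFun {n : ℕ} (hn : 3 ≤ n) (i : ℕ) : (fun ζ => ζ i) ∈ polyFun n :=
  ⟨MvPolynomial.X i, fun h => by omega, by simp; omega, by simp⟩

lemma continuous_of_mem_polyFun {n : ℕ} {u : (ℕ → ℝ) → ℝ} (hu : u ∈ polyFun n) :
    Continuous u := by
  obtain ⟨P, -, -, h⟩ := hu
  rw [funext h]
  exact MvPolynomial.continuous_eval P

/-- Along a line, a polynomial function is a polynomial. -/
lemma exists_polynomial_of_mem_polyFun {n : ℕ} {u : (ℕ → ℝ) → ℝ} (hu : u ∈ polyFun n)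
    (ζ v : ℕ → ℝ) :
    ∃ Q : Polynomial ℝ, Q.natDegree ≤ n ∧ ∀ t : ℝ, u (fun i => ζ i + t * v i) = Q.eval t := by
  obtain ⟨P, -, h2, h3⟩ := hu
  refine ⟨MvPolynomial.aeval (fun i => Polynomial.C (ζ i) + Polynomial.X * Polynomial.C (v i)) P,
    ?_, fun t => ?_⟩
  · refine (MvPolynomial.aeval_natDegree_le P (h2.trans (Nat.sub_le n 2)) _ (n := 1)
      fun i => ?_).trans (by simp)
    refine (Polynomial.natDegree_add_le _ _).trans ?_
    rw [Polynomial.natDegree_C]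
    refine max_le (Nat.zero_le _) (Polynomial.natDegree_mul_le.trans ?_)
    simp
  · rw [h3, ← Polynomial.coe_evalRingHom, MvPolynomial.aeval_def,
      MvPolynomial.hom_eval₂, MvPolynomial.eval, MvPolynomial.coe_eval₂Hom]
    congr 1
    · ext x; simp
    · ext i; simp; ring

/-- Families of series whose coefficients of degree `m` are polynomials in the parameters of
degree at most `m - 2`. -/
def polyFam (d : ℕ) : Submodule ℝ ((ℕ → ℝ) → PS d ℝ) where
  carrier := {f | ∀ a, (fun ζ => coeff a (f ζ)) ∈ polyFun a.degree}
  add_mem' hf hg a := by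
    simp only [Pi.add_apply, map_add]
    exact Submodule.add_mem _ (hf a) (hg a)
  zero_mem' a := Submodule.zero_mem (polyFun a.degree)
  smul_mem' c f hf a := by
    simp only [Pi.smul_apply, coeff_smul]
    exact Submodule.smul_mem _ c (hf a)

lemma sum_mem_polyFun {ι : Type*} {n : ℕ} (s : Finset ι) (u : ι → (ℕ → ℝ) → ℝ)
    (hu : ∀ i ∈ s, u i ∈ polyFun n) : (fun ζ => ∑ i ∈ s, u i ζ) ∈ polyFun n := by
  have : (fun ζ => ∑ i ∈ s, u i ζ) = ∑ i ∈ s, u i := by ext ζ; simp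
  rw [this]; exact Submodule.sum_mem _ hu

lemma coeff_pderiv_mem_polyFun {f : (ℕ → ℝ) → PS d ℝ} (hf : f ∈ polyFam d) (v : Fin d ⊕ Fin d)
    (a : Fin d ⊕ Fin d →₀ ℕ) :
    (fun ζ => coeff a (pderiv ℝ v (f ζ))) ∈ polyFun (a.degree + 1) := by
  have h := Submodule.smul_mem _ ((a v : ℝ) + 1) (hf (a + Finsupp.single v 1))
  rw [map_add, Finsupp.degree_single] at h
  convert h using 1
  ext ζ
  simp only [coeff_pderiv, Pi.smul_apply, smul_eq_mul]
  ring

lemma ham_mem_polyFam {f g : (ℕ → ℝ) → PS d ℝ} (hf : f ∈ polyFam d) (hg : g ∈ polyFam d) :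
    (fun ζ => ham (f ζ) (g ζ)) ∈ polyFam d := by
  classical
  intro a
  simp only [ham_apply, map_sum, map_sub, coeff_mul]
  refine sum_mem_polyFun _ _ fun j _ => Submodule.sub_mem _ ?_ ?_ <;>
  · refine sum_mem_polyFun _ _ fun b hb => ?_
    refine polyFun_mul (coeff_pderiv_mem_polyFun hf _ _) (coeff_pderiv_mem_polyFun hg _ _) ?_
    rw [← Finset.HasAntidiagonal.mem_antidiagonal.1 hb, map_add]
    omega

lemma exists_finset_sub_sum_mem (n : ℕ) : ∃ s : Finset (Fin d ⊕ Fin d →₀ ℕ),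
    (∀ a ∈ s, a.degree ≤ n) ∧
    ∀ f : PS d ℝ, f - ∑ a ∈ s, coeff a f • monomial a 1 ∈ ordGE _ ℝ (n + 1) := by
  classical
  have hfin : {a : Fin d ⊕ Fin d →₀ ℕ | a.degree ≤ n}.Finite := Finsupp.finite_of_degree_le n
  refine ⟨hfin.toFinset, fun a ha => by simpa using ha, fun f b hb => ?_⟩
  rw [map_sub, map_sum, Finset.sum_eq_single b]
  · simp
  · intro a _ hab
    rw [coeff_smul, coeff_monomial_ne hab.symm, mul_zero]
  · intro h
    exact absurd (hfin.mem_toFinset.2 (Nat.lt_succ_iff.1 hb)) h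

lemma functional_eq_sum (n : ℕ) : ∃ s : Finset (Fin d ⊕ Fin d →₀ ℕ),
    (∀ a ∈ s, a.degree ≤ n) ∧ ∀ L : PS d ℝ →ₗ[ℝ] ℝ, (∀ f ∈ ordGE _ ℝ (n + 1), L f = 0) →
      ∀ f, L f = ∑ a ∈ s, L (monomial a 1) * coeff a f := by
  obtain ⟨s, hs, h⟩ := exists_finset_sub_sum_mem (d := d) n
  refine ⟨s, hs, fun L hL f => ?_⟩
  have := hL _ (h f)
  rw [map_sub, sub_eq_zero, map_sum] at this
  rw [this]
  exact Finset.sum_congr rfl fun a _ => by rw [map_smul, smul_eq_mul, mul_comm]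

/-- A linear functional that depends on finitely many coefficients maps polynomial families to
polynomial functions. -/
lemma functional_mem_polyFun {f : (ℕ → ℝ) → PS d ℝ} (hf : f ∈ polyFam d) {n : ℕ}
    (L : PS d ℝ →ₗ[ℝ] ℝ) (hL : ∀ f ∈ ordGE _ ℝ (n + 1), L f = 0) :
    (fun ζ => L (f ζ)) ∈ polyFun n := by
  obtain ⟨s, hs, h⟩ := functional_eq_sum (d := d) n
  rw [show (fun ζ => L (f ζ)) = fun ζ => ∑ a ∈ s, L (monomial a 1) * coeff a (f ζ) from
    funext fun ζ => h L hL (f ζ)]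
  exact sum_mem_polyFun _ _ fun a ha => Submodule.smul_mem _ (L (monomial a 1))
    (polyFun_mono (hs a ha) (hf a))

lemma homological_mem_polyFam (ω : Fin d → ℝ) {f : (ℕ → ℝ) → PS d ℝ} (hf : f ∈ polyFam d) :
    (fun ζ => homological ω (f ζ)) ∈ polyFam d := fun a =>
  functional_mem_polyFun hf (coeff a ∘ₗ homological ω)
    fun _ hf => homological_mem ω hf a (Nat.lt_succ_self _)

lemma expHam_mem_polyFam {χ f : (ℕ → ℝ) → PS d ℝ} (hχ : χ ∈ polyFam d) (hf : f ∈ polyFam d) :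
    (fun ζ => expHam (χ ζ) (f ζ)) ∈ polyFam d := by
  have h : ∀ k, (fun ζ => (adHam (χ ζ) ^ k) (f ζ)) ∈ polyFam d := by
    intro k
    induction k with
    | zero => simpa using hf
    | succ k ih =>
      simp only [pow_succ', Module.End.mul_apply, adHam_apply]
      exact ham_mem_polyFam hχ ih
  intro a
  simp only [coeff_expHam, expPartial_apply, map_sum, coeff_smul]
  exact sum_mem_polyFun _ _ fun k _ => Submodule.smul_mem _ _ (h k a)

lemma genSeq_mem_polyFam (ω : Fin d → ℝ) {h : (ℕ → ℝ) → PS d ℝ} (hh : h ∈ polyFam d) (n : ℕ) :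
    (fun ζ => genSeq ω (h ζ) n) ∈ polyFam d := by
  induction n with
  | zero => exact Submodule.zero_mem _
  | succ n ih =>
    exact Submodule.add_mem _ ih (homological_mem_polyFam ω (expHam_mem_polyFam ih hh))

lemma generator_mem_polyFam (ω : Fin d → ℝ) {h : (ℕ → ℝ) → PS d ℝ} (hh : h ∈ polyFam d) :
    (fun ζ => generator ω (h ζ)) ∈ polyFam d := fun a => genSeq_mem_polyFam ω hh a.degree a

lemma coeff_actionPart_eq_zero {c : Fin d →₀ ℕ} {f : PS d ℝ}
    (hf : f ∈ ordGE _ ℝ (2 * c.degree + 1)) : coeff c (actionPart d f) = 0 := by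
  rw [coeff_actionPart, complexify_mem hf _ (by rw [degree_dia]; omega), Complex.zero_re]

/-- Brackets, Lie series and homological solutions preserve the grading of `polyFam`. The degree
bound, linear in |c|, is what keeps polynomial extrapolation geometric in |c|. -/
lemma coeff_normalForm_mem_polyFun (ω : Fin d → ℝ) {h : (ℕ → ℝ) → PS d ℝ} (hh : h ∈ polyFam d)
    (c : Fin d →₀ ℕ) : (fun ζ => coeff c (normalForm ω (h ζ))) ∈ polyFun (2 * c.degree) :=
  functional_mem_polyFun (expHam_mem_polyFam (generator_mem_polyFam ω hh) hh)
    (coeff c ∘ₗ actionPart d) fun _ hf => coeff_actionPart_eq_zero hf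

end Families

/-! ### Expansion of the normal form to second order -/

section SecondOrder

variable {d : ℕ}

/-- One-parameter families of series that are `O(τ^k)`, coefficientwise. -/
def smallFam (d k : ℕ) : Submodule ℝ (ℝ → PS d ℝ) where
  carrier := {f | ∀ a, (fun τ => coeff a (f τ)) =O[𝓝 0] fun τ : ℝ => τ ^ k}
  add_mem' hf hg a := by simpa using (hf a).add (hg a)
  zero_mem' a := by simpa using Asymptotics.isBigO_zero _ _
  smul_mem' c f hf a := by simpa using (hf a).const_mul_left c

lemma isBigO_pow_of_le {k l : ℕ} (h : k ≤ l) :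
    (fun τ : ℝ => τ ^ l) =O[𝓝 0] fun τ : ℝ => τ ^ k := by
  obtain ⟨m, rfl⟩ := Nat.exists_eq_add_of_le h
  simp only [pow_add]
  have : (fun τ : ℝ => τ ^ m) =O[𝓝 0] fun _ => (1 : ℝ) :=
    ((continuous_pow m).tendsto 0).isBigO_one ℝ
  simpa using (Asymptotics.isBigO_refl (fun τ : ℝ => τ ^ k) (𝓝 0)).mul this

lemma smallFam_anti {k l : ℕ} (h : k ≤ l) {f : ℝ → PS d ℝ} (hf : f ∈ smallFam d l) :
    f ∈ smallFam d k := fun a => (hf a).trans (isBigO_pow_of_le h)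

lemma pow_smul_mem_smallFam (k : ℕ) (f : PS d ℝ) : (fun τ : ℝ => τ ^ k • f) ∈ smallFam d k := by
  intro a
  simp only [coeff_smul]
  simpa using (Asymptotics.isBigO_refl (fun τ : ℝ => τ ^ k) (𝓝 0)).mul
    (Asymptotics.isBigO_refl (fun _ : ℝ => coeff a f) (𝓝 0)) |>.trans
      ((Asymptotics.isBigO_refl (fun τ : ℝ => τ ^ k) (𝓝 0)).mul
        (Asymptotics.isBigO_const_const (coeff a f) (one_ne_zero (α := ℝ)) (𝓝 0)))

lemma ham_mem_smallFam {k l : ℕ} {f g : ℝ → PS d ℝ} (hf : f ∈ smallFam d k)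
    (hg : g ∈ smallFam d l) : (fun τ => ham (f τ) (g τ)) ∈ smallFam d (k + l) := by
  classical
  have hp : ∀ {k : ℕ} {f : ℝ → PS d ℝ}, f ∈ smallFam d k → ∀ v a,
      (fun τ => coeff a (pderiv ℝ v (f τ))) =O[𝓝 0] fun τ : ℝ => τ ^ k := by
    intro k f hf v a
    refine ((hf (a + Finsupp.single v 1)).const_mul_left ((a v : ℝ) + 1)).congr_left fun τ => ?_
    rw [coeff_pderiv, mul_comm]
  intro a
  simp only [ham_apply, map_sum, map_sub, coeff_mul, pow_add]
  refine Asymptotics.IsBigO.fun_sum fun j _ => Asymptotics.IsBigO.sub ?_ ?_ <;>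
  exact Asymptotics.IsBigO.fun_sum fun b _ => (hp hf _ _).mul (hp hg _ _)

lemma functional_isBigO {k : ℕ} {f : ℝ → PS d ℝ} (hf : f ∈ smallFam d k) {n : ℕ}
    (L : PS d ℝ →ₗ[ℝ] ℝ) (hL : ∀ f ∈ ordGE _ ℝ (n + 1), L f = 0) :
    (fun τ => L (f τ)) =O[𝓝 0] fun τ : ℝ => τ ^ k := by
  obtain ⟨s, hs, h⟩ := functional_eq_sum (d := d) n
  rw [show (fun τ => L (f τ)) = fun τ => ∑ a ∈ s, L (monomial a 1) * coeff a (f τ) from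
    funext fun τ => h L hL (f τ)]
  exact Asymptotics.IsBigO.fun_sum fun a _ => (hf a).const_mul_left _

lemma expHam_expand {χ h : ℝ → PS d ℝ} (hχ : ∀ τ, χ τ ∈ ordGE _ ℝ 3) (hχ1 : χ ∈ smallFam d 1)
    (hh : h ∈ smallFam d 0) :
    (fun τ => expHam (χ τ) (h τ) - h τ - ham (χ τ) (h τ) -
      (2⁻¹ : ℝ) • ham (χ τ) (ham (χ τ) (h τ))) ∈ smallFam d 3 := by
  have hk : ∀ k, (fun τ => (adHam (χ τ) ^ k) (h τ)) ∈ smallFam d k := by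
    intro k
    induction k with
    | zero => simpa using hh
    | succ k ih =>
      simp only [pow_succ', Module.End.mul_apply, adHam_apply]
      rw [add_comm]
      exact ham_mem_smallFam hχ1 ih
  intro a
  have h1 : ∀ τ, coeff a (expHam (χ τ) (h τ) - h τ - ham (χ τ) (h τ) -
      (2⁻¹ : ℝ) • ham (χ τ) (ham (χ τ) (h τ))) = ∑ k ∈ Finset.range (a.degree + 1),
        (((k + 3).factorial : ℝ)⁻¹) * coeff a ((adHam (χ τ) ^ (k + 3)) (h τ)) := fun τ => by
    -- Three extra terms are kept so that k = 0, 1, 2 can be split off; the rest is a finite sum,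
    -- each term O(τ³).
    have h2 := expHam_sub_expPartial_mem (hχ τ) (h τ) (a.degree + 1 + 3) a (by omega)
    rw [map_sub, sub_eq_zero, expPartial_apply, Finset.sum_range_succ', Finset.sum_range_succ',
      Finset.sum_range_succ'] at h2
    rw [map_sub, map_sub, map_sub, h2]
    simp only [map_add, map_sum, coeff_smul, zero_add, pow_zero, Module.End.one_apply,
      adHam_apply, Nat.factorial, pow_succ, Module.End.mul_apply]
    norm_num
  simp only [h1]
  exact Asymptotics.IsBigO.fun_sum fun k _ =>
    ((smallFam_anti (Nat.le_add_left 3 k) (hk (k + 3))) a).const_mul_left _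

lemma eq_zero_of_isBigO {c : ℝ} {k : ℕ}
    (h : (fun τ : ℝ => c * τ ^ k) =O[𝓝 0] fun τ : ℝ => τ ^ (k + 1)) : c = 0 := by
  obtain ⟨K, hK⟩ := h.bound
  rw [Metric.eventually_nhds_iff] at hK
  obtain ⟨ε, hε, hK⟩ := hK
  have h1 : ∀ᶠ τ : ℝ in 𝓝[>] 0, |c| ≤ K * τ := by
    filter_upwards [Ioo_mem_nhdsGT hε] with τ hτ
    have := hK (y := τ) (by rw [Real.dist_eq, sub_zero, abs_of_pos hτ.1]; exact hτ.2)
    rw [norm_mul, norm_pow, norm_pow, Real.norm_eq_abs, Real.norm_eq_abs, abs_of_pos hτ.1,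
      pow_succ, ← mul_assoc, mul_right_comm] at this
    exact le_of_mul_le_mul_right this (pow_pos hτ.1 k)
  have h2 : Filter.Tendsto (fun τ : ℝ => K * τ) (𝓝[>] 0) (𝓝 (K * 0)) :=
    ((continuous_const.mul continuous_id).tendsto 0).mono_left nhdsWithin_le_nhds
  rw [mul_zero] at h2
  exact abs_nonpos_iff.1 (ge_of_tendsto h2 h1)

lemma actionPart_ham_quadratic (ω : Fin d → ℝ) (g : PS d ℝ) :
    actionPart d (ham (quadratic ω) g) = 0 := by
  ext c
  have h0 : complexify d (ham (quadratic ω) g) =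
      (-Complex.I) • ham (complexify d (quadratic ω)) (complexify d g) := by
    rw [ham_complexify, smul_smul, neg_mul, Complex.I_mul_I, neg_neg, one_smul]
  have h1 : eigenvalue ω (dia c) = 0 := Finset.sum_eq_zero fun j _ => by simp
  rw [coeff_actionPart, h0, coeff_smul, coeff_ham_quadratic, h1]
  simp

/-- Modulo functions of the actions, g is {Q, u} with Q = ∑ ω_j I_j. By Jacobi and {n, Q} = 0, {n,
{Q, u}} = {Q, {n, u}}, and the image of {Q, ·} has no diagonal part. -/
lemma actionPart_ham_ofActions {ω : Fin d → ℝ} (hω : LinearIndependent ℚ ω)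
    (n : MvPowerSeries (Fin d) ℝ) (g : PS d ℝ) : actionPart d (ham (ofActions d n) g) = 0 := by
  have h : g = ham (quadratic ω) (homological ω g) + ofActions d (actionPart d g) := by
    rw [ham_homological hω, sub_add_cancel]
  rw [h, map_add, ham_ofActions, add_zero, ham_ham, quadratic, ham_ofActions, map_zero,
    Derivation.zero_apply, zero_add]
  exact actionPart_ham_quadratic ω _

/-- The first two terms of the expansion of a normalization of `N + τ F`. -/
lemma normalForm_expand {ω : Fin d → ℝ} (hω : LinearIndependent ℚ ω)
    {n : MvPowerSeries (Fin d) ℝ} {F χ₁ : PS d ℝ} (hF : actionPart d F = 0) {χ : ℝ → PS d ℝ}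
    (hχ : ∀ τ, χ τ ∈ ordGE _ ℝ 3) (hχ₁ : (fun τ => χ τ - τ • χ₁) ∈ smallFam d 2)
    {B : ℝ → MvPowerSeries (Fin d) ℝ}
    (hB : ∀ τ, expHam (χ τ) (ofActions d n + τ • F) = ofActions d (B τ)) :
    ham (ofActions d n) χ₁ = F ∧ ∀ c, (fun τ => coeff c (B τ) - coeff c n -
      τ ^ 2 * (2⁻¹ * coeff c (actionPart d (ham χ₁ F)))) =O[𝓝 0] fun τ : ℝ => τ ^ 3 := by
  have c0 : ∀ f : PS d ℝ, (fun _ => f) ∈ smallFam d 0 := fun f => by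
    simpa using pow_smul_mem_smallFam 0 f
  have c1 : ∀ f : PS d ℝ, (fun τ : ℝ => τ • f) ∈ smallFam d 1 := fun f => by
    simpa using pow_smul_mem_smallFam 1 f
  set N := ofActions d n with hN
  set ρ : ℝ → PS d ℝ := fun τ => χ τ - τ • χ₁ with hρ
  have hχe : ∀ τ, χ τ = τ • χ₁ + ρ τ := fun τ => by rw [hρ]; simp
  have hχS : χ ∈ smallFam d 1 := by
    rw [funext hχe]; exact Submodule.add_mem _ (c1 χ₁) (smallFam_anti one_le_two hχ₁)
  have hhS : (fun τ : ℝ => N + τ • F) ∈ smallFam d 0 :=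
    Submodule.add_mem _ (c0 N) (smallFam_anti zero_le_one (c1 F))
  have hexp := expHam_expand hχ hχS hhS
  have hham := ham_mem_smallFam hχS (ham_mem_smallFam hχS hhS)
  have e1 : ∀ τ, ham (χ τ) (N + τ • F) = τ • ham χ₁ N + τ ^ 2 • ham χ₁ F + ham (ρ τ) N +
      ham (ρ τ) (τ • F) := fun τ => by
    rw [hχe]
    simp only [map_add, map_smul, Derivation.add_apply, Derivation.smul_apply,
      Derivation.map_smul, smul_add, smul_smul, pow_two]
    abel
  have hρN := ham_mem_smallFam hχ₁ (c0 N)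
  have hρF := ham_mem_smallFam hχ₁ (c1 F)
  have hq2 := pow_smul_mem_smallFam 2 (ham χ₁ F)
  -- The order τ part of exp(ad χ)(N + τ F) is F + {χ₁, N}. It is a function of the actions, since
  -- projecting off the actions leaves a multiple of τ that is O(τ²), and its action part is zero.
  have first : F + ham χ₁ N = 0 := by
    have h1 : (fun τ => ofActions d (B τ) - N - τ • (F + ham χ₁ N)) ∈ smallFam d 2 := by
      have := Submodule.add_mem _ (Submodule.add_mem _ (Submodule.add_mem _ (Submodule.add_mem _
        (smallFam_anti (by norm_num) hexp) (Submodule.smul_mem _ (2⁻¹ : ℝ) hham)) hq2) hρN)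
        (smallFam_anti (by norm_num : 2 ≤ 2 + 1) hρF)
      convert this using 1
      ext1 τ
      simp only [Pi.add_apply, Pi.smul_apply]
      rw [hB, e1, smul_add]
      abel
    have h2 : ∀ G : PS d ℝ, ∀ a, coeff a G - coeff a (ofActions d (actionPart d G)) =
        coeff a (ham (quadratic ω) (homological ω G)) := fun G a => by
      rw [ham_homological hω, map_sub]
    have h3 : F + ham χ₁ N = ofActions d (actionPart d (F + ham χ₁ N)) := by
      rw [← sub_eq_zero, ← ham_homological hω]
      ext a
      refine eq_zero_of_isBigO (k := 1) ?_
      have h4 := functional_isBigO h1 (n := a.degree)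
        (coeff a ∘ₗ ((ham (quadratic ω) : PS d ℝ →ₗ[ℝ] PS d ℝ) ∘ₗ homological ω))
        (fun f hf => ham_mem_ordGE (quadratic_mem ω) (homological_mem ω hf) (by omega) a
          (Nat.lt_succ_self _))
      refine h4.neg_left.congr_left fun τ => ?_
      simp only [LinearMap.comp_apply, Derivation.coeFn_coe]
      have h5 : homological ω (ofActions d (B τ) - N - τ • (F + ham χ₁ N)) =
          -(τ • homological ω (F + ham χ₁ N)) := by
        rw [LinearMap.map_sub, LinearMap.map_sub, hN, homological_ofActions,
          homological_ofActions, sub_self, zero_sub, map_smul]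
      rw [h5, map_neg, Derivation.map_smul, map_neg, coeff_smul, neg_neg, pow_one, mul_comm]
    rw [h3, map_add, hF, ham_antisymm, map_neg, hN, actionPart_ham_ofActions hω]
    simp
  have hχN : ham χ₁ N = -F := by rw [← sub_eq_zero, sub_neg_eq_add, add_comm, first]
  refine ⟨by rw [ham_antisymm, hχN, neg_neg], fun c => ?_⟩
  -- With {χ₁, N} = -F the τ² terms are {χ₁, F} - ½{χ₁, F}. The unknown second-order part ρ of the
  -- generator enters only through {ρ, N}, which has no action part.
  have h1 : (fun τ => ofActions d (B τ) - N - (τ ^ 2 * 2⁻¹) • ham χ₁ F - ham (ρ τ) N) ∈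
      smallFam d 3 := by
    have t1 : (fun τ => ham (χ τ) (τ ^ 2 • ham χ₁ F + ham (ρ τ) N + ham (ρ τ) (τ • F))) ∈
        smallFam d 3 := by
      refine smallFam_anti (by norm_num) (ham_mem_smallFam (l := 2) hχS (Submodule.add_mem _
        (Submodule.add_mem _ hq2 hρN) (smallFam_anti (by norm_num) hρF)))
    have t2 := ham_mem_smallFam hχ₁ (c1 F)
    have := Submodule.add_mem _ (Submodule.sub_mem _ (Submodule.add_mem _ hexp
      (Submodule.smul_mem _ (2⁻¹ : ℝ) t1)) (Submodule.smul_mem _ (2⁻¹ : ℝ) t2)) hρF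
    convert this using 1
    ext1 τ
    simp only [Pi.add_apply, Pi.sub_apply, Pi.smul_apply]
    have e2 : ham (χ τ) (ham (χ τ) (N + τ • F)) = ham (χ τ) (τ ^ 2 • ham χ₁ F + ham (ρ τ) N +
        ham (ρ τ) (τ • F)) - τ ^ 2 • ham χ₁ F - ham (ρ τ) (τ • F) := by
      have e3 : ham (χ τ) (τ • ham χ₁ N) = - (τ ^ 2 • ham χ₁ F) - ham (ρ τ) (τ • F) := by
        rw [hχN, hχe]
        simp only [map_add, map_smul, Derivation.add_apply, Derivation.smul_apply,
          Derivation.map_smul, smul_neg, map_neg, pow_two]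
        module
      rw [e1, add_assoc, add_assoc, map_add, e3, ← add_assoc]
      abel
    rw [hB, e2, e1, hχN]
    module
  have h2 := functional_isBigO h1 (n := 2 * c.degree) (coeff c ∘ₗ actionPart d)
    fun f hf => coeff_actionPart_eq_zero hf
  refine h2.congr_left fun τ => ?_
  simp only [LinearMap.comp_apply]
  rw [(actionPart d).map_sub, (actionPart d).map_sub, (actionPart d).map_sub,
    ham_antisymm (ρ τ), map_neg, hN, actionPart_ham_ofActions hω, actionPart_ofActions,
    actionPart_ofActions, neg_zero, sub_zero, map_smul, map_sub, map_sub, coeff_smul]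
  ring

end SecondOrder

end Birkhoff

namespace Birkhoff

open MvPowerSeries

/-! ### Resonant monomials -/

section Modes

variable {d : ℕ}

lemma toComplexCoord_complexCoord (v : Fin d ⊕ Fin d) :
    toComplexCoord d (complexCoord v) = X v := by
  have h2 := C_invSqrtTwo_sq (d := d)
  have h4 : (C Complex.I * C Complex.I : PS d ℂ) = -1 := by
    rw [← map_mul, Complex.I_mul_I, map_neg, map_one]
  rcases v with j | j
  · simp only [complexCoord, Sum.elim_inl, map_mul, map_add, algHom_C, toComplexCoord_X, realCoord,
      Sum.elim_inr, map_neg]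
    linear_combination X (Sum.inl j) * h2 - C invSqrtTwo * C invSqrtTwo *
      (X (Sum.inl j) - X (Sum.inr j)) * h4
  · simp only [complexCoord, Sum.elim_inr, map_mul, map_sub, algHom_C, toComplexCoord_X, realCoord,
      Sum.elim_inl, map_neg]
    linear_combination X (Sum.inr j) * h2 + C invSqrtTwo * C invSqrtTwo *
      (X (Sum.inl j) - X (Sum.inr j)) * h4

/-- The monomial `c (ξ_p^k ξ_q^l η_q^m + η_p^k η_q^l ξ_q^m)` in the variables `(x, y)`, with
complex coefficients. -/
def modeComplex (p q : Fin d) (c : ℝ) (k l m : ℕ) : PS d ℂ :=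
  C (c : ℂ) * (complexCoord (Sum.inl p) ^ k * complexCoord (Sum.inl q) ^ l *
      complexCoord (Sum.inr q) ^ m +
    complexCoord (Sum.inr p) ^ k * complexCoord (Sum.inr q) ^ l * complexCoord (Sum.inl q) ^ m)

/-- The series `c (ξ_p^k ξ_q^l η_q^m + η_p^k η_q^l ξ_q^m)`. -/
def modeSeries (p q : Fin d) (c : ℝ) (k l m : ℕ) : PS d ℝ :=
  reSeries d (modeComplex p q c k l m)

lemma modeComplex_mem (p q : Fin d) (c : ℝ) (k l m : ℕ) :
    modeComplex p q c k l m ∈ ordGE _ ℂ (k + l + m) := by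
  have h : ∀ v n, (complexCoord v : PS d ℂ) ^ n ∈ ordGE _ ℂ n := fun v n =>
    pow_mem_ordGE (complexCoord_mem v) n
  exact C_mul_mem_ordGE _ (Submodule.add_mem _
    (mul_mem_ordGE (mul_mem_ordGE (h _ _) (h _ _)) (h _ _))
    (mul_mem_ordGE (mul_mem_ordGE (h _ _) (h _ _)) (h _ _)))

lemma modeSeries_mem (p q : Fin d) (c : ℝ) (k l m : ℕ) :
    modeSeries p q c k l m ∈ ordGE _ ℝ (k + l + m) := reSeries_mem (modeComplex_mem p q c k l m)

lemma conj_complexCoord (v : Fin d ⊕ Fin d) :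
    MvPowerSeries.map (starRingEnd ℂ) (complexCoord v) = complexCoord v.swap := by
  have h : (starRingEnd ℂ) invSqrtTwo = invSqrtTwo := by
    rw [invSqrtTwo, map_inv₀, Complex.conj_ofReal]
  rcases v with j | j <;>
  simp [complexCoord, map_C, map_X, h, sub_eq_add_neg]

/-- Conjugation exchanges ξ and η, hence the two summands, so taking real parts loses nothing. -/
lemma ofRealSeries_modeSeries (p q : Fin d) (c : ℝ) (k l m : ℕ) :
    ofRealSeries d (modeSeries p q c k l m) = modeComplex p q c k l m := by
  have h : MvPowerSeries.map (starRingEnd ℂ) (modeComplex p q c k l m) =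
      modeComplex p q c k l m := by
    simp only [modeComplex, map_mul, map_add, map_pow, conj_complexCoord, map_C,
      Complex.conj_ofReal, Sum.swap_inl, Sum.swap_inr]
    ring
  ext a
  rw [coeff_ofRealSeries, modeSeries, coeff_reSeries]
  refine Complex.conj_eq_iff_re.1 ?_
  rw [← coeff_map, h]

/-- The exponent of `ξ_p^k ξ_q^l η_q^m`. -/
def modeExp (p q : Fin d) (k l m : ℕ) : Fin d ⊕ Fin d →₀ ℕ :=
  Finsupp.single (Sum.inl p) k + Finsupp.single (Sum.inl q) l + Finsupp.single (Sum.inr q) m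

/-- The exponent of `η_p^k η_q^l ξ_q^m`. -/
def modeExpConj (p q : Fin d) (k l m : ℕ) : Fin d ⊕ Fin d →₀ ℕ :=
  Finsupp.single (Sum.inr p) k + Finsupp.single (Sum.inr q) l + Finsupp.single (Sum.inl q) m

lemma complexify_modeSeries (p q : Fin d) (c : ℝ) (k l m : ℕ) :
    complexify d (modeSeries p q c k l m) = (c : ℂ) • (monomial (modeExp p q k l m) 1 +
      monomial (modeExpConj p q k l m) 1) := by
  rw [complexify_apply, ofRealSeries_modeSeries, modeComplex]
  simp only [map_mul, map_add, map_pow, algHom_C, toComplexCoord_complexCoord, X_pow_eq,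
    monomial_mul_monomial, one_mul, modeExp, modeExpConj, smul_eq_C_mul]

lemma coeff_mul_pderiv_monomial (v : Fin d ⊕ Fin d) (f : PS d ℂ) (b a : Fin d ⊕ Fin d →₀ ℕ) :
    coeff a (f * pderiv ℂ v (monomial b 1)) =
      if b - Finsupp.single v 1 ≤ a then
        coeff (a - (b - Finsupp.single v 1)) f * (b v : ℂ) else 0 := by
  classical
  have h : pderiv ℂ v (monomial b (1 : ℂ)) = monomial (b - Finsupp.single v 1) (b v : ℂ) := by
    have := pderiv_coe (R := ℂ) (i := v) (MvPolynomial.monomial b (1 : ℂ))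
    simpa [MvPolynomial.pderiv_monomial] using this
  rw [h, coeff_mul_monomial]

lemma coeff_ham_actions_mul (p q : Fin d) (g : PS d ℂ) (a : Fin d ⊕ Fin d →₀ ℕ) :
    coeff a (ham ((X (Sum.inl p) * X (Sum.inr p)) * (X (Sum.inl q) * X (Sum.inr q))) g) =
      (if dia (Finsupp.single p 1) ≤ a then ((a (Sum.inr q) : ℂ) - a (Sum.inl q)) *
        coeff (a - dia (Finsupp.single p 1)) g else 0) +
      (if dia (Finsupp.single q 1) ≤ a then ((a (Sum.inr p) : ℂ) - a (Sum.inl p)) *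
        coeff (a - dia (Finsupp.single q 1)) g else 0) := by
  classical
  have h1 : ∀ j : Fin d, (X (Sum.inl j) * X (Sum.inr j) : PS d ℂ) =
      monomial (dia (Finsupp.single j 1)) 1 := fun j => by
    rw [X_def, X_def, monomial_mul_monomial, one_mul]
    congr 2
    ext (i | i) <;> simp [Finsupp.single_apply]
  have h2 : ∀ i j : Fin d, coeff a ((X (Sum.inl i) * X (Sum.inr i)) *
      ham (X (Sum.inl j) * X (Sum.inr j)) g) =
      if dia (Finsupp.single i 1) ≤ a then ((a (Sum.inr j) : ℂ) - a (Sum.inl j)) *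
        coeff (a - dia (Finsupp.single i 1)) g else 0 := fun i j => by
    rw [h1 i, coeff_monomial_mul, one_mul, coeff_ham_X_mul_X]
    split_ifs with h
    · congr 1
      have h3 := h (Sum.inl j)
      have h4 := h (Sum.inr j)
      simp only [dia_inl, dia_inr] at h3 h4
      simp only [Finsupp.tsub_apply, dia_inl, dia_inr]
      rw [Nat.cast_sub h3, Nat.cast_sub h4]
      ring
    · rfl
  rw [ham_mul_left, map_add, h2, h2]

end Modes

/-! ### The second-order contribution of one resonant mode. -/

section ModeCoefficient

variable {d : ℕ}

/-- The normal form of the unperturbed Hamiltonian. -/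
def baseNormal (ω : Fin d → ℝ) (p q : Fin d) : MvPowerSeries (Fin d) ℝ :=
  ∑ j, ω j • X j + X p * X q

lemma complexify_baseNormal (ω : Fin d → ℝ) (p q : Fin d) :
    complexify d (ofActions d (baseNormal ω p q)) = complexify d (quadratic ω) +
      (X (Sum.inl p) * X (Sum.inr p)) * (X (Sum.inl q) * X (Sum.inr q)) := by
  rw [baseNormal, map_add, map_add, map_mul, map_mul, ofActions_X, ofActions_X,
    complexify_actionSeries, complexify_actionSeries, quadratic]

lemma baseNormal_sub_quadratic_mem (ω : Fin d → ℝ) (p q : Fin d) :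
    ofActions d (baseNormal ω p q) - quadratic ω ∈ ordGE _ ℝ 4 := by
  rw [baseNormal, map_add, quadratic, add_sub_cancel_left, map_mul, ofActions_X, ofActions_X]
  exact mul_mem_ordGE (actionSeries_mem p) (actionSeries_mem q)

variable {ω : Fin d → ℝ} {p q : Fin d} {c : ℝ} {k l m : ℕ} {χ : PS d ℝ}

lemma coeff_ham_baseNormal (g : PS d ℂ) (a : Fin d ⊕ Fin d →₀ ℕ) :
    coeff a (ham (complexify d (ofActions d (baseNormal ω p q))) g) =
      (eigenvalue ω a : ℂ) * coeff a g +
      ((if dia (Finsupp.single p 1) ≤ a then ((a (Sum.inr q) : ℂ) - a (Sum.inl q)) *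
        coeff (a - dia (Finsupp.single p 1)) g else 0) +
      (if dia (Finsupp.single q 1) ≤ a then ((a (Sum.inr p) : ℂ) - a (Sum.inl p)) *
        coeff (a - dia (Finsupp.single q 1)) g else 0)) := by
  rw [complexify_baseNormal, map_add, Derivation.add_apply, map_add, coeff_ham_quadratic,
    coeff_ham_actions_mul]

lemma eigenvalue_add_dia (a : Fin d ⊕ Fin d →₀ ℕ) (b : Fin d →₀ ℕ) :
    eigenvalue ω (a + dia b) = eigenvalue ω a := by
  refine Finset.sum_congr rfl fun j _ => ?_
  simp

lemma eigenvalue_modeExp :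
    eigenvalue ω (modeExp p q k l m) = -(k * ω p + ((l : ℝ) - m) * ω q) := by
  classical
  simp only [eigenvalue, modeExp, Finsupp.add_apply, Finsupp.single_apply, Sum.inl.injEq,
    Sum.inr.injEq, reduceCtorEq, if_false, zero_add, add_zero, Nat.cast_add, Nat.cast_ite,
    Nat.cast_zero, mul_sub, mul_add, mul_ite, mul_zero, Finset.sum_sub_distrib,
    Finset.sum_add_distrib, Finset.sum_ite_eq, Finset.mem_univ, if_true]
  ring

lemma eigenvalue_modeExpConj :
    eigenvalue ω (modeExpConj p q k l m) = k * ω p + ((l : ℝ) - m) * ω q := by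
  classical
  simp only [eigenvalue, modeExpConj, Finsupp.add_apply, Finsupp.single_apply, Sum.inl.injEq,
    Sum.inr.injEq, reduceCtorEq, if_false, zero_add, add_zero, Nat.cast_add, Nat.cast_ite,
    Nat.cast_zero, mul_sub, mul_add, mul_ite, mul_zero, Finset.sum_sub_distrib,
    Finset.sum_add_distrib, Finset.sum_ite_eq, Finset.mem_univ, if_true]
  ring

/-- The coefficients of the solution of the linearized equation along a ray. -/
lemma coeff_ray_of_ham_eq {g f : PS d ℂ} {b : Fin d ⊕ Fin d →₀ ℕ} {s r δ : ℂ}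
    (hg : ham (complexify d (ofActions d (baseNormal ω p q))) g = f)
    (hp : b (Sum.inl p) = 0 ∨ b (Sum.inr p) = 0) (hq : b (Sum.inl q) = 0 ∨ b (Sum.inr q) = 0)
    (hpq : p ≠ q) (hf : coeff b f = s)
    (hf' : ∀ n, coeff (b + dia (Finsupp.single q (n + 1))) f = 0)
    (hδ : (eigenvalue ω b : ℂ) = δ) (hδ0 : δ ≠ 0)
    (hr : ((b (Sum.inr p) : ℂ) - b (Sum.inl p)) = r) (n : ℕ) :
    coeff (b + dia (Finsupp.single q n)) g = s / δ * (-(r / δ)) ^ n := by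
  classical
  -- No exponent on the ray contains a full factor ξ_p η_p, so shifts by I_p drop out and the
  -- equation becomes δ g_{n+1} + r g_n = 0.
  have hnp : ∀ n, ¬ dia (Finsupp.single p 1) ≤ b + dia (Finsupp.single q n) := fun n h => by
    rcases hp with hp | hp
    · have := h (Sum.inl p)
      simp [hp, hpq.symm] at this
    · have := h (Sum.inr p)
      simp [hp, hpq.symm] at this
  have hnq : ¬ dia (Finsupp.single q 1) ≤ b := fun h => by
    rcases hq with hq | hq
    · have := h (Sum.inl q)
      simp [hq] at this
    · have := h (Sum.inr q)
      simp [hq] at this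
  induction n with
  | zero =>
    have h1 := congrArg (coeff b) hg
    have h0 := hnp 0
    rw [Finsupp.single_zero, show dia (0 : Fin d →₀ ℕ) = 0 by ext (i | i) <;> rfl,
      add_zero] at h0
    rw [coeff_ham_baseNormal, if_neg h0, if_neg hnq, hδ, hf, add_zero, add_zero] at h1
    rw [Finsupp.single_zero, show dia (0 : Fin d →₀ ℕ) = 0 by ext (i | i) <;> rfl, add_zero,
      pow_zero, mul_one, eq_div_iff hδ0, mul_comm, h1]
  | succ n ih =>
    have h1 := congrArg (coeff (b + dia (Finsupp.single q (n + 1)))) hg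
    have h2 : b + dia (Finsupp.single q (n + 1)) =
        b + dia (Finsupp.single q n) + dia (Finsupp.single q 1) := by
      rw [add_assoc, ← dia_add, ← Finsupp.single_add]
    have h3 : dia (Finsupp.single q 1) ≤ b + dia (Finsupp.single q (n + 1)) := by
      rw [h2]; exact le_add_self
    have h4 : (((b + dia (Finsupp.single q (n + 1))) (Sum.inr p) : ℕ) : ℂ) -
        (((b + dia (Finsupp.single q (n + 1))) (Sum.inl p) : ℕ) : ℂ) = r := by
      rw [← hr]; simp
    rw [coeff_ham_baseNormal, if_neg (hnp _), if_pos h3, hf', eigenvalue_add_dia, hδ, h4] at h1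
    have h5 : b + dia (Finsupp.single q (n + 1)) - dia (Finsupp.single q 1) =
        b + dia (Finsupp.single q n) := by rw [h2, add_tsub_cancel_right]
    rw [h5, ih] at h1
    rw [pow_succ]
    have h6 : coeff (b + dia (Finsupp.single q (n + 1))) g * δ =
        s / δ * (-(r / δ)) ^ n * (-(r / δ)) * δ := by
      have : r / δ * δ = r := div_mul_cancel₀ _ hδ0
      linear_combination h1 + (s / δ * (-(r / δ)) ^ n) * this
    rw [mul_right_cancel₀ hδ0 h6]
    ring

/-- The exponent at which the mode contributes to the normal form. -/
def rayExp (p q : Fin d) (k n : ℕ) : Fin d →₀ ℕ := Finsupp.single p (k - 1) + Finsupp.single q n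

/-- The target has only k - 1 factors ξ_p and k - 1 factors η_p, while the mode carries k of one of
them. Only differentiation by that variable can contribute; it gives one factor k and the conjugate
derivative of g gives the other. -/
lemma coeff_ham_modeSeries (hpq : p ≠ q) (hk : 1 ≤ k) (g : PS d ℂ) (n : ℕ) :
    coeff (dia (rayExp p q k (l + m + n))) (ham g (complexify d (modeSeries p q c k l m))) =
      c * k ^ 2 * (coeff (modeExp p q k l m + dia (Finsupp.single q n)) g -
        coeff (modeExpConj p q k l m + dia (Finsupp.single q n)) g) := by
  classical
  have z1 : ∀ (f : PS d ℂ) v, v ≠ Sum.inl p → coeff (dia (rayExp p q k (l + m + n)))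
      (f * pderiv ℂ v (monomial (modeExp p q k l m) 1)) = 0 := fun f v hv => by
    rw [coeff_mul_pderiv_monomial, if_neg]
    intro h
    have := h (Sum.inl p)
    simp [modeExp, rayExp, hpq.symm, hv] at this
    omega
  have z2 : ∀ (f : PS d ℂ) v, v ≠ Sum.inr p → coeff (dia (rayExp p q k (l + m + n)))
      (f * pderiv ℂ v (monomial (modeExpConj p q k l m) 1)) = 0 := fun f v hv => by
    rw [coeff_mul_pderiv_monomial, if_neg]
    intro h
    have := h (Sum.inr p)
    simp [modeExpConj, rayExp, hpq.symm, hv] at this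
    omega
  have w1 : modeExp p q k l m - Finsupp.single (Sum.inl p) 1 ≤
      dia (rayExp p q k (l + m + n)) := by
    rintro (i | i) <;>
    simp only [modeExp, rayExp, Finsupp.tsub_apply, Finsupp.add_apply, dia_inl, dia_inr,
      Finsupp.single_apply, Sum.inl.injEq, Sum.inr.injEq, reduceCtorEq, if_false] <;>
    split_ifs <;> omega
  have w2 : modeExpConj p q k l m - Finsupp.single (Sum.inr p) 1 ≤
      dia (rayExp p q k (l + m + n)) := by
    rintro (i | i) <;>
    simp only [modeExpConj, rayExp, Finsupp.tsub_apply, Finsupp.add_apply, dia_inl, dia_inr,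
      Finsupp.single_apply, Sum.inl.injEq, Sum.inr.injEq, reduceCtorEq, if_false] <;>
    split_ifs <;> omega
  have v1 : dia (rayExp p q k (l + m + n)) - (modeExp p q k l m - Finsupp.single (Sum.inl p) 1) +
      Finsupp.single (Sum.inr p) 1 = modeExpConj p q k l m + dia (Finsupp.single q n) := by
    ext (i | i) <;>
    simp only [modeExp, modeExpConj, rayExp, Finsupp.tsub_apply, Finsupp.add_apply, dia_inl,
      dia_inr, Finsupp.single_apply, Sum.inl.injEq, Sum.inr.injEq, reduceCtorEq, if_false] <;>
    split_ifs <;> omega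
  have v2 : dia (rayExp p q k (l + m + n)) -
      (modeExpConj p q k l m - Finsupp.single (Sum.inr p) 1) +
      Finsupp.single (Sum.inl p) 1 = modeExp p q k l m + dia (Finsupp.single q n) := by
    ext (i | i) <;>
    simp only [modeExp, modeExpConj, rayExp, Finsupp.tsub_apply, Finsupp.add_apply, dia_inl,
      dia_inr, Finsupp.single_apply, Sum.inl.injEq, Sum.inr.injEq, reduceCtorEq, if_false] <;>
    split_ifs <;> omega
  have u1 : (dia (rayExp p q k (l + m + n)) - (modeExp p q k l m - Finsupp.single (Sum.inl p) 1) :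
      Fin d ⊕ Fin d →₀ ℕ) (Sum.inr p) = k - 1 := by
    simp [modeExp, rayExp, hpq.symm]
  have u2 : (dia (rayExp p q k (l + m + n)) -
      (modeExpConj p q k l m - Finsupp.single (Sum.inr p) 1) : Fin d ⊕ Fin d →₀ ℕ) (Sum.inl p) =
      k - 1 := by
    simp [modeExpConj, rayExp, hpq.symm]
  have x1 : modeExp p q k l m (Sum.inl p) = k := by
    simp [modeExp, hpq.symm]
  have x2 : modeExpConj p q k l m (Sum.inr p) = k := by
    simp [modeExpConj, hpq.symm]
  have hk1 : (((k - 1 : ℕ) : ℂ) + 1) = k := by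
    rw [Nat.cast_sub hk]; push_cast; ring
  rw [complexify_modeSeries, Derivation.map_smul, map_add, coeff_smul, map_add, ham_apply,
    ham_apply, map_sum, map_sum, Finset.sum_eq_single p, Finset.sum_eq_single p]
  · rw [map_sub, map_sub, z1 _ (Sum.inr p) (by simp), z2 _ (Sum.inl p) (by simp), coeff_mul_pderiv_monomial,
      coeff_mul_pderiv_monomial, if_pos w1, if_pos w2, coeff_pderiv, coeff_pderiv, v1, v2, u1, u2,
      x1, x2, hk1]
    ring
  · intro j _ hj
    rw [map_sub, z2 _ _ (by simpa using hj), z2 _ _ (by simp), sub_zero]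
  · simp
  · intro j _ hj
    rw [map_sub, z1 _ _ (by simp), z1 _ _ (by simpa using hj), sub_zero]
  · simp

/-- Along powers of I_q, χ is the mode divided by δ + k I_q, up to a unit. The conjugate halves have
opposite divisors and add up to the factor 2. -/
lemma coeff_actionPart_ham_modeSeries (hpq : p ≠ q) (hk : 1 ≤ k) (hlm : l = 0 ∨ m = 0)
    (hδ : k * ω p + ((l : ℝ) - m) * ω q ≠ 0)
    (hχ : ham (ofActions d (baseNormal ω p q)) χ = modeSeries p q c k l m) (n : ℕ) :
    coeff (rayExp p q k (l + m + n)) (actionPart d (ham χ (modeSeries p q c k l m))) =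
      -2 * c ^ 2 * k ^ 2 / (k * ω p + ((l : ℝ) - m) * ω q) *
        (-(k / (k * ω p + ((l : ℝ) - m) * ω q))) ^ n := by
  classical
  set δ := k * ω p + ((l : ℝ) - m) * ω q with hδd
  have hg : ham (complexify d (ofActions d (baseNormal ω p q))) (complexify d χ) =
      Complex.I • complexify d (modeSeries p q c k l m) := by rw [ham_complexify, hχ]
  have hδ0 : (δ : ℂ) ≠ 0 := by exact_mod_cast hδ
  have x1 : modeExp p q k l m (Sum.inl p) = k := by
    simp [modeExp, hpq.symm]
  have x2 : modeExpConj p q k l m (Sum.inr p) = k := by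
    simp [modeExpConj, hpq.symm]
  have x3 : modeExp p q k l m (Sum.inr p) = 0 := by
    simp [modeExp, hpq.symm]
  have x4 : modeExpConj p q k l m (Sum.inl p) = 0 := by
    simp [modeExpConj, hpq.symm]
  have x5 : modeExp p q k l m (Sum.inl q) = l := by
    simp [modeExp, hpq]
  have x6 : modeExp p q k l m (Sum.inr q) = m := by
    simp [modeExp]
  have x7 : modeExpConj p q k l m (Sum.inl q) = m := by
    simp [modeExpConj]
  have x8 : modeExpConj p q k l m (Sum.inr q) = l := by
    simp [modeExpConj, hpq]
  have y1 : ∀ n, modeExp p q k l m + dia (Finsupp.single q n) ≠ modeExpConj p q k l m :=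
    fun n h => by
      have := DFunLike.congr_fun h (Sum.inl p)
      rw [Finsupp.add_apply, x1, x4] at this
      omega
  have y2 : ∀ n, modeExpConj p q k l m + dia (Finsupp.single q n) ≠ modeExp p q k l m :=
    fun n h => by
      have := DFunLike.congr_fun h (Sum.inr p)
      rw [Finsupp.add_apply, x2, x3] at this
      omega
  have y3 : ∀ n (b : Fin d ⊕ Fin d →₀ ℕ), b + dia (Finsupp.single q (n + 1)) ≠ b := fun n b h => by
    have := DFunLike.congr_fun h (Sum.inl q)
    simp at this
  have y4 : modeExp p q k l m ≠ modeExpConj p q k l m := fun h => by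
    rw [← x1, h, x4] at hk; omega
  have r1 := coeff_ray_of_ham_eq hg (Or.inr x3) (by rw [x5, x6]; exact hlm) hpq
    (s := Complex.I * c) (r := -k) (δ := -δ)
    (by rw [coeff_smul, complexify_modeSeries, coeff_smul, map_add, coeff_monomial_same,
          coeff_monomial_ne y4, add_zero, mul_one])
    (fun n => by
      rw [coeff_smul, complexify_modeSeries, coeff_smul, map_add, coeff_monomial_ne (y3 n _),
          coeff_monomial_ne (y1 _), add_zero, mul_zero, mul_zero])
    (by rw [eigenvalue_modeExp, ← hδd, Complex.ofReal_neg]) (neg_ne_zero.2 hδ0)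
    (by rw [x1, x3]; simp) n
  have r2 := coeff_ray_of_ham_eq hg (Or.inl x4) (by rw [x7, x8]; exact hlm.symm) hpq
    (s := Complex.I * c) (r := k) (δ := δ)
    (by rw [coeff_smul, complexify_modeSeries, coeff_smul, map_add, coeff_monomial_same,
          coeff_monomial_ne y4.symm, zero_add, mul_one])
    (fun n => by
      rw [coeff_smul, complexify_modeSeries, coeff_smul, map_add, coeff_monomial_ne (y3 n _),
          coeff_monomial_ne (y2 _), add_zero, mul_zero, mul_zero])
    (by rw [eigenvalue_modeExpConj, ← hδd]) hδ0
    (by rw [x2, x4]; simp) n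
  have h1 : complexify d (ham χ (modeSeries p q c k l m)) = (-Complex.I) •
      ham (complexify d χ) (complexify d (modeSeries p q c k l m)) := by
    rw [ham_complexify, smul_smul, neg_mul, Complex.I_mul_I, neg_neg, one_smul]
  rw [coeff_actionPart, h1, coeff_smul, coeff_ham_modeSeries hpq hk, r1, r2, neg_div_neg_eq]
  have h2 : -Complex.I * (c * k ^ 2 * (Complex.I * c / -δ * (-((k : ℂ) / δ)) ^ n -
      Complex.I * c / δ * (-((k : ℂ) / δ)) ^ n)) =
      ((-2 * c ^ 2 * k ^ 2 / δ * (-(k / δ)) ^ n : ℝ) : ℂ) := by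
    push_cast
    rw [div_neg]
    field_simp
    linear_combination (2 * (c : ℂ) ^ 2 * k ^ 2 * (-((k : ℂ) / δ)) ^ n) * Complex.I_sq
  rw [h2, Complex.ofReal_re]

end ModeCoefficient

end Birkhoff

namespace Birkhoff

open MvPowerSeries

/-! ### The normal form along a line of perturbations -/

section Line

variable {d : ℕ}

lemma expHam_zero (f : PS d ℝ) : expHam 0 f = f := by
  have h : (adHam (0 : PS d ℝ)) = 0 := by
    ext1 f
    simp
  ext a
  rw [coeff_expHam, expPartial_apply, Finset.sum_eq_single 0]
  · simp
  · intro k _ hk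
    rw [h, zero_pow hk]
    simp
  · simp

lemma generator_ofActions (ω : Fin d → ℝ) (B : MvPowerSeries (Fin d) ℝ) :
    generator ω (ofActions d B) = 0 := by
  have h : ∀ n, genSeq ω (ofActions d B) n = 0 := by
    intro n
    induction n with
    | zero => rfl
    | succ n ih => rw [genSeq, ih, expHam_zero, homological_ofActions, zero_add]
  ext a
  rw [generator, coeff_ofCoeffs, h]

/-- Families that are linear in the parameters. -/
def family (N : PS d ℝ) (F : ℕ → PS d ℝ) (ζ : ℕ → ℝ) : PS d ℝ :=
  -- In the application F n has order at least n + 3, so the finite range contains every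
  -- contribution.
  ofCoeffs fun a => coeff a N + ∑ n ∈ Finset.range (a.degree + 1), ζ n * coeff a (F n)

lemma coeff_family (N : PS d ℝ) (F : ℕ → PS d ℝ) (ζ : ℕ → ℝ) (a : Fin d ⊕ Fin d →₀ ℕ) :
    coeff a (family N F ζ) =
      coeff a N + ∑ n ∈ Finset.range (a.degree + 1), ζ n * coeff a (F n) := rfl

lemma family_mem_polyFam {N : PS d ℝ} (hN : N ∈ ordGE _ ℝ 2) {F : ℕ → PS d ℝ}
    (hF : ∀ n, F n ∈ ordGE _ ℝ 3) : family N F ∈ polyFam d := by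
  intro a
  simp only [coeff_family]
  refine Submodule.add_mem _ ?_ (sum_mem_polyFun _ _ fun n _ => ?_)
  · by_cases h : a.degree < 2
    · rw [hN a h]; exact Submodule.zero_mem _
    · exact const_mem_polyFun (not_lt.1 h) _
  · by_cases h : a.degree < 3
    · simp only [hF n a h, mul_zero]
      exact Submodule.zero_mem _
    · simp only [mul_comm _ (coeff a (F n))]
      exact Submodule.smul_mem _ (coeff a (F n)) (coord_mem_polyFun (not_lt.1 h) n)

lemma family_sub_mem {N : PS d ℝ} {F : ℕ → PS d ℝ} (hF : ∀ n, F n ∈ ordGE _ ℝ 3) (ζ : ℕ → ℝ) :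
    family N F ζ - N ∈ ordGE _ ℝ 3 := by
  intro a ha
  rw [map_sub, coeff_family, add_sub_cancel_left]
  exact Finset.sum_eq_zero fun n _ => by rw [hF n a ha, mul_zero]

lemma family_single {N : PS d ℝ} {F : ℕ → PS d ℝ} (hF : ∀ n, F n ∈ ordGE _ ℝ (n + 3)) (n : ℕ)
    (τ : ℝ) : family N F (fun i => τ * (Pi.single n 1 : ℕ → ℝ) i) = N + τ • F n := by
  classical
  ext a
  rw [coeff_family, map_add, coeff_smul]
  congr 1
  by_cases h : n ∈ Finset.range (a.degree + 1)
  · rw [Finset.sum_eq_single_of_mem n h, Pi.single_eq_same, mul_one]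
    intro i _ hi
    rw [Pi.single_eq_of_ne hi]; simp
  · rw [hF n a (by simp at h; omega), mul_zero]
    refine Finset.sum_eq_zero fun i hi => ?_
    rw [Pi.single_eq_of_ne (by rintro rfl; exact h hi)]
    simp

/-- χ₁ is the τ-derivative at 0 of the canonical generator, whose coefficients are polynomials in τ
vanishing at 0, because N is already normal. -/
lemma exists_normalForm_line {ω : Fin d → ℝ} (hω : LinearIndependent ℚ ω)
    {n : MvPowerSeries (Fin d) ℝ} (hn : ofActions d n - quadratic ω ∈ ordGE _ ℝ 3) {F : PS d ℝ}
    (hF3 : F ∈ ordGE _ ℝ 3) (hF : actionPart d F = 0) :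
    ∃ χ₁ : PS d ℝ, ham (ofActions d n) χ₁ = F ∧ ∀ c,
      (fun τ : ℝ => coeff c (normalForm ω (ofActions d n + τ • F)) - coeff c n -
        τ ^ 2 * (2⁻¹ * coeff c (actionPart d (ham χ₁ F)))) =O[𝓝 0] fun τ : ℝ => τ ^ 3 := by
  have hfam : (fun ζ : ℕ → ℝ => ofActions d n + ζ 0 • F) ∈ polyFam d := by
    have := family_mem_polyFam (mem_ordGE_two_of_sub_quadratic hn)
      (F := fun n => if n = 0 then F else 0)
      (fun n => by split_ifs; exacts [hF3, Submodule.zero_mem _])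
    convert this using 1
    ext ζ a
    rw [coeff_family, Finset.sum_eq_single_of_mem 0 (by simp)]
    · simp
    · intro b _ hb
      simp [hb]
  have hpoly : ∀ a, ∃ Q : Polynomial ℝ, ∀ τ : ℝ,
      coeff a (generator ω (ofActions d n + τ • F)) = Q.eval τ := fun a => by
    obtain ⟨Q, -, hQ⟩ := exists_polynomial_of_mem_polyFun (generator_mem_polyFam ω hfam a)
      0 (fun _ => 1)
    exact ⟨Q, fun τ => by simpa using hQ τ⟩
  choose Q hQ using hpoly
  have hQ0 : ∀ a, (Q a).coeff 0 = 0 := fun a => by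
    have := hQ a 0
    rw [zero_smul, add_zero, generator_ofActions, map_zero] at this
    rw [Polynomial.coeff_zero_eq_eval_zero, ← this]
  have hmem : ∀ τ : ℝ, ofActions d n + τ • F - quadratic ω ∈ ordGE _ ℝ 3 := fun τ => by
    rw [add_sub_right_comm]
    exact Submodule.add_mem _ hn (Submodule.smul_mem _ _ hF3)
  refine ⟨ofCoeffs fun a => (Q a).coeff 1, normalForm_expand hω hF
    (χ := fun τ => generator ω (ofActions d n + τ • F)) (fun τ => generator_mem hω (hmem τ))
    (fun a => ?_) (fun τ => expHam_generator hω (hmem τ))⟩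
  have h : ∀ τ : ℝ, coeff a (generator ω (ofActions d n + τ • F) -
      τ • (ofCoeffs fun a => (Q a).coeff 1)) = τ ^ 2 * ((Q a).divX.divX).eval τ := fun τ => by
    rw [map_sub, coeff_smul, coeff_ofCoeffs, hQ]
    conv_lhs => rw [← Polynomial.divX_mul_X_add (Q a), ← Polynomial.divX_mul_X_add (Q a).divX]
    simp [hQ0, Polynomial.coeff_divX]
    ring
  simp only [h]
  have h1 : (fun τ : ℝ => ((Q a).divX.divX).eval τ) =O[𝓝 0] fun _ => (1 : ℝ) :=
    ((Q a).divX.divX.continuous.tendsto 0).isBigO_one ℝ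
  simpa using (Asymptotics.isBigO_refl (fun τ : ℝ => τ ^ 2) (𝓝 0)).mul h1

lemma actionPart_modeSeries {p q : Fin d} (hpq : p ≠ q) {k : ℕ} (hk : 1 ≤ k) (c : ℝ) (l m : ℕ) :
    actionPart d (modeSeries p q c k l m) = 0 := by
  classical
  ext b
  have h1 : dia b ≠ modeExp p q k l m := fun h => by
    have h1 := DFunLike.congr_fun h (Sum.inl p)
    have h2 := DFunLike.congr_fun h (Sum.inr p)
    simp [modeExp, hpq.symm] at h1 h2
    omega
  have h2 : dia b ≠ modeExpConj p q k l m := fun h => by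
    have h1 := DFunLike.congr_fun h (Sum.inl p)
    have h2 := DFunLike.congr_fun h (Sum.inr p)
    simp [modeExpConj, hpq.symm] at h1 h2
    omega
  rw [coeff_actionPart, complexify_modeSeries, coeff_smul, map_add, coeff_monomial_ne h1,
    coeff_monomial_ne h2]
  simp

/-- The second order coefficients of the normal form of a single perturbed mode. -/
lemma isBigO_normalForm_modeSeries {ω : Fin d → ℝ} (hω : LinearIndependent ℚ ω) {p q : Fin d}
    (hpq : p ≠ q) {k l m : ℕ} (hk : 3 ≤ k) (hlm : l = 0 ∨ m = 0) (c : ℝ)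
    (hδ : k * ω p + ((l : ℝ) - m) * ω q ≠ 0) (n : ℕ) :
    (fun τ : ℝ => coeff (rayExp p q k (l + m + n))
        (normalForm ω (ofActions d (baseNormal ω p q) + τ • modeSeries p q c k l m)) -
      coeff (rayExp p q k (l + m + n)) (baseNormal ω p q) -
      τ ^ 2 * (-(c ^ 2 * k ^ 2 / (k * ω p + ((l : ℝ) - m) * ω q)) *
        (-(k / (k * ω p + ((l : ℝ) - m) * ω q))) ^ n)) =O[𝓝 0] fun τ : ℝ => τ ^ 3 := by
  obtain ⟨χ, hχ, h⟩ := exists_normalForm_line hω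
    (ordGE_anti (by norm_num) (baseNormal_sub_quadratic_mem ω p q))
    (ordGE_anti (by omega) (modeSeries_mem p q c k l m))
    (actionPart_modeSeries hpq (by omega) c l m)
  refine (h (rayExp p q k (l + m + n))).congr_left fun τ => ?_
  rw [coeff_actionPart_ham_modeSeries hpq (by omega) hlm hδ hχ]
  ring

end Line

end Birkhoff

namespace Birkhoff

/-! ### Polynomial inequalities -/

section PolynomialBounds

open Polynomial

lemma abs_eval_T_le {x : ℝ} (hx : 1 ≤ x) (n : ℕ) :
    |(Chebyshev.T ℝ n).eval x| ≤ (2 * x + 1) ^ n := by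
  induction n using Nat.twoStepInduction with
  | zero => simp
  | one =>
    simp only [Nat.cast_one, Chebyshev.T_one, eval_X, pow_one]
    rw [abs_of_nonneg (by linarith)]; linarith
  | more n h1 h2 =>
    have e : ((n + 2 : ℕ) : ℤ) = (n : ℤ) + 2 := by push_cast; ring
    rw [e, Chebyshev.T_add_two]
    push_cast at h2
    simp only [eval_sub, eval_mul, eval_X, eval_ofNat]
    refine (abs_sub _ _).trans ?_
    rw [abs_mul, abs_of_nonneg (show 0 ≤ 2 * x by linarith)]
    have h3 : 2 * x * |(Chebyshev.T ℝ (n + 1)).eval x| ≤ 2 * x * (2 * x + 1) ^ (n + 1) :=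
      mul_le_mul_of_nonneg_left h2 (by linarith)
    have h4 : (2 * x + 1) ^ n ≤ (2 * x + 1) ^ (n + 1) :=
      pow_le_pow_right₀ (by linarith) (Nat.le_succ n)
    calc _ ≤ 2 * x * (2 * x + 1) ^ (n + 1) + (2 * x + 1) ^ (n + 1) := by linarith
      _ = (2 * x + 1) ^ (n + 2) := by ring

/-- Among polynomials bounded by 1 on [-1, 1] the Chebyshev polynomial grows fastest outside it. The
undifferentiated case k = 0 is used, for P and -P. -/
lemma abs_eval_le_of_le_on_Icc {n : ℕ} {P : ℝ[X]} (hP : P.natDegree ≤ n) {M : ℝ} (hM : 0 < M)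
    (h : ∀ t ∈ Set.Icc (-1 : ℝ) 1, |P.eval t| ≤ M) {x : ℝ} (hx : 1 ≤ x) :
    |P.eval x| ≤ M * (2 * x + 1) ^ n := by
  have key : ∀ Q : ℝ[X], Q.natDegree ≤ n → (∀ t ∈ Set.Icc (-1 : ℝ) 1, |Q.eval t| ≤ M) →
      Q.eval x ≤ M * (2 * x + 1) ^ n := by
    intro Q hQ h
    have h1 := Chebyshev.eval_iterate_derivative_le_of_forall_abs_le_one (n := n)
      (P := C M⁻¹ * Q) (k := 0) hx
      (natDegree_le_iff_degree_le.1 ((natDegree_C_mul_le _ _).trans hQ)) (fun t ht => by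
        rw [eval_mul, eval_C, abs_mul, abs_of_pos (inv_pos.2 hM), inv_mul_le_iff₀ hM, mul_one]
        exact h t ht)
    simp only [Function.iterate_zero, id_eq, eval_mul, eval_C] at h1
    rw [← inv_mul_le_iff₀ hM]
    exact h1.trans ((le_abs_self _).trans (abs_eval_T_le hx n))
  refine abs_le.2 ⟨?_, key P hP h⟩
  have := key (-P) (by rwa [natDegree_neg]) (fun t ht => by rw [eval_neg, abs_neg]; exact h t ht)
  rw [eval_neg] at this
  linarith

/-- A polynomial that is bounded on `[c, 1]` is bounded at `0`, geometrically in the degree. -/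
lemma exists_abs_coeff_zero_le {c : ℝ} (hc0 : 0 < c) (hc1 : c < 1) :
    ∃ K : ℝ, 1 ≤ K ∧ ∀ (n : ℕ) (P : ℝ[X]) (M : ℝ), P.natDegree ≤ n → 0 < M →
      (∀ t ∈ Set.Icc c 1, |P.eval t| ≤ M) → |P.coeff 0| ≤ M * K ^ n := by
  have hs : 1 ≤ (1 + c) / (1 - c) := by
    rw [le_div_iff₀ (by linarith)]; linarith
  refine ⟨2 * ((1 + c) / (1 - c)) + 1, by linarith, fun n P M hP hM h => ?_⟩
  -- The decreasing affine map of [-1, 1] onto [c, 1] takes the value 0 at (1 + c)/(1 - c).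
  have h1 := abs_eval_le_of_le_on_Icc (n := n)
    (P := P.comp (C ((1 + c) / 2) + C (-((1 - c) / 2)) * X)) (M := M) ?_ hM ?_ hs
  · rw [eval_comp] at h1
    have e : (C ((1 + c) / 2) + C (-((1 - c) / 2)) * X).eval ((1 + c) / (1 - c)) = 0 := by
      have : 1 - c ≠ 0 := by linarith
      simp only [eval_add, eval_mul, eval_C, eval_X]
      field_simp
      ring
    rwa [e, ← coeff_zero_eq_eval_zero] at h1
  · refine natDegree_comp_le.trans ?_
    calc _ ≤ n * 1 := Nat.mul_le_mul hP (by compute_degree)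
      _ = n := mul_one n
  · intro t ht
    rw [eval_comp]
    refine h _ ?_
    simp only [eval_add, eval_mul, eval_C, eval_X]
    constructor <;> nlinarith [ht.1, ht.2]

/-- A polynomial that is bounded on `[0, 1]` has bounded second coefficient, geometrically in the
degree. -/
lemma exists_abs_coeff_two_le :
    ∃ K : ℝ, 1 ≤ K ∧ ∀ (n : ℕ) (P : ℝ[X]) (M : ℝ), P.natDegree ≤ n → 0 < M →
      (∀ t ∈ Set.Icc (0 : ℝ) 1, |P.eval t| ≤ M) → |P.coeff 2| ≤ 16 * M * K ^ n := by
  obtain ⟨K, hK, h⟩ := exists_abs_coeff_zero_le (c := 1 / 2) (by norm_num) (by norm_num)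
  -- On [1/2, 1] division by t costs a factor 2, and P(0) is bounded by extrapolation, whence 4 M
  -- K^n. Two divisions and one last extrapolation give 16 M K^(3n).
  have step : ∀ (n : ℕ) (P : ℝ[X]) (M : ℝ), P.natDegree ≤ n → 0 < M →
      (∀ t ∈ Set.Icc (1 / 2 : ℝ) 1, |P.eval t| ≤ M) →
      P.divX.natDegree ≤ n ∧ ∀ t ∈ Set.Icc (1 / 2 : ℝ) 1, |P.divX.eval t| ≤ 4 * M * K ^ n := by
    intro n P M hP hM hb
    refine ⟨(natDegree_divX_eq_natDegree_tsub_one (p := P)).le.trans (by omega), fun t ht => ?_⟩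
    have h0 := h n P M hP hM hb
    have h1 := hb t ht
    have e : P.eval t = P.divX.eval t * t + P.coeff 0 := by
      conv_lhs => rw [← divX_mul_X_add P]
      simp
    have h2 : |P.divX.eval t| * t ≤ M + M * K ^ n := by
      rw [← abs_of_nonneg (show 0 ≤ t by linarith [ht.1]), ← abs_mul,
        abs_of_nonneg (show 0 ≤ t by linarith [ht.1])]
      rw [show P.divX.eval t * t = P.eval t - P.coeff 0 by rw [e]; ring]
      exact (abs_sub _ _).trans (add_le_add h1 h0)
    have h3 : M ≤ M * K ^ n := le_mul_of_one_le_right hM.le (one_le_pow₀ hK)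
    nlinarith [ht.1, abs_nonneg (P.divX.eval t)]
  refine ⟨K ^ 3, one_le_pow₀ hK, fun n P M hP hM hb => ?_⟩
  have hKn : 0 < K ^ n := by positivity
  obtain ⟨d1, b1⟩ := step n P M hP hM fun t ht => hb t ⟨by linarith [ht.1], ht.2⟩
  obtain ⟨d2, b2⟩ := step n P.divX _ d1 (by positivity) b1
  have := h n P.divX.divX _ d2 (by positivity) b2
  rw [coeff_divX, coeff_divX] at this
  refine this.trans (le_of_eq ?_)
  rw [← pow_mul, mul_comm 3 n, pow_mul]
  ring

end PolynomialBounds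

end Birkhoff

namespace Birkhoff

open MvPowerSeries

/-! ### Divergence for some parameters -/

section Divergence

variable {d : ℕ}

/-- A polynomial that is O(τ³) has no terms of degree below 3. -/
lemma coeff_two_eq_of_isBigO {Q : Polynomial ℝ} {a b : ℝ}
    (h : (fun τ : ℝ => Q.eval τ - a - τ ^ 2 * b) =O[𝓝 0] fun τ : ℝ => τ ^ 3) :
    Q.coeff 2 = b := by
  set P : Polynomial ℝ := Q - Polynomial.C a - Polynomial.X ^ 2 * Polynomial.C b with hP
  have hPe : (fun τ : ℝ => P.eval τ) =O[𝓝 0] fun τ : ℝ => τ ^ 3 :=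
    h.congr_left fun τ => by simp [hP]; ring
  have key : ∀ j < 3, P.coeff j = 0 := by
    intro j
    induction j using Nat.strong_induction_on with
    | _ j ih =>
      intro hj
      obtain ⟨R, hR⟩ := Polynomial.X_pow_dvd_iff.2 fun i hi => ih i hi (hi.trans hj)
      have h0 : P.coeff j = R.coeff 0 := by
        rw [hR]; simpa using Polynomial.coeff_X_pow_mul R j 0
      rw [h0]
      refine eq_zero_of_isBigO (k := j) ?_
      have h1 : (fun τ : ℝ => R.coeff 0 * τ ^ j) =
          fun τ => P.eval τ - τ ^ (j + 1) * R.divX.eval τ := by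
        ext τ
        have e : R.eval τ = R.divX.eval τ * τ + R.coeff 0 := by
          conv_lhs => rw [← Polynomial.divX_mul_X_add R]
          simp
        rw [hR, Polynomial.eval_mul, e]
        simp
        ring
      have h2 : (fun τ : ℝ => R.divX.eval τ) =O[𝓝 0] fun _ => (1 : ℝ) :=
        (R.divX.continuous.tendsto 0).isBigO_one ℝ
      rw [h1]
      refine (hPe.trans (isBigO_pow_of_le (by omega))).sub ?_
      simpa using (Asymptotics.isBigO_refl (fun τ : ℝ => τ ^ (j + 1)) (𝓝 0)).mul h2
  have := key 2 (by norm_num)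
  rw [hP] at this
  simp at this
  linarith

lemma abs_coeff_le_of_not_isDivergent {B : MvPowerSeries (Fin d) ℝ} (h : ¬ IsDivergent B) :
    ∃ A : ℕ, ∀ c, |coeff c B| ≤ ((A : ℝ) + 1) ^ (c.degree + 1) := by
  rw [IsDivergent] at h
  push Not at h
  obtain ⟨r, hr, hs⟩ := h
  obtain ⟨A, hA⟩ := exists_nat_ge (max (∑' m : Fin d →₀ ℕ, |coeff m B| * r ^ m.degree) r⁻¹)
  refine ⟨A, fun c => ?_⟩
  have h1 := hs.le_tsum c fun j _ => by positivity
  have h2 : |coeff c B| ≤ (∑' m : Fin d →₀ ℕ, |coeff m B| * r ^ m.degree) * (r⁻¹) ^ c.degree := by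
    rw [inv_pow, ← div_eq_mul_inv, le_div_iff₀ (pow_pos hr _)]
    exact h1
  refine h2.trans ?_
  rw [pow_succ, mul_comm]
  have h3 : r⁻¹ ≤ (A : ℝ) + 1 := ((le_max_right _ _).trans hA).trans (by linarith)
  have h4 : (∑' m : Fin d →₀ ℕ, |coeff m B| * r ^ m.degree) ≤ (A : ℝ) + 1 :=
    ((le_max_left _ _).trans hA).trans (by linarith)
  exact mul_le_mul (pow_le_pow_left₀ (inv_pos.2 hr).le h3 _) h4
    (tsum_nonneg fun m => by positivity) (by positivity)

/-- By Baire's theorem, convergence for all parameters is uniform on a box. -/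
lemma exists_box_of_not_isDivergent {B : (ℕ → ℝ) → MvPowerSeries (Fin d) ℝ}
    (hB : ∀ c, Continuous fun ζ => coeff c (B ζ))
    (h : ∀ ζ : ℕ → ℝ, (∀ n, ζ n ∈ Set.Icc (0 : ℝ) 1) → ¬ IsDivergent (B ζ)) :
    ∃ (A : ℝ) (I : Finset ℕ) (ζ₀ : ℕ → ℝ) (a : ℝ), 1 ≤ A ∧ 0 < a ∧ a < 1 ∧
      ∀ n ∉ I, ∀ t ∈ Set.Icc a 1, ∀ τ ∈ Set.Icc (0 : ℝ) 1, ∀ c,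
        |coeff c (B fun i => τ * (Pi.single n 1 : ℕ → ℝ) i + t * if i ∈ I then ζ₀ i else 0)| ≤
          A ^ (c.degree + 1) := by
  classical
  let E : ℕ → Set (ℕ → Set.Icc (0 : ℝ) 1) := fun A =>
    {ζ | ∀ c, |coeff c (B fun i => ζ i)| ≤ ((A : ℝ) + 1) ^ (c.degree + 1)}
  have hE : ∀ A, IsClosed (E A) := fun A => by
    simp only [E, Set.ofPred_forall]
    refine isClosed_iInter fun c => isClosed_le ?_ continuous_const
    exact ((hB c).comp (continuous_pi fun i =>
      continuous_subtype_val.comp (continuous_apply i))).abs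
  have hU : ⋃ A, E A = Set.univ := Set.eq_univ_of_forall fun ζ => by
    obtain ⟨A, hA⟩ := abs_coeff_le_of_not_isDivergent (h (fun i => ζ i) fun n => (ζ n).2)
    exact Set.mem_iUnion.2 ⟨A, hA⟩
  obtain ⟨A, ζ₀, hζ₀⟩ := nonempty_interior_of_iUnion_of_closed hE hU
  -- An open set of the product constrains only the coordinates in a finite set I; all others are
  -- free in [0, 1].
  obtain ⟨I, u, hu, hsub⟩ := isOpen_pi_iff.1 isOpen_interior ζ₀ hζ₀
  have hv : ∀ i ∈ I, ∀ᶠ t : ℝ in 𝓝 1, ∀ ht : t * ζ₀ i ∈ Set.Icc (0 : ℝ) 1,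
      (⟨t * ζ₀ i, ht⟩ : Set.Icc (0 : ℝ) 1) ∈ u i := fun i hi => by
    obtain ⟨v, hvo, hv⟩ := isOpen_induced_iff.1 (hu i hi).1
    have h1 : ∀ᶠ t : ℝ in 𝓝 1, t * ζ₀ i ∈ v := by
      refine (by fun_prop : Continuous fun t : ℝ => t * (ζ₀ i : ℝ)).continuousAt.eventually_mem
        (hvo.mem_nhds ?_)
      rw [one_mul]
      have := (hu i hi).2
      rwa [← hv] at this
    filter_upwards [h1] with t ht1 ht
    rw [← hv]
    exact ht1
  have hI := (Filter.eventually_all_finset I).2 hv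
  obtain ⟨ε, hε, hI⟩ := Metric.eventually_nhds_iff.1 hI
  -- The lower end max(1/2, 1 - ε/2) is positive and within ε of 1, so t ζ₀ stays in the
  -- neighbourhood for t between it and 1.
  refine ⟨A + 1, I, fun i => ζ₀ i, max (1 / 2) (1 - ε / 2), by simp,
    lt_of_lt_of_le (by norm_num) (le_max_left _ _), max_lt (by norm_num) (by linarith),
    fun n hn t ht τ hτ c => ?_⟩
  have ht0 : 0 ≤ t := le_trans (by norm_num) ((le_max_left _ _).trans ht.1)
  have hmem : ∀ i, τ * (Pi.single n 1 : ℕ → ℝ) i + t * (if i ∈ I then (ζ₀ i : ℝ) else 0) ∈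
      Set.Icc (0 : ℝ) 1 := fun i => by
    by_cases hi : i ∈ I
    · rw [Pi.single_eq_of_ne (by rintro rfl; exact hn hi), if_pos hi, mul_zero, zero_add]
      exact ⟨mul_nonneg ht0 (ζ₀ i).2.1, mul_le_one₀ ht.2 (ζ₀ i).2.1 (ζ₀ i).2.2⟩
    · rw [if_neg hi, mul_zero, add_zero]
      by_cases h : i = n
      · subst h; simpa using hτ
      · rw [Pi.single_eq_of_ne h]; simp
  refine (interior_subset (hsub (?_ : (fun i => ⟨_, hmem i⟩) ∈ _)) : _ ∈ E A) c
  intro i hi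
  have hi' : i ∈ I := hi
  have h1 := hI (y := t) (by
    rw [Real.dist_eq, abs_sub_comm, abs_of_nonneg (by linarith [ht.2])]
    linarith [(le_max_right (1 / 2 : ℝ) (1 - ε / 2)).trans ht.1]) i hi'
  have e : τ * (Pi.single n 1 : ℕ → ℝ) i + t * (if i ∈ I then (ζ₀ i : ℝ) else 0) = t * ζ₀ i := by
    rw [Pi.single_eq_of_ne (by rintro rfl; exact hn hi'), if_pos hi', mul_zero, zero_add]
  have h2 := h1 (e ▸ hmem i)
  convert h2 using 2

lemma le_of_forall_pow_le {x b G L : ℝ} (hb : 0 < b) (hL : 0 < L)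
    (h : ∀ j : ℕ, b * x ^ j ≤ G * L ^ j) : x ≤ L := by
  by_contra! hx
  obtain ⟨j, hj⟩ := pow_unbounded_of_one_lt (G / b) ((one_lt_div hL).2 hx)
  rw [div_lt_iff₀ hb, div_pow, div_mul_eq_mul_div, lt_div_iff₀ (pow_pos hL j)] at hj
  linarith [h j]

lemma degree_rayExp (p q : Fin d) (k n : ℕ) : (rayExp p q k n).degree = k - 1 + n := by
  rw [rayExp, map_add, Finsupp.degree_single, Finsupp.degree_single]

lemma frequency_ne_zero {ω : Fin d → ℝ} (hω : LinearIndependent ℚ ω) {p q : Fin d} (hpq : p ≠ q)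
    {k : ℕ} (hk : 1 ≤ k) (l m : ℕ) : k * ω p + ((l : ℝ) - m) * ω q ≠ 0 := by
  rw [← eigenvalue_modeExpConj]
  intro h
  have := (eigenvalue_eq_zero_iff hω _).1 h p
  simp [modeExpConj, hpq.symm] at this
  omega

/-- The core contradiction. The alternative l = 0 or m = 0 treats both sign cases at once. -/
theorem exists_isDivergent {ω : Fin d → ℝ} (hω : LinearIndependent ℚ ω) {p q : Fin d}
    (hpq : p ≠ q) {C : ℝ} {c : ℕ → ℝ} {k l m : ℕ → ℕ} (hk : ∀ n, n + 3 ≤ k n)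
    (hlm : ∀ n, l n = 0 ∨ m n = 0) (hc : ∀ n, c n ≠ 0)
    (hδ : ∀ n, |k n * ω p + ((l n : ℝ) - m n) * ω q| < C / k n) :
    ∃ ζ : ℕ → ℝ, (∀ n, ζ n ∈ Set.Icc (0 : ℝ) 1) ∧
      IsDivergent (normalForm ω (family (ofActions d (baseNormal ω p q))
        (fun n => modeSeries p q (c n) (k n) (l n) (m n)) ζ)) := by
  classical
  by_contra! hcon
  set F : ℕ → PS d ℝ := fun n => modeSeries p q (c n) (k n) (l n) (m n) with hF
  have hFn : ∀ n, F n ∈ ordGE _ ℝ (n + 3) := fun n =>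
    ordGE_anti (by have := hk n; omega) (modeSeries_mem p q (c n) (k n) (l n) (m n))
  have hF3 : ∀ n, F n ∈ ordGE _ ℝ 3 := fun n => ordGE_anti (by omega) (hFn n)
  have hN2 : ofActions d (baseNormal ω p q) ∈ ordGE _ ℝ 2 := mem_ordGE_two_of_sub_quadratic
    (ordGE_anti (by norm_num) (baseNormal_sub_quadratic_mem ω p q))
  have hpoly := coeff_normalForm_mem_polyFun ω (family_mem_polyFam hN2 hF3)
  obtain ⟨A, I, ζ₀, a, hA, ha0, ha1, hbox⟩ :=
    exists_box_of_not_isDivergent (fun c => continuous_of_mem_polyFun (hpoly c)) hcon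
  obtain ⟨K₁, hK₁, h₁⟩ := exists_abs_coeff_zero_le ha0 ha1
  obtain ⟨K₂, hK₂, h₂⟩ := exists_abs_coeff_two_le
  -- Raising j by one raises the degree by one: one factor A from the box and, as the coefficients
  -- have degree at most twice that, a factor (K₁ K₂)².
  set L : ℝ := A * (K₁ * K₂) ^ 2 with hL
  have hL0 : 0 < L := by positivity
  have hquot : ∀ n ∉ I, (k n : ℝ) / |k n * ω p + ((l n : ℝ) - m n) * ω q| ≤ L := by
    intro n hn
    have hδ0 := frequency_ne_zero hω hpq (by have := hk n; omega : 1 ≤ k n) (l n) (m n)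
    set δ : ℝ := k n * ω p + ((l n : ℝ) - m n) * ω q with hδd
    have hk0 : (0 : ℝ) < k n := by exact_mod_cast (by have := hk n; omega : 0 < k n)
    have hc0 := hc n
    have hδ' := abs_pos.2 hδ0
    refine le_of_forall_pow_le (b := c n ^ 2 * k n ^ 2 / |δ|)
      (G := 16 * A ^ (k n - 1 + (l n + m n) + 1) * (K₁ * K₂) ^ (2 * (k n - 1 + (l n + m n))))
      (by positivity) hL0 fun j => ?_
    set b := rayExp p q (k n) (l n + m n + j) with hb
    obtain ⟨Q, hQd, hQ⟩ := exists_polynomial_of_mem_polyFun (hpoly b) 0 (Pi.single n 1)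
    have hQ' : ∀ τ : ℝ, coeff b (normalForm ω (ofActions d (baseNormal ω p q) + τ • F n)) =
        Q.eval τ := fun τ => by
      rw [← hQ τ, ← family_single hFn n τ]
      simp
    have hQ2 : Q.coeff 2 = -(c n ^ 2 * k n ^ 2 / δ) * (-(k n / δ)) ^ j :=
      coeff_two_eq_of_isBigO ((isBigO_normalForm_modeSeries hω hpq (by have := hk n; omega)
        (hlm n) (c n) hδ0 j).congr_left fun τ => by rw [← hQ' τ])
    have hQb : ∀ τ ∈ Set.Icc (0 : ℝ) 1, |Q.eval τ| ≤ A ^ (b.degree + 1) * K₁ ^ (2 * b.degree) := by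
      intro τ hτ
      -- With τ fixed, the coordinates in I are scaled by t. The bound for t in [a, 1] is
      -- extrapolated to t = 0, where only N + τ F_n remains.
      obtain ⟨R, hRd, hR⟩ := exists_polynomial_of_mem_polyFun (hpoly b)
        (fun i => τ * (Pi.single n 1 : ℕ → ℝ) i) (fun i => if i ∈ I then ζ₀ i else 0)
      have h := h₁ _ R (A ^ (b.degree + 1)) hRd (by positivity) fun t ht => by
        rw [← hR t]
        exact hbox n hn t ht τ hτ b
      rw [Polynomial.coeff_zero_eq_eval_zero, ← hR 0] at h
      rw [← hQ' τ, ← family_single hFn n τ]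
      simpa using h
    have h3 := h₂ _ Q _ hQd (by positivity) hQb
    rw [hQ2, abs_mul, abs_neg, abs_pow, abs_neg, abs_div, abs_div, Nat.abs_cast,
      abs_of_nonneg (by positivity : 0 ≤ c n ^ 2 * (k n : ℝ) ^ 2)] at h3
    refine h3.trans (le_of_eq ?_)
    rw [hb, degree_rayExp, hL]
    ring
  have hlarge : ∀ n ∉ I, ((n : ℝ) + 3) ^ 2 < L * C := by
    intro n hn
    have hδ0 := abs_pos.2
      (frequency_ne_zero hω hpq (by have := hk n; omega : 1 ≤ k n) (l n) (m n))
    have h1 := hquot n hn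
    have h2 := hδ n
    have hkn : (n : ℝ) + 3 ≤ k n := by exact_mod_cast hk n
    have hk0 : (0 : ℝ) < k n := by have : (0 : ℝ) ≤ n := n.cast_nonneg; linarith
    rw [div_le_iff₀ hδ0] at h1
    rw [lt_div_iff₀ hk0] at h2
    calc ((n : ℝ) + 3) ^ 2 ≤ (k n : ℝ) * k n := by
          rw [pow_two]
          exact mul_le_mul hkn hkn (by positivity) hk0.le
      _ ≤ L * |k n * ω p + ((l n : ℝ) - m n) * ω q| * k n :=
          mul_le_mul_of_nonneg_right h1 hk0.le
      _ < L * C := by rw [mul_assoc]; exact mul_lt_mul_of_pos_left h2 hL0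
  -- An index beyond both I and L C contradicts (n + 3)² < L C.
  obtain ⟨M, hM⟩ := exists_nat_ge (L * C)
  have hn : max M (I.sup id + 1) ∉ I := fun h => by
    have h1 : max M (I.sup id + 1) ≤ I.sup id := Finset.le_sup (f := id) h
    have h2 := le_max_right M (I.sup id + 1)
    omega
  have h1 := hlarge _ hn
  have h2 : (M : ℝ) ≤ (max M (I.sup id + 1) : ℕ) := by exact_mod_cast le_max_left _ _
  nlinarith [(M : ℕ).cast_nonneg (α := ℝ)]

end Divergence

end Birkhoff

namespace Birkhoff

open MvPowerSeries

/-! ### Convergence -/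

section Convergence

variable {d : ℕ}

lemma hasSum_polynomial {σ R : Type*} [CommRing R] [TopologicalSpace R] (P : MvPolynomial σ R)
    (z : σ → R) :
    HasSum (fun a : σ →₀ ℕ => coeff a (P : MvPowerSeries σ R) * a.prod fun v e => z v ^ e)
      (MvPolynomial.eval z P) := by
  rw [MvPolynomial.eval_eq]
  refine hasSum_sum_of_ne_finset_zero fun a ha => ?_
  rw [MvPolynomial.coeff_coe, MvPolynomial.notMem_support_iff.1 ha, zero_mul]

/-- `f` is dominated, coefficient by coefficient, by the polynomial `g`. -/
def Dominated (f : PS d ℂ) (g : MvPolynomial (Fin d ⊕ Fin d) ℝ) : Prop :=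
  ∀ a, ‖coeff a f‖ ≤ g.coeff a

lemma Dominated.add {f f' : PS d ℂ} {g g' : MvPolynomial (Fin d ⊕ Fin d) ℝ} (h : Dominated f g)
    (h' : Dominated f' g') : Dominated (f + f') (g + g') := fun a => by
  rw [map_add, MvPolynomial.coeff_add]
  exact (norm_add_le _ _).trans (add_le_add (h a) (h' a))

lemma Dominated.neg {f : PS d ℂ} {g : MvPolynomial (Fin d ⊕ Fin d) ℝ} (h : Dominated f g) :
    Dominated (-f) g := fun a => by
  rw [map_neg, norm_neg]; exact h a

lemma Dominated.mul {f f' : PS d ℂ} {g g' : MvPolynomial (Fin d ⊕ Fin d) ℝ} (h : Dominated f g)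
    (h' : Dominated f' g') : Dominated (f * f') (g * g') := fun a => by
  classical
  rw [coeff_mul, MvPolynomial.coeff_mul]
  refine (norm_sum_le _ _).trans (Finset.sum_le_sum fun x _ => ?_)
  rw [norm_mul]
  exact mul_le_mul (h _) (h' _) (norm_nonneg _) ((norm_nonneg _).trans (h _))

lemma dominated_C (c : ℂ) : Dominated (C c : PS d ℂ) (MvPolynomial.C ‖c‖) := fun a => by
  classical
  rw [coeff_C, MvPolynomial.coeff_C]
  by_cases h : a = 0
  · rw [if_pos h, if_pos h.symm]
  · rw [if_neg h, if_neg (Ne.symm h), norm_zero]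

lemma dominated_X (v : Fin d ⊕ Fin d) : Dominated (X v : PS d ℂ) (MvPolynomial.X v) := fun a => by
  classical
  rw [coeff_X, MvPolynomial.coeff_X]
  by_cases h : a = Finsupp.single v 1
  · rw [if_pos h, if_pos h.symm, norm_one]
  · rw [if_neg h, if_neg (Ne.symm h), norm_zero]

lemma Dominated.pow {f : PS d ℂ} {g : MvPolynomial (Fin d ⊕ Fin d) ℝ} (h : Dominated f g)
    (n : ℕ) : Dominated (f ^ n) (g ^ n) := by
  induction n with
  | zero => simpa using dominated_C (d := d) 1
  | succ n ih => rw [pow_succ, pow_succ]; exact ih.mul h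

/-- A polynomial dominating the coordinates `ξ_j` and `η_j`. -/
def coordMajorant (j : Fin d) : MvPolynomial (Fin d ⊕ Fin d) ℝ :=
  MvPolynomial.C ‖invSqrtTwo‖ * (MvPolynomial.X (Sum.inl j) + MvPolynomial.X (Sum.inr j))

lemma dominated_complexCoord_inl (j : Fin d) :
    Dominated (complexCoord (Sum.inl j)) (coordMajorant j) := by
  refine (dominated_C _).mul ((dominated_X _).add ?_)
  simpa using (dominated_C (d := d) Complex.I).mul (dominated_X (Sum.inr j))

lemma dominated_complexCoord_inr (j : Fin d) :
    Dominated (complexCoord (Sum.inr j)) (coordMajorant j) := by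
  simp only [complexCoord, Sum.elim_inr, sub_eq_add_neg]
  refine (dominated_C _).mul ((dominated_X _).add ?_)
  simpa using ((dominated_C (d := d) Complex.I).mul (dominated_X (Sum.inr j))).neg

/-- A polynomial dominating a mode. -/
def modeMajorant (p q : Fin d) (c : ℝ) (k l m : ℕ) : MvPolynomial (Fin d ⊕ Fin d) ℝ :=
  MvPolynomial.C |c| * (coordMajorant p ^ k * coordMajorant q ^ l * coordMajorant q ^ m +
    coordMajorant p ^ k * coordMajorant q ^ l * coordMajorant q ^ m)

lemma abs_coeff_modeSeries_le (p q : Fin d) (c : ℝ) (k l m : ℕ) (a : Fin d ⊕ Fin d →₀ ℕ) :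
    |coeff a (modeSeries p q c k l m)| ≤ (modeMajorant p q c k l m).coeff a := by
  have h1 := dominated_complexCoord_inl p
  have h2 := dominated_complexCoord_inr p
  have h3 := dominated_complexCoord_inl q
  have h4 := dominated_complexCoord_inr q
  have h := (dominated_C (d := d) (c : ℂ)).mul
    ((((h1.pow k).mul (h3.pow l)).mul (h4.pow m)).add
      (((h2.pow k).mul (h4.pow l)).mul (h3.pow m)))
  rw [Complex.norm_real, Real.norm_eq_abs] at h
  exact (Complex.abs_re_le_norm _).trans (h a)

lemma norm_invSqrtTwo : ‖invSqrtTwo‖ = (Real.sqrt 2)⁻¹ := by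
  rw [invSqrtTwo, norm_inv, Complex.norm_real, Real.norm_eq_abs,
    abs_of_nonneg (Real.sqrt_nonneg 2)]

lemma eval_modeMajorant (p q : Fin d) (c : ℝ) (k l m : ℕ) (r : ℝ) :
    MvPolynomial.eval (fun _ => r) (modeMajorant p q c k l m) =
      2 * (|c| * (Real.sqrt 2 * r) ^ (k + l + m)) := by
  have h : ∀ j : Fin d, MvPolynomial.eval (fun _ => r) (coordMajorant j) = Real.sqrt 2 * r :=
    fun j => by
      have h2 : (Real.sqrt 2)⁻¹ * 2 = Real.sqrt 2 := by
        rw [inv_mul_eq_div, Real.div_sqrt]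
      simp only [coordMajorant, map_mul, map_add, MvPolynomial.eval_C, MvPolynomial.eval_X,
        norm_invSqrtTwo]
      linear_combination r * h2
  simp only [modeMajorant, map_mul, map_add, map_pow, h, MvPolynomial.eval_C]
  ring

/-- The complex coordinates as polynomials. -/
def coordPoly : Fin d ⊕ Fin d → MvPolynomial (Fin d ⊕ Fin d) ℂ :=
  Sum.elim (fun j => MvPolynomial.C invSqrtTwo * (MvPolynomial.X (Sum.inl j) +
      MvPolynomial.C Complex.I * MvPolynomial.X (Sum.inr j)))
    (fun j => MvPolynomial.C invSqrtTwo * (MvPolynomial.X (Sum.inl j) -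
      MvPolynomial.C Complex.I * MvPolynomial.X (Sum.inr j)))

lemma coe_coordPoly (v : Fin d ⊕ Fin d) : (coordPoly v : PS d ℂ) = complexCoord v := by
  rcases v with j | j
  · simp [coordPoly, complexCoord]
  · simp only [coordPoly, complexCoord, Sum.elim_inr,
      ← MvPolynomial.coeToMvPowerSeries.ringHom_apply, map_mul, map_sub]
    simp

/-- The value of a mode. -/
def mode (p q : Fin d) (c : ℝ) (k l m : ℕ) (z : Phase d) : ℝ :=
  ((c : ℂ) * (xi p z ^ k * xi q z ^ l * eta q z ^ m +
    eta p z ^ k * eta q z ^ l * xi q z ^ m)).re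

lemma convergesAtTo_modeSeries (p q : Fin d) (c : ℝ) (k l m : ℕ) (z : Phase d) :
    ConvergesAtTo (modeSeries p q c k l m) z (mode p q c k l m z) := by
  have h := hasSum_polynomial (MvPolynomial.C (c : ℂ) *
    (coordPoly (Sum.inl p) ^ k * coordPoly (Sum.inl q) ^ l * coordPoly (Sum.inr q) ^ m +
      coordPoly (Sum.inr p) ^ k * coordPoly (Sum.inr q) ^ l * coordPoly (Sum.inl q) ^ m))
    (fun v => (z v : ℂ))
  have e1 : ∀ j, MvPolynomial.eval (fun v => (z v : ℂ)) (coordPoly (Sum.inl j)) = xi j z :=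
    fun j => by simp [coordPoly, xi, invSqrtTwo, div_eq_inv_mul]
  have e2 : ∀ j, MvPolynomial.eval (fun v => (z v : ℂ)) (coordPoly (Sum.inr j)) = eta j z :=
    fun j => by simp [coordPoly, eta, invSqrtTwo, div_eq_inv_mul]
  simp only [map_mul, map_add, map_pow, e1, e2, MvPolynomial.eval_C, MvPolynomial.coe_mul,
    MvPolynomial.coe_add, MvPolynomial.coe_pow, coe_coordPoly, MvPolynomial.coe_C] at h
  have h' := Complex.hasSum_re h
  unfold ConvergesAtTo
  convert h' using 1
  · ext a
    have : (a.prod fun v e => (z v : ℂ) ^ e) = ((a.prod fun v e => z v ^ e : ℝ) : ℂ) := by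
      simp [Finsupp.prod]
    rw [this, Complex.re_mul_ofReal]
    rfl
  · rfl

/-- A polynomial with value `∑ ω_j I_j`. -/
def quadraticPoly (ω : Fin d → ℝ) : MvPolynomial (Fin d ⊕ Fin d) ℝ :=
  ∑ j, MvPolynomial.C (ω j) * (MvPolynomial.C (1 / 2) *
    (MvPolynomial.X (Sum.inl j) ^ 2 + MvPolynomial.X (Sum.inr j) ^ 2))

lemma coe_quadraticPoly (ω : Fin d → ℝ) : (quadraticPoly ω : PS d ℝ) = quadratic ω := by
  rw [quadratic, quadraticPoly, map_sum, ← MvPolynomial.coeToMvPowerSeries.ringHom_apply, map_sum]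
  refine Finset.sum_congr rfl fun j _ => ?_
  rw [map_smul, ofActions_X, smul_eq_C_mul]
  simp [actionSeries]

lemma convergesAtTo_quadratic (ω : Fin d → ℝ) (z : Phase d) :
    ConvergesAtTo (quadratic ω) z (∑ j, ω j * action j z) := by
  have h := hasSum_polynomial (quadraticPoly ω) z
  rw [coe_quadraticPoly] at h
  have e : MvPolynomial.eval z (quadraticPoly ω) = ∑ j, ω j * action j z := by
    simp only [quadraticPoly, map_sum, map_mul, map_add, map_pow, MvPolynomial.eval_C,
      MvPolynomial.eval_X, action]
    exact Finset.sum_congr rfl fun j _ => by ring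
  rw [e] at h
  exact h

lemma ConvergesAtTo.add {f g : PS d ℝ} {z : Phase d} {s t : ℝ} (hf : ConvergesAtTo f z s)
    (hg : ConvergesAtTo g z t) : ConvergesAtTo (f + g) z (s + t) := by
  refine (HasSum.add hf hg).congr_fun fun a => ?_
  rw [map_add, add_mul]

lemma ConvergesAtTo.sub {f g : PS d ℝ} {z : Phase d} {s t : ℝ} (hf : ConvergesAtTo f z s)
    (hg : ConvergesAtTo g z t) : ConvergesAtTo (f - g) z (s - t) := by
  refine (HasSum.sub hf hg).congr_fun fun a => ?_
  rw [map_sub, sub_mul]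

lemma convergesAtTo_baseNormal (ω : Fin d → ℝ) (p q : Fin d) (z : Phase d) :
    ConvergesAtTo (ofActions d (baseNormal ω p q)) z
      (∑ j, ω j * action j z + action q z * action p z) := by
  rw [baseNormal, map_add]
  refine (convergesAtTo_quadratic ω z).add ?_
  have h := hasSum_polynomial ((MvPolynomial.C (1 / 2) *
    (MvPolynomial.X (Sum.inl p) ^ 2 + MvPolynomial.X (Sum.inr p) ^ 2)) * (MvPolynomial.C (1 / 2) *
    (MvPolynomial.X (Sum.inl q) ^ 2 + MvPolynomial.X (Sum.inr q) ^ 2)) :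
      MvPolynomial (Fin d ⊕ Fin d) ℝ) z
  rw [map_mul, ofActions_X, ofActions_X]
  have e1 : ((MvPolynomial.C (1 / 2) * (MvPolynomial.X (Sum.inl p) ^ 2 +
      MvPolynomial.X (Sum.inr p) ^ 2)) * (MvPolynomial.C (1 / 2) * (MvPolynomial.X (Sum.inl q) ^ 2 +
      MvPolynomial.X (Sum.inr q) ^ 2)) : MvPolynomial (Fin d ⊕ Fin d) ℝ) =
      (actionSeries p * actionSeries q : PS d ℝ) := by
    simp only [MvPolynomial.coe_mul, MvPolynomial.coe_add, MvPolynomial.coe_pow,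
      MvPolynomial.coe_C, MvPolynomial.coe_X, actionSeries]
  rw [e1] at h
  have e2 : ∀ j, 1 / 2 * (z (Sum.inl j) ^ 2 + z (Sum.inr j) ^ 2) = action j z := fun j => by
    rw [action]; ring
  simp only [map_mul, map_add, map_pow, MvPolynomial.eval_C, MvPolynomial.eval_X, e2] at h
  rw [mul_comm (action q z)]
  exact h

lemma abs_prod_pow_le (z : Phase d) (a : Fin d ⊕ Fin d →₀ ℕ) :
    |a.prod fun v e => z v ^ e| ≤ ‖z‖ ^ a.degree := by
  rw [Finsupp.prod_fintype _ _ (by simp), Finset.abs_prod, Finsupp.degree_eq_sum,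
    ← Finset.prod_pow_eq_pow_sum]
  refine Finset.prod_le_prod (fun _ _ => abs_nonneg _) fun v _ => ?_
  rw [abs_pow]
  exact pow_le_pow_left₀ (abs_nonneg _) (norm_le_pi_norm z v) _

/-- Convergence at (1, …, 1) makes the coefficients absolutely summable; for ‖z‖ < 1 every remaining
monomial is at most ‖z‖^m. -/
lemma isBigO_of_mem_ordGE {f : PS d ℝ} {G : Phase d → ℝ} {m : ℕ} (hf : f ∈ ordGE _ ℝ m)
    (hG : ∀ z, ConvergesAtTo f z (G z)) : G =O[𝓝 0] fun z => ‖z‖ ^ m := by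
  have hs : Summable fun a => |coeff a f| := by
    have := (hG fun _ => 1).summable.abs
    simpa [Finsupp.prod] using this
  refine Asymptotics.IsBigO.of_bound (∑' a, |coeff a f|) ?_
  filter_upwards [Metric.ball_mem_nhds (0 : Phase d) one_pos] with z hz
  rw [mem_ball_zero_iff] at hz
  rw [norm_pow, norm_norm, ← (hG z).tsum_eq]
  refine tsum_of_norm_bounded (hs.hasSum.mul_right (‖z‖ ^ m)) fun a => ?_
  rw [Real.norm_eq_abs, abs_mul]
  by_cases ha : a.degree < m
  · rw [hf a ha]; simp
  · exact mul_le_mul_of_nonneg_left ((abs_prod_pow_le z a).trans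
      (pow_le_pow_of_le_one (norm_nonneg z) hz.le (not_lt.1 ha))) (abs_nonneg _)

/-- The general term is (x e^(-n))^(N n), which is at most x e^(-n) once the base is below 1. -/
lemma summable_amplitude {N : ℕ → ℕ} (hN : ∀ n, 1 ≤ N n) {x : ℝ} (hx : 0 ≤ x) :
    Summable fun n : ℕ => Real.exp (-(n * N n : ℝ)) * x ^ N n := by
  have h1 : Summable fun n : ℕ => x * Real.exp (-1) ^ n :=
    (summable_geometric_of_lt_one (Real.exp_pos _).le (by simp)).mul_left x
  refine Summable.of_norm_bounded_eventually_nat h1 ?_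
  have h2 := h1.tendsto_atTop_zero.eventually_le_const one_pos
  filter_upwards [h2] with n hn
  have e : Real.exp (-(n * N n : ℝ)) * x ^ N n = (x * Real.exp (-1) ^ n) ^ N n := by
    rw [mul_pow, ← pow_mul, ← Real.exp_nat_mul, mul_comm]
    push_cast
    ring_nf
  have h0 : 0 ≤ x * Real.exp (-1) ^ n := by positivity
  rw [e, Real.norm_eq_abs, abs_of_nonneg (pow_nonneg h0 _)]
  exact (pow_le_pow_of_le_one h0 hn (hN n)).trans (pow_one _).le

/-- Convergence of a superposition of modes. -/
lemma convergesAtTo_family {N : PS d ℝ} {z : Phase d} {s : ℝ} (hN : ConvergesAtTo N z s)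
    {p q : Fin d} {c : ℕ → ℝ} {k l m : ℕ → ℕ} (hk : ∀ n, n + 3 ≤ k n)
    (hc : ∀ n, c n = Real.exp (-(n * (k n + l n + m n : ℕ) : ℝ)))
    {ζ : ℕ → ℝ} (hζ : ∀ n, ζ n ∈ Set.Icc (0 : ℝ) 1) :
    (Summable fun n => ζ n * mode p q (c n) (k n) (l n) (m n) z) ∧
    ConvergesAtTo (family N (fun n => modeSeries p q (c n) (k n) (l n) (m n)) ζ) z
      (s + ∑' n, ζ n * mode p q (c n) (k n) (l n) (m n) z) := by
  set F : ℕ → PS d ℝ := fun n => modeSeries p q (c n) (k n) (l n) (m n) with hF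
  set G : ℕ → MvPolynomial (Fin d ⊕ Fin d) ℝ :=
    fun n => modeMajorant p q (c n) (k n) (l n) (m n) with hG
  -- The double series over modes and exponents is dominated by that of the majorants at (‖z‖, …,
  -- ‖z‖). Summing it in the two orders identifies the sum of the modes with that of the power
  -- series.
  let T : ℕ × (Fin d ⊕ Fin d →₀ ℕ) → ℝ := fun x =>
    ζ x.1 * (coeff x.2 (F x.1) * x.2.prod fun v e => z v ^ e)
  let U : ℕ × (Fin d ⊕ Fin d →₀ ℕ) → ℝ := fun x =>
    coeff x.2 (G x.1 : PS d ℝ) * x.2.prod fun _ e => ‖z‖ ^ e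
  have hprod : ∀ a : Fin d ⊕ Fin d →₀ ℕ, (a.prod fun _ e => ‖z‖ ^ e) = ‖z‖ ^ a.degree := fun a => by
    rw [Finsupp.prod_fintype _ _ (by simp), Finset.prod_pow_eq_pow_sum, Finsupp.degree_eq_sum]
  have hTU : ∀ x, |T x| ≤ U x := by
    rintro ⟨n, a⟩
    have h1 : |coeff a (F n)| ≤ coeff a (G n : PS d ℝ) := abs_coeff_modeSeries_le _ _ _ _ _ _ _
    simp only [T, U, abs_mul, hprod]
    rw [abs_of_nonneg (hζ n).1]
    calc _ ≤ 1 * (|coeff a (F n)| * |a.prod fun v e => z v ^ e|) :=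
          mul_le_mul_of_nonneg_right (hζ n).2 (by positivity)
      _ ≤ _ := by
          rw [one_mul]
          exact mul_le_mul h1 (abs_prod_pow_le z a) (abs_nonneg _) ((abs_nonneg _).trans h1)
  have hU : Summable U := by
    refine (summable_prod_of_nonneg fun x => (abs_nonneg _).trans (hTU x)).2
      ⟨fun n => (hasSum_polynomial (G n) fun _ => ‖z‖).summable, ?_⟩
    have h1 : ∀ n, ∑' a, U (n, a) =
        2 * (Real.exp (-(n * (k n + l n + m n : ℕ) : ℝ)) *
          (Real.sqrt 2 * ‖z‖) ^ (k n + l n + m n)) := fun n => by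
      rw [(hasSum_polynomial (G n) fun _ => ‖z‖).tsum_eq, eval_modeMajorant, hc,
        abs_of_pos (Real.exp_pos _)]
    simp only [h1]
    exact (summable_amplitude (fun n => by have := hk n; omega) (by positivity)).mul_left 2
  have hT : Summable T := Summable.of_norm_bounded hU hTU
  have h1 : ∀ n, HasSum (fun a => T (n, a)) (ζ n * mode p q (c n) (k n) (l n) (m n) z) :=
    fun n => (convergesAtTo_modeSeries p q (c n) (k n) (l n) (m n) z).mul_left (ζ n)
  have h2 := hT.hasSum.prod_fiberwise h1
  refine ⟨h2.summable, ?_⟩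
  have h3 : ∀ a, HasSum (fun n => T (n, a)) (∑ n ∈ Finset.range (a.degree + 1), T (n, a)) :=
    fun a => hasSum_sum_of_ne_finset_zero fun n hn => by
      have : coeff a (F n) = 0 := modeSeries_mem p q (c n) (k n) (l n) (m n) a (by
        have := hk n
        simp at hn
        omega)
      simp only [T, this, zero_mul, mul_zero]
  have h4 : HasSum (fun a => ∑ n ∈ Finset.range (a.degree + 1), T (n, a)) (∑' x, T x) :=
    ((Equiv.prodComm _ _).hasSum_iff.2 hT.hasSum).prod_fiberwise h3
  rw [h2.tsum_eq]
  refine (HasSum.add hN h4).congr_fun fun a => ?_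
  rw [coeff_family, add_mul, Finset.sum_mul]
  congr 1
  exact Finset.sum_congr rfl fun n _ => by simp only [T, mul_assoc]

end Convergence

end Birkhoff

namespace Birkhoff

open MvPowerSeries

/-! ### Small divisors and the main theorem -/

section Conclusion

variable {d : ℕ}

/-- Dirichlet's theorem with a bound N so large that no k < X approximates to within 1/(N + 1):
these finitely many distances are positive. As k ≤ N, the error is below 1/k. -/
lemma exists_approximation {α : ℝ} (hα0 : 0 ≤ α)
    (hα : ∀ k l : ℕ, 1 ≤ k → (k : ℝ) * α - l ≠ 0) (X : ℕ) :
    ∃ k l : ℕ, X ≤ k ∧ 1 ≤ k ∧ |(k : ℝ) * α - l| < 1 / k := by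
  have hround : ∀ k : ℕ, (round ((k : ℝ) * α) : ℝ) = (round ((k : ℝ) * α)).toNat := fun k => by
    have h : 0 ≤ round ((k : ℝ) * α) := by
      rw [round_eq]
      exact Int.floor_nonneg.2 (by positivity)
    exact_mod_cast (Int.toNat_of_nonneg h).symm
  have h1 : ∀ᶠ N : ℕ in Filter.atTop, ∀ k ∈ Finset.range X, 1 ≤ k →
      1 / ((N : ℝ) + 1) < |(k : ℝ) * α - round ((k : ℝ) * α)| := by
    refine (Filter.eventually_all_finset _).2 fun k _ => ?_
    by_cases hk : 1 ≤ k
    · have h2 : 0 < |(k : ℝ) * α - round ((k : ℝ) * α)| := by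
        rw [hround]; exact abs_pos.2 (hα k _ hk)
      filter_upwards [tendsto_one_div_add_atTop_nhds_zero_nat.eventually_lt_const h2] with N hN _
      exact hN
    · exact Filter.Eventually.of_forall fun N h => absurd h hk
  obtain ⟨N, hN, hN1⟩ := (h1.and (Filter.eventually_ge_atTop 1)).exists
  obtain ⟨k, hk0, hkN, hk⟩ := Real.exists_nat_abs_mul_sub_round_le α hN1
  refine ⟨k, (round ((k : ℝ) * α)).toNat, ?_, hk0, ?_⟩
  · by_contra! hX
    exact absurd (hN k (Finset.mem_range.2 hX) hk0) (not_lt.2 hk)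
  · rw [← hround]
    refine hk.trans_lt ?_
    have : (k : ℝ) ≤ N := by exact_mod_cast hkN
    have h0 : (0 : ℝ) < k := by exact_mod_cast hk0
    exact one_div_lt_one_div_of_lt h0 (by linarith)

lemma exists_isApproximating {α β : ℝ} (hβ : β ≠ 0) (hα : α * β ≤ 0)
    (h : ∀ k l : ℕ, 1 ≤ k → (k : ℝ) * α + l * β ≠ 0) :
    ∃ k l : ℕ → ℕ, IsApproximating |β| α β k l := by
  have h1 : ∀ n : ℕ, ∃ k l : ℕ, |(k : ℝ) * α + l * β| < |β| / k ∧
      10 * Real.exp (Real.exp (n : ℝ)) ≤ k := fun n => by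
    -- The problem reduces to approximating -α/β, nonnegative by the sign condition; this is what
    -- allows a natural number l.
    have e : ∀ k l : ℕ, (k : ℝ) * α + l * β = -β * (k * (-α / β) - l) := fun k l => by
      field_simp
      ring
    obtain ⟨X, hX⟩ := exists_nat_ge (10 * Real.exp (Real.exp (n : ℝ)))
    obtain ⟨k, l, hk, hk1, hkl⟩ := exists_approximation (α := -α / β)
      (by
        rw [← mul_div_mul_right _ _ hβ]
        exact div_nonneg (by linarith) (mul_self_nonneg β))
      (fun k l hk h0 => h k l hk (by rw [e, h0, mul_zero])) X
    refine ⟨k, l, ?_, hX.trans (by exact_mod_cast hk)⟩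
    rw [e, abs_mul, abs_neg, div_eq_mul_one_div |β|]
    exact mul_lt_mul_of_pos_left hkl (abs_pos.2 hβ)
  choose k l hkl using h1
  exact ⟨k, l, hkl⟩

lemma IsApproximating.le {C α β : ℝ} {k l : ℕ → ℕ} (h : IsApproximating C α β k l) (n : ℕ) :
    n + 3 ≤ k n := by
  have h1 := (h n).2
  have h2 := Real.add_one_le_exp (n : ℝ)
  have h3 := Real.add_one_le_exp (Real.exp (n : ℝ))
  have h4 : ((n + 3 : ℕ) : ℝ) ≤ k n := by
    push_cast
    have : (0 : ℝ) ≤ n := n.cast_nonneg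
    linarith
  exact_mod_cast h4

theorem yieldsDivergentBNF {ω : Fin d → ℝ} (hω : LinearIndependent ℚ ω) {p q : Fin d}
    (hpq : p ≠ q) {C : ℝ} {c : ℕ → ℝ} {k l m : ℕ → ℕ} (hk : ∀ n, n + 3 ≤ k n)
    (hlm : ∀ n, l n = 0 ∨ m n = 0)
    (hc : ∀ n, c n = Real.exp (-(n * (k n + l n + m n : ℕ) : ℝ)))
    (hδ : ∀ n, |k n * ω p + ((l n : ℝ) - m n) * ω q| < C / k n) :
    YieldsDivergentBNF ω p q fun n => mode p q (c n) (k n) (l n) (m n) := by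
  have hF : ∀ n, modeSeries p q (c n) (k n) (l n) (m n) ∈ ordGE _ ℝ 3 := fun n =>
    ordGE_anti (by have := hk n; omega) (modeSeries_mem p q (c n) (k n) (l n) (m n))
  have hquad : ∀ ζ, family (ofActions d (baseNormal ω p q))
      (fun n => modeSeries p q (c n) (k n) (l n) (m n)) ζ - quadratic ω ∈ ordGE _ ℝ 3 := fun ζ => by
    rw [← sub_add_sub_cancel]
    exact Submodule.add_mem _ (family_sub_mem hF ζ)
      (ordGE_anti (by norm_num) (baseNormal_sub_quadratic_mem ω p q))
  have hconv : ∀ ζ : ℕ → ℝ, (∀ n, ζ n ∈ Set.Icc (0 : ℝ) 1) → ∀ z, ConvergesAtTo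
      (family (ofActions d (baseNormal ω p q))
        (fun n => modeSeries p q (c n) (k n) (l n) (m n)) ζ) z
      (perturbed ω p q (fun n => mode p q (c n) (k n) (l n) (m n)) ζ z) := fun ζ hζ z =>
    (convergesAtTo_family (convergesAtTo_baseNormal ω p q z) hk hc hζ).2
  refine ⟨fun ζ hζ => ⟨fun z =>
    (convergesAtTo_family (convergesAtTo_baseNormal ω p q z) hk hc hζ).1, ⟨_, hconv ζ hζ⟩,
    isBigO_of_mem_ordGE (hquad ζ) fun z => (hconv ζ hζ z).sub (convergesAtTo_quadratic ω z)⟩, ?_⟩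
  obtain ⟨ζ, hζ, hdiv⟩ := exists_isDivergent hω hpq (c := c) hk hlm
    (fun n => by rw [hc]; exact (Real.exp_pos _).ne') hδ
  refine ⟨ζ, hζ, _, Filter.Eventually.of_forall (hconv ζ hζ),
    ⟨_, isBirkhoffNormalForm_normalForm hω (hquad ζ)⟩, fun B hB => ?_⟩
  rw [hB.eq_normalForm hω (hquad ζ)]
  exact hdiv

lemma modeOpp_eq_mode (p q : Fin d) (n k l : ℕ) :
    modeOpp p q n k l = mode p q (amplitude n k l) k l 0 := by
  ext z
  simp [modeOpp, mode]

lemma modeSame_eq_mode (p q : Fin d) (n k l : ℕ) :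
    modeSame p q n k l = mode p q (amplitude n k l) k 0 l := by
  ext z
  simp [modeSame, mode]

lemma yieldsDivergentBNF_modeOpp {ω : Fin d → ℝ} (hω : LinearIndependent ℚ ω) {p q : Fin d}
    (hpq : p ≠ q) {C : ℝ} {k l : ℕ → ℕ} (h : IsApproximating C (ω p) (ω q) k l) :
    YieldsDivergentBNF ω p q fun n => modeOpp p q n (k n) (l n) := by
  simp only [modeOpp_eq_mode]
  refine yieldsDivergentBNF hω hpq (C := C) (m := fun _ => 0) h.le (fun n => Or.inr rfl)
    (fun n => ?_) (fun n => ?_)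
  · simp [amplitude]
  · simpa using (h n).1

lemma yieldsDivergentBNF_modeSame {ω : Fin d → ℝ} (hω : LinearIndependent ℚ ω) {p q : Fin d}
    (hpq : p ≠ q) {C : ℝ} {k l : ℕ → ℕ} (h : IsApproximating C (ω p) (-ω q) k l) :
    YieldsDivergentBNF ω p q fun n => modeSame p q n (k n) (l n) := by
  simp only [modeSame_eq_mode]
  refine yieldsDivergentBNF hω hpq (C := C) (l := fun _ => 0) h.le (fun n => Or.inl rfl)
    (fun n => ?_) (fun n => ?_)
  · simp [amplitude]
  · simpa using (h n).1

lemma exists_isApproximating_opp {ω : Fin d → ℝ} (hω : LinearIndependent ℚ ω) {p q : Fin d}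
    (hpq : p ≠ q) (h : ω p * ω q < 0) :
    ∃ k l : ℕ → ℕ, IsApproximating |ω q| (ω p) (ω q) k l :=
  exists_isApproximating (hω.ne_zero q) h.le fun k l hk => by
    simpa using frequency_ne_zero hω hpq hk l 0

lemma exists_isApproximating_same {ω : Fin d → ℝ} (hω : LinearIndependent ℚ ω) {p q : Fin d}
    (hpq : p ≠ q) (h : 0 < ω p * ω q) :
    ∃ k l : ℕ → ℕ, IsApproximating |ω q| (ω p) (-ω q) k l := by
  rw [← abs_neg (ω q)]
  exact exists_isApproximating (neg_ne_zero.2 (hω.ne_zero q)) (by linarith) fun k l hk => by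
    simpa using frequency_ne_zero hω hpq hk 0 l

lemma YieldsDivergentBNF.exists_hamiltonian {ω : Fin d → ℝ} {p q : Fin d} {F : ℕ → Phase d → ℝ}
    (h : YieldsDivergentBNF ω p q F) :
    ∃ H : Phase d → ℝ, IsRealEntire H ∧ IsEllipticEquilibrium ω H ∧ HasDivergentBNF H := by
  obtain ⟨h1, ζ, hζ, h2⟩ := h
  exact ⟨_, (h1 ζ hζ).2.1, (h1 ζ hζ).2.2, h2⟩

end Conclusion

end Birkhoff

end

open Birkhoff in
theorem theoremB (d : ℕ) (hd : 2 ≤ d) (ω : Fin d → ℝ) (hω : LinearIndependent ℚ ω) :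
    (∃ H : Phase d → ℝ,
      IsRealEntire H ∧ IsEllipticEquilibrium ω H ∧ HasDivergentBNF H) ∧
    ∀ p q : Fin d, |ω p| < |ω q| →
      (ω p * ω q < 0 →
        (∃ k l : ℕ → ℕ, IsApproximating |ω q| (ω p) (ω q) k l) ∧
        ∀ C : ℝ, ∀ k l : ℕ → ℕ, IsApproximating C (ω p) (ω q) k l →
          YieldsDivergentBNF ω p q fun n => modeOpp p q n (k n) (l n)) ∧
      (0 < ω p * ω q →
        (∃ k l : ℕ → ℕ, IsApproximating |ω q| (ω p) (-ω q) k l) ∧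
        ∀ C : ℝ, ∀ k l : ℕ → ℕ, IsApproximating C (ω p) (-ω q) k l →
          YieldsDivergentBNF ω p q fun n => modeSame p q n (k n) (l n)) := by
  refine ⟨?_, fun p q hlt => ?_⟩
  -- For the existence statement any two distinct indices serve; the sign of the product of their
  -- frequencies selects the type of mode.
  · have hpq : (⟨0, by omega⟩ : Fin d) ≠ ⟨1, by omega⟩ := by simp
    rcases lt_or_gt_of_ne (mul_ne_zero (hω.ne_zero ⟨0, by omega⟩) (hω.ne_zero ⟨1, by omega⟩))
      with h | h
    · obtain ⟨k, l, hkl⟩ := exists_isApproximating_opp hω hpq h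
      exact (yieldsDivergentBNF_modeOpp hω hpq hkl).exists_hamiltonian
    · obtain ⟨k, l, hkl⟩ := exists_isApproximating_same hω hpq h
      exact (yieldsDivergentBNF_modeSame hω hpq hkl).exists_hamiltonian
  · have hpq : p ≠ q := by
      rintro rfl
      exact lt_irrefl _ hlt
    exact ⟨fun h => ⟨exists_isApproximating_opp hω hpq h,
        fun C k l hkl => yieldsDivergentBNF_modeOpp hω hpq hkl⟩,
      fun h => ⟨exists_isApproximating_same hω hpq h,
        fun C k l hkl => yieldsDivergentBNF_modeSame hω hpq hkl⟩⟩
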